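/- **Setting.** For $\alpha\ne\beta$ in $\{1,2\}$ let $\sigma_\alpha=\sigma_\alpha^c\cup\sigma_\alpha^d\subset\mathbb R$, where $\sigma_\alpha^c$ is a finite union of nondegenerate (bounded or unbounded) intervals and $\sigma_\alpha^d$ is a finite set of $N_\alpha$ points disjoint from $\sigma^c_\alpha$. Let $\mathcal G_\alpha(\lambda)$, $\lambda\in\sigma_\alpha$, be nonzero complex Hilbert spaces, equal to a fixed space $\mathcal G_\alpha^c$ for $\lambda\in\sigma_\alpha^c$ and finite-dimensional for $\lambda\in\sigma_\alpha^d$. Put $$\mathcal H_\alpha=L_2(\sigma_\alpha^c,\mathcal G_\alpha^c)\oplus\bigoplus_{\lambda\in\sigma_\alpha^d}\mathcal G_\alpha(\lambda),$$ let $A_\alpha$ be the self-adjoint operator $(A_\alpha f)(\lambda)=\lambda f(\lambda)$ on its natural domain and $E_\alpha$ its spectral measure. Assume $d_0=\mathrm{dist}(\sigma_1,\sigma_2)>0$. Write $\int_{\sigma_\alpha}^{\oplus}$ for the Lebesgue integral over $\sigma^c_\alpha$ plus the sum over $\sigma_\alpha^d$. An operator $T:\mathcal H_\beta\to\mathcal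 H_\alpha$ is an integral operator with kernel $F$, $F(\lambda,\mu):\mathcal G_\beta(\mu)\to\mathcal G_\alpha(\lambda)$, if $(Tf)(\lambda)=\int^{\oplus}_{\sigma_\beta}F(\lambda,\mu)f(\mu)\,d\mu$ for all $f$, for a.e. $\lambda\in\sigma_\alpha^c$ and all $\lambda\in\sigma_\alpha^d$. For $\theta>\frac12$ and $\frac12<\gamma<1$ the class $\mathcal B^{\alpha\beta}_{\theta\gamma}$ consists of the operator-valued kernels $F$ on $\sigma_\alpha\times\sigma_\beta$ with $\|F\|_{\mathcal B}<\infty$, where $$\begin{aligned}\|F\|_{\mathcal B}={}&\sup_{\lambda\in\sigma_\alpha,\ \mu\in\sigma_\beta}(1+|\lambda|)^\theta(1+|\mu|)^\theta|F(\lambda,\mu)|+\sup_{\lambda\ne\lambda'\in\sigma^c_\alpha,\ \mu\in\sigma_\beta}(1+|\mu|)^\theta\frac{|F(\lambda,\mu)-F(\lambda',\mu)|}{|\lambda-\lambda'|^\gamma}\\&+\sup_{\lambda\in\sigma_\alpha,\ \mu\ne\mu'\in\sigma^c_\beta}(1+|\lambda|)^\theta\frac{|F(\lambda,\mu)-F(\lambda,\mu')|}{|\mu-\mu'|^\gamma}\\&+\sup_{\lambda\ne\lambda'\in\sigma^c_\alpha,\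 \mu\ne\mu'\in\sigma^c_\beta}\frac{|F(\lambda,\mu)-F(\lambda',\mu)-F(\lambda,\mu')+F(\lambda',\mu')|}{|\lambda-\lambda'|^\gamma|\mu-\mu'|^\gamma}.\end{aligned}$$ For a bounded $B_{\beta\alpha}:\mathcal H_\alpha\to\mathcal H_\beta$ with $B_{\alpha\beta}=B_{\beta\alpha}^*$, the *basic equation* for a bounded operator $Q_{\beta\alpha}:\mathcal H_\alpha\to\mathcal H_\beta$ is $$Q_{\beta\alpha}=\int_{\sigma_\beta}E_\beta(d\mu)\,B_{\beta\alpha}\,(A_\alpha+B_{\alpha\beta}Q_{\beta\alpha}-\mu)^{-1},\tag{1}$$ where $\sigma_\beta$ is required to lie in the resolvent set of $A_\alpha+B_{\alpha\beta}Q_{\beta\alpha}$, and the integral is the operator-norm limit of the sums $\sum_kE_\beta(\Delta_k)B_{\beta\alpha}T_k$ belonging to simple functions that converge to the integrand $T(\mu)=(A_\alpha+B_{\alpha\beta}Q_{\beta\alpha}-\mu)^{-1}$ in $L_\infty$ with respect to $E_\beta$. **Statement.** For every $\theta>\frac12$ there is a constant $c=c(\theta)>0$ such that the following holds in every setting as above,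 for all $\frac12<\gamma<1$. Let $B_{\beta\alpha}$ be an integral operator with kernel in $\mathcal B^{\beta\alpha}_{\theta\gamma}$, and write $\|B_{\beta\alpha}\|_{\mathcal B}$ for the norm of the kernel. 1. Let $Q_{\beta\alpha}$ be a solution of (1), put $Q_{\alpha\beta}=-Q_{\beta\alpha}^*$, and suppose that with some $C_{\alpha\beta},C_{\beta\alpha}>0$ $$\|(A_\alpha+B_{\alpha\beta}Q_{\beta\alpha}-\mu)^{-1}\|\le\frac{C_{\alpha\beta}}{1+|\mu|}\ \ (\mu\in\sigma_\beta),\qquad\|(A_\beta+B_{\beta\alpha}Q_{\alpha\beta}-\lambda)^{-1}\|\le\frac{C_{\beta\alpha}}{1+|\lambda|}\ \ (\lambda\in\sigma_\alpha),$$ including the existence of these resolvents. Then (a) $Q_{\beta\alpha}$ is an integral operator with kernel in $\mathcal B^{\beta\alpha}_{\theta\gamma}$ and $$\|Q_{\beta\alpha}\|_{\mathcal B}\le\frac{c}{d_0}\bigl(1+d_0^{-\gamma}\bigr)^2\Bigl\{\|B_{\beta\alpha}\|_{\mathcal B}+(1+N_\alpha)(1+N_\beta)\bigl(C_{\alpha\beta}+C_{\alpha\beta}^{1+\gamma}\bigr)\bigl(C_{\beta\alpha}+C_{\beta\alpha}^{1+\gamma}\bigr)\|B_{\beta\alpha}\|_{\mathcal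 B}^3\Bigr\};$$ (b) $W_\alpha=B_{\alpha\beta}Q_{\beta\alpha}$ is an integral operator with kernel in $\mathcal B^{\alpha\alpha}_{\theta\gamma}$ and $$\|W_\alpha\|_{\mathcal B}\le c\,(1+N_\beta)\bigl(C_{\beta\alpha}+C_{\beta\alpha}^{1+\gamma}\bigr)\|B_{\beta\alpha}\|_{\mathcal B}^2 .$$ 2. Let $\delta>0$ and suppose that the Hilbert–Schmidt norm satisfies $\|B_{\alpha\beta}\|_2<d_0\min\bigl\{\frac1{1+\delta},\frac{\delta}{1+\delta^2}\bigr\}$. Then (1) has exactly one solution $Q_{\beta\alpha}$ with $\|Q_{\beta\alpha}\|\le\delta$, and for this solution $Q_{\beta\alpha}$ and $B_{\alpha\beta}Q_{\beta\alpha}$ are integral operators with kernels in $\mathcal B^{\beta\alpha}_{\theta\gamma}$ and $\mathcal B^{\alpha\alpha}_{\theta\gamma}$, respectively. -/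

import Mathlib

open MeasureTheory Filter Topology
open scoped ENNReal InnerProductSpace

universe u v

noncomputable section

namespace Friedrichs

/-- The data of one channel in the diagonal representation: the continuous spectrum is a finite
union of nondegenerate (bounded or unbounded, open, closed or half-open) intervals `I j`, the
discrete spectrum `disc` is a finite set disjoint from it, `Gc` is the fibre over every point of
the continuous spectrum (an arbitrary Hilbert space) and `Gd x` is the finite-dimensional fibre
over the point `x` of the discrete spectrum. -/
structure Channel where
  n : ℕ
  I : Fin n → Set ℝ
  ordConnected_I : ∀ j, (I j).OrdConnected
  nonempty_interior_I : ∀ j, (interior (I j)).Nonempty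
  disc : Finset ℝ
  disjoint_I_disc : ∀ j, Disjoint (I j) (disc : Set ℝ)
  Gc : Type u
  [normedGc : NormedAddCommGroup Gc]
  [innerGc : InnerProductSpace ℂ Gc]
  [completeGc : CompleteSpace Gc]
  [nontrivialGc : Nontrivial Gc]
  Gd : {x // x ∈ disc} → Type u
  [normedGd : ∀ x, NormedAddCommGroup (Gd x)]
  [innerGd : ∀ x, InnerProductSpace ℂ (Gd x)]
  [finiteGd : ∀ x, FiniteDimensional ℂ (Gd x)]
  [nontrivialGd : ∀ x, Nontrivial (Gd x)]

namespace Channel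

attribute [instance] normedGc innerGc completeGc nontrivialGc
attribute [instance] normedGd innerGd finiteGd nontrivialGd

variable (C : Channel.{u})

/-- The continuous spectrum. -/
def cont : Set ℝ := ⋃ j, C.I j

/-- The spectrum. -/
def spec : Set ℝ := C.cont ∪ C.disc

theorem measurableSet_cont : MeasurableSet C.cont :=
  MeasurableSet.iUnion fun j => (C.ordConnected_I j).measurableSet

/-- Lebesgue measure on the continuous spectrum. -/
def contMeasure : Measure C.cont := Measure.comap (↑) (volume : Measure ℝ)

/-- The points of the spectrum, sorted into continuous (`inl`) and discrete (`inr`) ones. -/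
abbrev Pt : Type := C.cont ⊕ {x // x ∈ C.disc}

/-- The real number underlying a point of the spectrum. -/
def pos : C.Pt → ℝ
  | .inl x => x
  | .inr x => x

/-- The fibre over a point of the spectrum. -/
def Fiber : C.Pt → Type u
  | .inl _ => C.Gc
  | .inr x => C.Gd x

instance instNormedFiber : ∀ x : C.Pt, NormedAddCommGroup (C.Fiber x)
  | .inl _ => inferInstanceAs (NormedAddCommGroup C.Gc)
  | .inr x => inferInstanceAs (NormedAddCommGroup (C.Gd x))

instance instInnerFiber : ∀ x : C.Pt, InnerProductSpace ℂ (C.Fiber x)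
  | .inl _ => inferInstanceAs (InnerProductSpace ℂ C.Gc)
  | .inr x => inferInstanceAs (InnerProductSpace ℂ (C.Gd x))

instance instCompleteFiber : ∀ x : C.Pt, CompleteSpace (C.Fiber x)
  | .inl _ => inferInstanceAs (CompleteSpace C.Gc)
  | .inr x => FiniteDimensional.complete ℂ (C.Gd x)

/-- The Hilbert space of the channel: the orthogonal sum of `L²(σᶜ, Gc)` and of the fibres over
the discrete spectrum. -/
abbrev Space : Type u := WithLp 2 (Lp C.Gc 2 C.contMeasure × PiLp 2 C.Gd)

/-- The value of (a representative of) an element of the Hilbert space at a point. -/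
def val (f : C.Space) : (x : C.Pt) → C.Fiber x
  | .inl x => (f.fst : C.cont → C.Gc) x
  | .inr x => f.snd x

/-- A property holds at almost every point of the continuous spectrum and at every point of the
discrete spectrum. -/
def AE (p : C.Pt → Prop) : Prop :=
  (∀ᵐ x ∂C.contMeasure, p (.inl x)) ∧ ∀ x, p (.inr x)

/-- The integral over the continuous spectrum plus the sum over the discrete spectrum. -/
def sumInt {E : Type*} [NormedAddCommGroup E] [NormedSpace ℝ E] (F : C.Pt → E) : E :=
  (∫ x, F (.inl x) ∂C.contMeasure) + ∑ x, F (.inr x)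

/-- A measure in the class of maximal spectral type: Lebesgue measure on the continuous spectrum,
unit masses on the discrete spectrum. -/
def specMeasure : Measure ℝ := volume.restrict C.cont + ∑ x ∈ C.disc, Measure.dirac x

theorem space_ext {f g : C.Space} (h : f.fst = g.fst) (h' : ∀ x, f.snd x = g.snd x) : f = g :=
  WithLp.ofLp_injective 2 (Prod.ext h (WithLp.ofLp_injective 2 (funext h')))

section Multiplication

variable {X G : Type*} [MeasurableSpace X] [NormedAddCommGroup G] [NormedSpace ℂ G]
  {m : Measure X}

theorem smul_coeFn_add (φ : X → ℂ) (f g : Lp G 2 m) :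
    (fun x => φ x • (f + g) x) =ᵐ[m] (fun x => φ x • f x) + fun x => φ x • g x := by
  filter_upwards [Lp.coeFn_add f g] with x hx
  rw [hx, Pi.add_apply, smul_add, Pi.add_apply]

theorem smul_coeFn_smul (φ : X → ℂ) (c : ℂ) (f : Lp G 2 m) :
    (fun x => φ x • (c • f) x) =ᵐ[m] c • fun x => φ x • f x := by
  filter_upwards [Lp.coeFn_smul c f] with x hx
  rw [hx, Pi.smul_apply, Pi.smul_apply, smul_comm]

theorem smul_coeFn_zero (φ : X → ℂ) : (fun x => φ x • (0 : Lp G 2 m) x) =ᵐ[m] 0 := by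
  filter_upwards [Lp.coeFn_zero G 2 m] with x hx
  rw [hx]
  exact smul_zero (φ x)

variable (G m) in
/-- The functions `f ∈ L²` with `φ f ∈ L²`. -/
def lpMulDomain (φ : X → ℂ) : Submodule ℂ (Lp G 2 m) where
  carrier := {f | MemLp (fun x => φ x • f x) 2 m}
  zero_mem' := (memLp_congr_ae (smul_coeFn_zero φ)).2 MemLp.zero
  add_mem' := fun {f g} hf hg => (memLp_congr_ae (smul_coeFn_add φ f g)).2 (MemLp.add hf hg)
  smul_mem' := fun c f hf => (memLp_congr_ae (smul_coeFn_smul φ c f)).2 (MemLp.const_smul hf c)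

variable (G m) in
/-- Multiplication by `φ` on its natural domain in `L²`. -/
def lpMul (φ : X → ℂ) : lpMulDomain G m φ →ₗ[ℂ] Lp G 2 m where
  toFun := fun f => MemLp.toLp (fun x => φ x • (f : Lp G 2 m) x) f.2
  map_add' := fun f g => by
    have hf : MemLp (fun x => φ x • (f : Lp G 2 m) x) 2 m := f.2
    have hg : MemLp (fun x => φ x • (g : Lp G 2 m) x) 2 m := g.2
    rw [← MemLp.toLp_add hf hg]
    exact MemLp.toLp_congr _ _ (smul_coeFn_add φ (f : Lp G 2 m) (g : Lp G 2 m))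
  map_smul' := fun c f => by
    have hf : MemLp (fun x => φ x • (f : Lp G 2 m) x) 2 m := f.2
    rw [RingHom.id_apply, ← MemLp.toLp_const_smul c hf]
    exact MemLp.toLp_congr _ _ (smul_coeFn_smul φ c (f : Lp G 2 m))

end Multiplication

/-- The operator of multiplication by the function `φ`, on its natural domain (all `f` for which
`φ f` is again square integrable). -/
def mulBy (φ : ℝ → ℂ) : C.Space →ₗ.[ℂ] C.Space where
  domain := (lpMulDomain C.Gc C.contMeasure (fun x : C.cont => φ x)).comap
    (WithLp.fstₗ 2 ℂ (Lp C.Gc 2 C.contMeasure) (PiLp 2 C.Gd))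
  toFun :=
    { toFun := fun f => WithLp.toLp 2
        (lpMul C.Gc C.contMeasure (fun x : C.cont => φ x) ⟨(f : C.Space).fst, f.2⟩,
          WithLp.toLp 2 fun x => φ x • (f : C.Space).snd x)
      map_add' := fun f g => C.space_ext
        ((lpMul C.Gc C.contMeasure (fun x : C.cont => φ x)).map_add
          ⟨(f : C.Space).fst, f.2⟩ ⟨(g : C.Space).fst, g.2⟩)
        (fun x => smul_add (φ x) ((f : C.Space).snd x) ((g : C.Space).snd x))
      map_smul' := fun c f => C.space_ext
        ((lpMul C.Gc C.contMeasure (fun x : C.cont => φ x)).map_smul c ⟨(f : C.Space).fst, f.2⟩)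
        (fun x => smul_comm (φ x) c ((f : C.Space).snd x)) }

/-- The operator of multiplication by the independent variable, on its natural domain. -/
def mulOp : C.Space →ₗ.[ℂ] C.Space := C.mulBy fun x => (x : ℂ)

open Classical in
/-- The characteristic function of `S`. -/
def char (S : Set ℝ) (x : ℝ) : ℂ := if x ∈ S then 1 else 0

theorem measurable_char {S : Set ℝ} (hS : MeasurableSet S) : Measurable (char S) :=
  Measurable.ite hS measurable_const measurable_const

theorem norm_char_smul_le (S : Set ℝ) (x : ℝ) {G : Type*} [NormedAddCommGroup G]
    [NormedSpace ℂ G] (v : G) : ‖char S x • v‖ ≤ ‖v‖ := by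
  by_cases h : x ∈ S <;> simp [char, h]

theorem memLp_char {S : Set ℝ} (hS : MeasurableSet S) (f : Lp C.Gc 2 C.contMeasure) :
    MemLp (fun x : C.cont => char S x • f x) 2 C.contMeasure :=
  (Lp.memLp f).of_le
    (((measurable_char hS).comp measurable_subtype_coe).aestronglyMeasurable.smul
      (Lp.aestronglyMeasurable f))
    (Eventually.of_forall fun x => norm_char_smul_le S x (f x))

theorem mem_domain_char {S : Set ℝ} (hS : MeasurableSet S) (f : C.Space) :
    f ∈ (C.mulBy (char S)).domain := C.memLp_char hS f.fst

/-- The multiplication by the characteristic function of the Borel set `S`, as an everywhere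
defined linear map. -/
def projLinear (S : Set ℝ) (hS : MeasurableSet S) : C.Space →ₗ[ℂ] C.Space :=
  (C.mulBy (char S)).toFun ∘ₗ LinearMap.codRestrict _ LinearMap.id (C.mem_domain_char hS)

theorem norm_projLinear_le (S : Set ℝ) (hS : MeasurableSet S) (f : C.Space) :
    ‖C.projLinear S hS f‖ ≤ 1 * ‖f‖ := by
  have h1 : ‖(C.projLinear S hS f).fst‖ ≤ ‖f.fst‖ := by
    apply Lp.norm_le_norm_of_ae_le
    filter_upwards [MemLp.coeFn_toLp (C.memLp_char hS f.fst)] with x hx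
    exact (congrArg norm hx).trans_le (norm_char_smul_le S x (f.fst x))
  have h2 : ‖(C.projLinear S hS f).snd‖ ^ 2 ≤ ‖f.snd‖ ^ 2 := by
    rw [PiLp.norm_sq_eq_of_L2, PiLp.norm_sq_eq_of_L2]
    exact Finset.sum_le_sum fun x _ =>
      pow_le_pow_left₀ (norm_nonneg _) (norm_char_smul_le S x (f.snd x)) 2
  rw [one_mul, ← sq_le_sq₀ (norm_nonneg _) (norm_nonneg _), WithLp.prod_norm_sq_eq_of_L2,
    WithLp.prod_norm_sq_eq_of_L2]
  exact add_le_add (pow_le_pow_left₀ (norm_nonneg _) h1 2) h2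

/-- The spectral projection of `mulOp` for the Borel set `S`. -/
def proj (S : Set ℝ) (hS : MeasurableSet S) : C.Space →L[ℂ] C.Space :=
  (C.projLinear S hS).mkContinuous 1 (C.norm_projLinear_le S hS)

end Channel

/-- The distance between the spectra of two channels. -/
def specDist (C : Channel.{u}) (D : Channel.{v}) : ℝ :=
  sInf (Set.image2 (fun x y => |x - y|) C.spec D.spec)

/-- Operator-valued kernels on `σ(C) × σ(D)`: the value at `(x, y)` maps the fibre of `D` over
`y` to the fibre of `C` over `x`. -/
def Kernel (C : Channel.{u}) (D : Channel.{v}) : Type (max u v) :=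
  (x : C.Pt) → (y : D.Pt) → D.Fiber y →L[ℂ] C.Fiber x

namespace Kernel

variable {C : Channel.{u}} {D : Channel.{v}} (F : Kernel C D)

/-- The kernel at points with `x` in the continuous spectrum, where the fibre is constant. -/
def left (x : C.cont) (y : D.Pt) : D.Fiber y →L[ℂ] C.Gc := F (.inl x) y

/-- The kernel at points with `y` in the continuous spectrum, where the fibre is constant. -/
def right (x : C.Pt) (y : D.cont) : D.Gc →L[ℂ] C.Fiber x := F x (.inl y)

/-- The kernel on the product of the continuous spectra. -/
def both (x : C.cont) (y : D.cont) : D.Gc →L[ℂ] C.Gc := F (.inl x) (.inl y)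

/-- The weighted Hölder norm with weight exponent `θ` and Hölder exponent `γ`, with values in
`[0, ∞]`. (For coinciding points a quotient reads `0 / 0 = 0` and does not contribute.) -/
def holderNorm (θ γ : ℝ) : ℝ≥0∞ :=
  (⨆ (x : C.Pt) (y : D.Pt),
      ENNReal.ofReal ((1 + |C.pos x|) ^ θ * (1 + |D.pos y|) ^ θ * ‖F x y‖)) +
  (⨆ (x : C.cont) (x' : C.cont) (y : D.Pt),
      ENNReal.ofReal ((1 + |D.pos y|) ^ θ *
        (‖F.left x y - F.left x' y‖ / |(x : ℝ) - x'| ^ γ))) +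
  (⨆ (x : C.Pt) (y : D.cont) (y' : D.cont),
      ENNReal.ofReal ((1 + |C.pos x|) ^ θ *
        (‖F.right x y - F.right x y'‖ / |(y : ℝ) - y'| ^ γ))) +
  (⨆ (x : C.cont) (x' : C.cont) (y : D.cont) (y' : D.cont),
      ENNReal.ofReal (‖F.both x y - F.both x' y - F.both x y' + F.both x' y'‖ /
        (|(x : ℝ) - x'| ^ γ * |(y : ℝ) - y'| ^ γ)))

/-- Membership in the weighted Hölder class. -/
def InClass (θ γ : ℝ) : Prop := F.holderNorm θ γ < ∞

end Kernel

/-- `T` is the integral operator with kernel `F`. -/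
def IsIntegralOperator {C : Channel.{u}} {D : Channel.{v}} (T : D.Space →L[ℂ] C.Space)
    (F : Kernel C D) : Prop :=
  ∀ f : D.Space, C.AE fun x =>
    Integrable (fun y : D.cont => F x (.inl y) (D.val f (.inl y))) D.contMeasure ∧
      C.val (T f) x = D.sumInt fun y => F x y (D.val f y)

/-- `R` is the resolvent `(T - z)⁻¹` of the partially defined operator `T`, i.e. `z` lies in the
resolvent set of `T` and `R` is the bounded inverse of `T - z`. -/
def IsResolvent {E : Type*} [NormedAddCommGroup E] [NormedSpace ℂ E]
    (T : E →ₗ.[ℂ] E) (z : ℂ) (R : E →L[ℂ] E) : Prop :=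
  (∀ f : E, ∃ h : R f ∈ T.domain, T ⟨R f, h⟩ - z • R f = f) ∧
    ∀ f : T.domain, R (T f - z • (f : E)) = f

/-- The operator `A + W` for the multiplication operator `A` of a channel and a bounded `W`,
defined on the domain of `A`. -/
def perturbed (C : Channel.{u}) (W : C.Space →L[ℂ] C.Space) : C.Space →ₗ.[ℂ] C.Space :=
  (W : C.Space →ₗ[ℂ] C.Space) +ᵥ C.mulOp

/-- The resolvent estimate `‖(A + W - μ)⁻¹‖ ≤ K / (1 + |μ|)` for all `μ` in the spectrum of the
channel `D`, including the existence of these resolvents. -/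
def ResolventBound (C : Channel.{u}) (D : Channel.{v}) (W : C.Space →L[ℂ] C.Space) (K : ℝ) :
    Prop :=
  ∀ μ ∈ D.spec, ∃ R : C.Space →L[ℂ] C.Space,
    IsResolvent (perturbed C W) (μ : ℂ) R ∧ ‖R‖ ≤ K / (1 + |μ|)

/-- The integral sum `∑ₖ E(Δₖ) B Tₖ` of a simple function with value `Tₖ` on the set `Δₖ`, where
`E` is the spectral measure of the channel `D`. -/
def spectralSum {C : Channel.{u}} {D : Channel.{v}} (B : C.Space →L[ℂ] D.Space)
    (S : SimpleFunc ℝ (C.Space →L[ℂ] C.Space)) : C.Space →L[ℂ] D.Space :=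
  ∑ T ∈ S.range, (D.proj (S ⁻¹' {T}) (S.measurableSet_fiber T)) ∘L B ∘L T

/-- `X = ∫ E(dμ) B T(μ)` for the spectral measure `E` of the channel `D`: the operator `X` is the
limit in operator norm of integral sums of simple functions that converge to `T` in
`L_∞` with respect to `E`. -/
def IsSpectralIntegral {C : Channel.{u}} {D : Channel.{v}} (B : C.Space →L[ℂ] D.Space)
    (T : ℝ → C.Space →L[ℂ] C.Space) (X : C.Space →L[ℂ] D.Space) : Prop :=
  ∃ S : ℕ → SimpleFunc ℝ (C.Space →L[ℂ] C.Space),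
    (∀ ε > 0, ∀ᶠ n in atTop, ∀ᵐ μ ∂D.specMeasure, ‖S n μ - T μ‖ ≤ ε) ∧
      Tendsto (fun n => spectralSum B (S n)) atTop (𝓝 X)

/-- `Q` solves the basic equation `Q = ∫ E_β(dμ) B (A_α + B* Q - μ)⁻¹`, where `B = B_βα` and
`B* = B_αβ`; the spectrum of `β` lies in the resolvent set of `A_α + B* Q`. -/
def IsBasicSolution {α : Channel.{u}} {β : Channel.{v}} (B Q : α.Space →L[ℂ] β.Space) : Prop :=
  ∃ R : ℝ → α.Space →L[ℂ] α.Space,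
    (∀ μ ∈ β.spec, IsResolvent (perturbed α (B.adjoint ∘L Q)) (μ : ℂ) (R μ)) ∧
      IsSpectralIntegral B R Q

/-- The Hilbert-Schmidt norm with values in `[0, ∞]`: the square root of the supremum of
`∑ ‖T e‖²` over the finite orthonormal systems. -/
def hilbertSchmidtNorm {E F : Type*} [NormedAddCommGroup E] [InnerProductSpace ℂ E]
    [NormedAddCommGroup F] [NormedSpace ℂ F] (T : E →L[ℂ] F) : ℝ≥0∞ :=
  (⨆ (s : Finset E) (_ : Orthonormal ℂ ((↑) : {e // e ∈ s} → E)), ∑ e ∈ s, ‖T e‖ₑ ^ 2) ^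
    (1 / 2 : ℝ)

end Friedrichs

end

/-!
Write `A` for the multiplication operators, `R(μ) = (A + B* Q - μ)⁻¹` and
`S(λ) = (A - B Q* - λ)⁻¹`. A kernel of the Hölder class is a family of rows
`r(μ) f = ∫ b(μ, λ) f(λ) dλ`, and because `2θ > 1` these rows are bounded operators that inherit the
weight and the Hölder continuity (`Kernel.HolderBound.rowBound`). The adjoint `B*` is the integral
operator with the adjoint kernel, with rows `s(λ)` (`Kernel.HolderBound.val_adjoint`).

**Pointwise form of the basic equation.** An integral sum acts at the point `μ` as `r(μ)` composed
with the value of the simple function at `μ`. Passing to the limit, a solution satisfies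
`(Q f)(μ) = r(μ) R(μ) f` (`IsSpectralIntegral.val_eq`). This implies the Riccati equation
`Q A - A Q + Q B* Q = B` (`isMul_solution`), hence the dual Riccati equation for `Q*`, and hence the
dual basic equation `(Q* k)(λ) = -s(λ) S(λ) k` (`val_adjoint_solution`). The last step is a
uniqueness statement: the dual Riccati equation gives
`(Q* k)(x) + s(x) S(t) k = (x - t) (Q* S(t) k)(x)`, so that the defect of the dual basic equation is
of first order in the length of the interval around `t`; its square integral over the interval is
then of second order, and a measure with this property vanishes (`measure_eq_zero_of_le_sq`).

**Kernels.** If `U(x)` and `V(y)` are two families of operators with the bounds of rows, then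
`U(x) V(y)*` is a kernel of the class (`RowBound.sandwich`). The dual basic equation shows that
`B* Q` has the kernel `-s(λ) (s(λ') S(λ'))*`. For `Q` itself, composing
`r(μ) = r(μ) R(μ) (A + B* Q - μ)` with `(A - μ)⁻¹` gives the kernel
`(b(μ, λ) + r(μ) R(μ) (s(λ) S(λ) B)*) / (λ - μ)` (`isIntegralOperator_divDiff`). Division by `λ - μ`
preserves the class, since `|λ - μ| ≥ d₀` (`Kernel.HolderBound.divDiff`). The Hölder exponent comes
from interpolating between Lipschitz and uniform bounds, for `1 / (λ - μ)` as for the resolvents,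
which yields the powers `d₀ ^ (-γ)` and `K ^ (1 + γ)`.

**Existence and uniqueness.** The right-hand side of the basic equation is bounded by the
Hilbert-Schmidt norm of `B*` times the supremum of the integrand, because the pieces
`E(Δₖ) B Tₖ f` are orthogonal (`norm_spectralSum_le`). Together with the Neumann series for the
resolvents this makes it a contraction of the ball of radius `δ` (`IsSmall.norm_image_sub_le`). The
Neumann series also provides the decay of the resolvents at infinity that the first part assumes:
at most one of the two spectra is unbounded in each direction, so the distance from `μ` to the other
spectrum grows linearly (`exists_dist_bound`).
-/

noncomputable section

namespace Friedrichs

open Channel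

/-! ### The Hilbert space of a channel -/

namespace Channel

variable (C : Channel.{u})

/-- The filter of the sets of full measure: almost every point of the continuous spectrum and
every point of the discrete one. -/
def aeFilter : Filter C.Pt := (ae C.contMeasure).map Sum.inl ⊔ (⊤ : Filter _).map Sum.inr

variable {C}

theorem eventually_aeFilter {p : C.Pt → Prop} : (∀ᶠ x in C.aeFilter, p x) ↔ C.AE p := by
  rw [aeFilter, eventually_sup, eventually_map, eventually_map, eventually_top, AE]

theorem map_contMeasure :
    C.contMeasure.map ((↑) : C.cont → ℝ) = (volume : Measure ℝ).restrict C.cont :=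
  map_comap_subtype_coe C.measurableSet_cont volume

instance : SigmaFinite C.contMeasure :=
  SigmaFinite.of_map _ measurable_subtype_coe.aemeasurable
    (map_contMeasure (C := C) ▸ inferInstance)

theorem val_add (f g : C.Space) :
    ∀ᶠ x in C.aeFilter, C.val (f + g) x = C.val f x + C.val g x :=
  eventually_aeFilter.2 ⟨Lp.coeFn_add f.fst g.fst, fun _ => rfl⟩

theorem val_sub (f g : C.Space) :
    ∀ᶠ x in C.aeFilter, C.val (f - g) x = C.val f x - C.val g x :=
  eventually_aeFilter.2 ⟨Lp.coeFn_sub f.fst g.fst, fun _ => rfl⟩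

theorem val_smul (c : ℂ) (f : C.Space) :
    ∀ᶠ x in C.aeFilter, C.val (c • f) x = c • C.val f x :=
  eventually_aeFilter.2 ⟨Lp.coeFn_smul c f.fst, fun _ => rfl⟩

theorem val_neg (f : C.Space) : ∀ᶠ x in C.aeFilter, C.val (-f) x = -C.val f x :=
  eventually_aeFilter.2 ⟨Lp.coeFn_neg f.fst, fun _ => rfl⟩

theorem val_zero : ∀ᶠ x in C.aeFilter, C.val (0 : C.Space) x = 0 :=
  eventually_aeFilter.2 ⟨Lp.coeFn_zero C.Gc 2 C.contMeasure, fun _ => rfl⟩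

theorem val_sum {ι : Type*} (s : Finset ι) (f : ι → C.Space) :
    ∀ᶠ x in C.aeFilter, C.val (∑ i ∈ s, f i) x = ∑ i ∈ s, C.val (f i) x := by
  classical
  induction s using Finset.induction_on with
  | empty => simpa using val_zero
  | insert a s ha ih =>
    filter_upwards [ih, val_add (f a) (∑ i ∈ s, f i)] with x h1 h2
    rw [Finset.sum_insert ha, Finset.sum_insert ha, h2, h1]

theorem ext_val {f g : C.Space} (h : ∀ᶠ x in C.aeFilter, C.val f x = C.val g x) : f = g := by
  obtain ⟨h1, h2⟩ := eventually_aeFilter.1 h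
  exact C.space_ext (Lp.ext h1) h2

/-- A section of the fibres that is square integrable over the continuous spectrum is represented
by an element of the Hilbert space. -/
theorem exists_val_eq (φ : (x : C.Pt) → C.Fiber x)
    (h : MemLp (fun x : C.cont => (φ (.inl x) : C.Gc)) 2 C.contMeasure) :
    ∃ f : C.Space, ∀ᶠ x in C.aeFilter, C.val f x = φ x :=
  ⟨WithLp.toLp 2 (h.toLp _, WithLp.toLp 2 fun x => φ (.inr x)),
    eventually_aeFilter.2 ⟨h.coeFn_toLp, fun _ => rfl⟩⟩

theorem sumInt_congr {E : Type*} [NormedAddCommGroup E] [NormedSpace ℝ E] {F G : C.Pt → E}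
    (h : ∀ᶠ x in C.aeFilter, F x = G x) : C.sumInt F = C.sumInt G := by
  obtain ⟨h1, h2⟩ := eventually_aeFilter.1 h
  exact congrArg₂ (· + ·) (integral_congr_ae h1) (Finset.sum_congr rfl fun x _ => h2 x)

theorem inner_eq_sumInt (f g : C.Space) :
    ⟪f, g⟫_ℂ = C.sumInt fun x => ⟪C.val f x, C.val g x⟫_ℂ := by
  rw [WithLp.prod_inner_apply]
  change ⟪f.fst, g.fst⟫_ℂ + ⟪f.snd, g.snd⟫_ℂ = _
  rw [L2.inner_def, PiLp.inner_apply]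
  rfl

theorem memLp_val (f : C.Space) :
    MemLp (fun x : C.cont => (C.val f (.inl x) : C.Gc)) 2 C.contMeasure :=
  Lp.memLp f.fst

/-- The null sets of the spectral measure contain no point of the discrete spectrum. -/
theorem eventually_specMeasure {p : ℝ → Prop} :
    (∀ᵐ x ∂C.specMeasure, p x) ↔ ∀ᶠ x in C.aeFilter, p (C.pos x) := by
  rw [eventually_aeFilter, specMeasure, ae_add_measure_iff,
    ae_restrict_iff_subtype C.measurableSet_cont]
  refine and_congr Iff.rfl ?_
  have : ∀ s : Finset ℝ, (∀ᵐ x ∂(∑ y ∈ s, Measure.dirac y), p x) ↔ ∀ y ∈ s, p y := by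
    classical
    intro s
    induction s using Finset.induction_on with
    | empty => simp
    | insert a s ha ih =>
      rw [Finset.sum_insert ha, ae_add_measure_iff, ih, ae_dirac_eq]
      simp
  rw [this]
  exact ⟨fun h x => h x x.2, fun h y hy => h ⟨y, hy⟩⟩

theorem pos_mem_spec (x : C.Pt) : C.pos x ∈ C.spec := by
  rcases x with x | x
  · exact Or.inl x.2
  · exact Or.inr x.2

end Channel

/-! ### The weight, and integration against weighted forms -/

/-- The weight of the kernel class. -/
def weight (θ t : ℝ) : ℝ := (1 + |t|) ^ (-θ)

theorem weight_pos (θ t : ℝ) : 0 < weight θ t := by unfold weight; positivity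

theorem weight_le_one {θ : ℝ} (hθ : 1 / 2 < θ) (t : ℝ) : weight θ t ≤ 1 :=
  Real.rpow_le_one_of_one_le_of_nonpos (by linarith [abs_nonneg t]) (by linarith)

theorem continuous_weight (θ : ℝ) : Continuous (weight θ) :=
  (continuous_const.add continuous_abs).rpow_const fun t =>
    Or.inl (show (0 : ℝ) < 1 + |t| by positivity).ne'

theorem memLp_weight {θ : ℝ} (hθ : 1 / 2 < θ) : MemLp (weight θ) 2 (volume : Measure ℝ) := by
  rw [memLp_two_iff_integrable_sq_norm (continuous_weight θ).aestronglyMeasurable]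
  have h : Integrable (fun x : ℝ => (1 + ‖x‖) ^ (-(2 * θ))) volume :=
    integrable_one_add_norm (by simp; linarith)
  refine h.congr (Eventually.of_forall fun t => ?_)
  have h0 : (0 : ℝ) ≤ 1 + |t| := by positivity
  simp only [weight, Real.norm_eq_abs, sq_abs]
  rw [← Real.rpow_natCast, ← Real.rpow_mul h0]
  congr 1
  push_cast
  ring

/-- The norm of the weight in `L²(ℝ)`. -/
def weightNorm (θ : ℝ) : ℝ := (eLpNorm (weight θ) 2 (volume : Measure ℝ)).toReal

theorem weightNorm_nonneg (θ : ℝ) : 0 ≤ weightNorm θ := ENNReal.toReal_nonneg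

namespace Channel

variable {C : Channel.{u}} {θ A : ℝ}

variable (C) in
/-- A bound for the norm of the weight in `L²` of the continuous spectrum plus that in `ℓ²` of the
discrete one. The summand `1` makes it positive and lets the number of the discrete points enter
through the factor `√(1 + N)` only. -/
def mass (θ : ℝ) : ℝ := (weightNorm θ + 1) * √(1 + C.disc.card)

theorem mass_pos : 0 < C.mass θ := by
  have := weightNorm_nonneg θ
  unfold mass
  positivity

theorem le_mass : weightNorm θ + √C.disc.card ≤ C.mass θ := by
  have h1 : 1 ≤ √(1 + (C.disc.card : ℝ)) := by
    rw [Real.one_le_sqrt]; linarith [Nat.cast_nonneg (α := ℝ) C.disc.card]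
  have h2 : √(C.disc.card : ℝ) ≤ √(1 + (C.disc.card : ℝ)) := Real.sqrt_le_sqrt (by linarith)
  unfold mass
  nlinarith [weightNorm_nonneg θ]

theorem memLp_weight_cont (hθ : 1 / 2 < θ) :
    MemLp (fun x : C.cont => weight θ x) 2 C.contMeasure := by
  have h := (memLp_weight hθ).restrict C.cont
  rw [← map_contMeasure] at h
  exact h.comp_of_map measurable_subtype_coe.aemeasurable

theorem norm_weight_cont_le (hθ : 1 / 2 < θ) :
    ‖(memLp_weight_cont (C := C) hθ).toLp _‖ ≤ weightNorm θ := by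
  rw [Lp.norm_toLp, weightNorm]
  refine ENNReal.toReal_mono (memLp_weight hθ).2.ne ?_
  have h := eLpNorm_map_measure (p := 2) (f := ((↑) : C.cont → ℝ)) (μ := C.contMeasure)
    (g := weight θ) (continuous_weight θ).aestronglyMeasurable
    measurable_subtype_coe.aemeasurable
  rw [map_contMeasure] at h
  exact h.symm.trans_le (eLpNorm_mono_measure _ Measure.restrict_le_self)

/-- Here `2θ > 1` enters: the weight is square integrable, so that a pointwise bound by it is a
bound in norm. -/
theorem norm_le_of_val_le (hθ : 1 / 2 < θ) (hA : 0 ≤ A) {f : C.Space}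
    (h : ∀ᶠ x in C.aeFilter, ‖C.val f x‖ ≤ A * weight θ (C.pos x)) : ‖f‖ ≤ A * C.mass θ := by
  obtain ⟨h1, h2⟩ := eventually_aeFilter.1 h
  have e1 : ‖f.fst‖ ≤ A * weightNorm θ := by
    refine (Lp.norm_le_mul_norm_of_ae_le_mul (g := (memLp_weight_cont hθ).toLp _) (c := A)
      ?_).trans (mul_le_mul_of_nonneg_left (norm_weight_cont_le hθ) hA)
    filter_upwards [h1, (memLp_weight_cont (C := C) hθ).coeFn_toLp] with x hx hx'
    rw [hx', Real.norm_of_nonneg (weight_pos θ _).le]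
    exact hx
  have e2 : ‖f.snd‖ ≤ A * √C.disc.card := by
    rw [← sq_le_sq₀ (norm_nonneg _) (by positivity), PiLp.norm_sq_eq_of_L2, mul_pow,
      Real.sq_sqrt (Nat.cast_nonneg _)]
    refine (Finset.sum_le_card_nsmul _ _ (A ^ 2) fun x _ => ?_).trans_eq ?_
    · exact pow_le_pow_left₀ (norm_nonneg _)
        ((h2 x).trans (mul_le_of_le_one_right hA (weight_le_one hθ _))) 2
    · simp [mul_comm]
  have e3 : ‖f‖ ≤ ‖f.fst‖ + ‖f.snd‖ := by
    refine abs_le_of_sq_le_sq' ?_ (by positivity) |>.2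
    rw [WithLp.prod_norm_sq_eq_of_L2]
    nlinarith [norm_nonneg f.fst, norm_nonneg f.snd]
  calc ‖f‖ ≤ A * (weightNorm θ + √C.disc.card) := by linarith
    _ ≤ A * C.mass θ := mul_le_mul_of_nonneg_left le_mass hA

variable {E : Type*} [NormedAddCommGroup E] [InnerProductSpace ℂ E]

/-- The restriction of a family of operators on the fibres to the continuous spectrum, where the
fibre is constant. -/
def contForm (k : (x : C.Pt) → C.Fiber x →L[ℂ] E) (x : C.cont) : C.Gc →L[ℂ] E := k (.inl x)

/-- A family of operators from the fibres to a fixed space that is continuous on the continuous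
spectrum and dominated by the weight; integration against it is a bounded operator. -/
structure IsWeightedForm (θ A : ℝ) (k : (x : C.Pt) → C.Fiber x →L[ℂ] E) : Prop where
  continuous : Continuous (contForm k)
  bound : ∀ x, ‖k x‖ ≤ A * weight θ (C.pos x)

namespace IsWeightedForm

variable {k : (x : C.Pt) → C.Fiber x →L[ℂ] E} (hk : IsWeightedForm θ A k) (hθ : 1 / 2 < θ)

include hk

theorem ae_bound : ∀ᵐ x : C.cont ∂C.contMeasure, ‖contForm k x‖ ≤
    A * ‖weight θ (x : ℝ)‖ := Eventually.of_forall fun x => by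
  rw [Real.norm_of_nonneg (weight_pos θ _).le]
  exact hk.bound (.inl x)

include hθ

theorem memLp : MemLp (contForm k) 2 C.contMeasure :=
  (memLp_weight_cont hθ).of_le_mul hk.continuous.aestronglyMeasurable hk.ae_bound

theorem integrable (f : C.Space) :
    Integrable (fun x : C.cont => k (.inl x) (C.val f (.inl x))) C.contMeasure :=
  memLp_one_iff_integrable.1
    ((ContinuousLinearMap.id ℂ (C.Gc →L[ℂ] E)).memLp_of_bilin 1 (hk.memLp hθ) (memLp_val f))

theorem norm_sumInt_le (hA : 0 ≤ A) (f : C.Space) :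
    ‖C.sumInt fun x => k x (C.val f x)‖ ≤ A * C.mass θ * ‖f‖ := by
  have e1 : ‖∫ x : C.cont, k (.inl x) (C.val f (.inl x)) ∂C.contMeasure‖ ≤
      A * weightNorm θ * ‖f‖ := by
    set L := (ContinuousLinearMap.id ℂ (C.Gc →L[ℂ] E))
    have h := L.coeFn_holder (r := 1) ((hk.memLp hθ).toLp _) f.fst
    have h' : ∀ᵐ x ∂C.contMeasure, (L.holder 1 ((hk.memLp hθ).toLp _) f.fst : C.cont → E) x =
        k (.inl x) (C.val f (.inl x)) := by
      filter_upwards [h, (hk.memLp hθ).coeFn_toLp] with x hx hx'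
      rw [hx, hx']
      rfl
    rw [← integral_congr_ae h']
    calc _ ≤ _ := norm_integral_le_integral_norm _
      _ = ‖L.holder 1 ((hk.memLp hθ).toLp _) f.fst‖ := (L1.norm_eq_integral_norm _).symm
      _ ≤ _ := L.norm_holder_apply_apply_le _ _
      _ ≤ 1 * (A * weightNorm θ) * ‖f‖ := by
        have h0 : 0 ≤ A * weightNorm θ := mul_nonneg hA (weightNorm_nonneg θ)
        gcongr
        · exact ContinuousLinearMap.norm_id_le
        · refine (Lp.norm_le_mul_norm_of_ae_le_mul (g := (memLp_weight_cont hθ).toLp _) (c := A)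
            ?_).trans (mul_le_mul_of_nonneg_left (norm_weight_cont_le hθ) hA)
          filter_upwards [hk.ae_bound, (memLp_weight_cont (C := C) hθ).coeFn_toLp,
            (hk.memLp hθ).coeFn_toLp] with x hx hx' hx''
          rw [hx', hx'']
          exact hx
        · exact WithLp.norm_fst_le _ _
      _ = _ := by ring
  have e2 : ‖∑ x, k (.inr x) (C.val f (.inr x))‖ ≤ A * √C.disc.card * ‖f‖ := by
    have h1 : ‖∑ x, k (.inr x) (C.val f (.inr x))‖ ≤ ∑ x, A * ‖f.snd x‖ := by
      refine (norm_sum_le _ _).trans (Finset.sum_le_sum fun x _ => ?_)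
      refine (k (.inr x)).le_of_opNorm_le ((hk.bound _).trans ?_) _
      exact mul_le_of_le_one_right hA (weight_le_one hθ _)
    have h2 : ∑ x, ‖f.snd x‖ ≤ √C.disc.card * ‖f.snd‖ := by
      refine abs_le_of_sq_le_sq' ?_ (by positivity) |>.2
      rw [mul_pow, Real.sq_sqrt (Nat.cast_nonneg _), PiLp.norm_sq_eq_of_L2]
      refine sq_sum_le_card_mul_sum_sq.trans_eq ?_
      simp
    have h3 : ‖f.snd‖ ≤ ‖f‖ := WithLp.norm_snd_le _ _
    calc _ ≤ A * ∑ x, ‖f.snd x‖ := h1.trans_eq (Finset.mul_sum _ _ _).symm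
      _ ≤ A * (√C.disc.card * ‖f‖) := by gcongr; exact h2.trans (by gcongr)
      _ = _ := by ring
  calc _ ≤ _ := norm_add_le _ _
    _ ≤ A * (weightNorm θ + √C.disc.card) * ‖f‖ := by linarith
    _ ≤ _ := by gcongr; exact le_mass

end IsWeightedForm

theorem sumInt_add {F G : C.Pt → E} (hF : Integrable (fun x => F (.inl x)) C.contMeasure)
    (hG : Integrable (fun x => G (.inl x)) C.contMeasure) :
    C.sumInt (fun x => F x + G x) = C.sumInt F + C.sumInt G := by
  simp only [sumInt]
  rw [integral_add hF hG, Finset.sum_add_distrib]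
  abel

theorem sumInt_sub {F G : C.Pt → E} (hF : Integrable (fun x => F (.inl x)) C.contMeasure)
    (hG : Integrable (fun x => G (.inl x)) C.contMeasure) :
    C.sumInt (fun x => F x - G x) = C.sumInt F - C.sumInt G := by
  simp only [sumInt]
  rw [integral_sub hF hG, Finset.sum_sub_distrib]
  abel

theorem sumInt_smul (c : ℂ) (F : C.Pt → E) :
    C.sumInt (fun x => c • F x) = c • C.sumInt F := by
  simp only [sumInt]
  rw [integral_smul, ← Finset.smul_sum, smul_add]

theorem sumInt_inner [CompleteSpace E] (e : E) {F : C.Pt → E}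
    (hF : Integrable (fun x => F (.inl x)) C.contMeasure) :
    C.sumInt (fun x => ⟪e, F x⟫_ℂ) = ⟪e, C.sumInt F⟫_ℂ := by
  simp only [sumInt]
  rw [integral_inner hF, inner_add_right, inner_sum]

/-- Integration against a weighted form as a bounded operator. -/
def formOp {k : (x : C.Pt) → C.Fiber x →L[ℂ] E} (hk : IsWeightedForm θ A k) (hθ : 1 / 2 < θ)
    (hA : 0 ≤ A) : C.Space →L[ℂ] E :=
  LinearMap.mkContinuous
    { toFun := fun f => C.sumInt fun x => k x (C.val f x)
      map_add' := fun f g => by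
        rw [← sumInt_add (hk.integrable hθ f) (hk.integrable hθ g)]
        refine sumInt_congr ?_
        filter_upwards [val_add f g] with x hx
        rw [hx, map_add]
      map_smul' := fun c f => by
        rw [RingHom.id_apply, ← sumInt_smul]
        refine sumInt_congr ?_
        filter_upwards [val_smul c f] with x hx
        rw [hx, map_smul] }
    (A * C.mass θ) (hk.norm_sumInt_le hθ hA)

theorem norm_formOp_le {k : (x : C.Pt) → C.Fiber x →L[ℂ] E} (hk : IsWeightedForm θ A k)
    (hθ : 1 / 2 < θ) (hA : 0 ≤ A) : ‖formOp hk hθ hA‖ ≤ A * C.mass θ :=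
  LinearMap.mkContinuous_norm_le _ (mul_nonneg hA mass_pos.le) _

end Channel

/-! ### Kernels of the Hölder class -/

namespace Kernel

variable {C : Channel.{u}} {D : Channel.{v}} {θ γ M : ℝ}

/-- The four estimates that make up the weighted Hölder norm, with a common constant. -/
structure HolderBound (F : Kernel C D) (θ γ M : ℝ) : Prop where
  bound : ∀ x y, ‖F x y‖ ≤ M * weight θ (C.pos x) * weight θ (D.pos y)
  left : ∀ (x x' : C.cont) y, ‖F.left x y - F.left x' y‖ ≤
    M * |(x : ℝ) - x'| ^ γ * weight θ (D.pos y)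
  right : ∀ x (y y' : D.cont), ‖F.right x y - F.right x y'‖ ≤
    M * weight θ (C.pos x) * |(y : ℝ) - y'| ^ γ
  both : ∀ (x x' : C.cont) (y y' : D.cont),
    ‖F.both x y - F.both x' y - F.both x y' + F.both x' y'‖ ≤
      M * |(x : ℝ) - x'| ^ γ * |(y : ℝ) - y'| ^ γ

theorem inv_weight (θ t : ℝ) : (1 + |t|) ^ θ = (weight θ t)⁻¹ := by
  rw [weight, Real.rpow_neg (by positivity), inv_inv]

/-- For coinciding points the quotients in the norm carry no information, but there both sides of
the estimates vanish. -/
theorem inClass_holderBound {F : Kernel C D} (hF : F.InClass θ γ) (hγ : 0 < γ) :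
    F.HolderBound θ γ (F.holderNorm θ γ).toReal := by
  have hfin : F.holderNorm θ γ ≠ ∞ := hF.ne
  have key : ∀ t : ℝ, ENNReal.ofReal t ≤ F.holderNorm θ γ → t ≤ (F.holderNorm θ γ).toReal :=
    fun t ht => (ENNReal.ofReal_le_iff_le_toReal hfin).1 ht
  have zero : ∀ x : ℝ, |x - x| ^ γ = 0 := fun x => by
    rw [sub_self, abs_zero, Real.zero_rpow hγ.ne']
  refine ⟨fun x y => ?_, fun x x' y => ?_, fun x y y' => ?_, fun x x' y y' => ?_⟩
  · have h := key ((1 + |C.pos x|) ^ θ * (1 + |D.pos y|) ^ θ * ‖F x y‖) <| by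
      rw [holderNorm, add_assoc, add_assoc]
      exact le_add_right (le_iSup₂_of_le x y le_rfl)
    have h1 := weight_pos θ (C.pos x)
    have h2 := weight_pos θ (D.pos y)
    rw [inv_weight, inv_weight, ← mul_inv, inv_mul_le_iff₀ (by positivity)] at h
    linarith
  · by_cases hx : x = x'
    · subst hx; rw [sub_self, norm_zero, zero]; simp
    have h := key ((1 + |D.pos y|) ^ θ *
        (‖F.left x y - F.left x' y‖ / |(x : ℝ) - x'| ^ γ)) <| by
      rw [holderNorm, add_assoc, add_assoc]
      exact le_add_left (le_add_right (le_iSup_of_le x (le_iSup₂_of_le x' y le_rfl)))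
    have h1 := weight_pos θ (D.pos y)
    have h2 : 0 < |(x : ℝ) - x'| ^ γ :=
      Real.rpow_pos_of_pos (abs_pos.2 (sub_ne_zero.2 fun h => hx (Subtype.ext h))) _
    rw [inv_weight, inv_mul_le_iff₀ h1, div_le_iff₀ h2] at h
    linarith
  · by_cases hy : y = y'
    · subst hy; rw [sub_self, norm_zero, zero]; simp
    have h := key ((1 + |C.pos x|) ^ θ *
        (‖F.right x y - F.right x y'‖ / |(y : ℝ) - y'| ^ γ)) <| by
      rw [holderNorm, add_assoc]
      exact le_add_left (le_add_right (le_iSup_of_le x (le_iSup₂_of_le y y' le_rfl)))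
    have h1 := weight_pos θ (C.pos x)
    have h2 : 0 < |(y : ℝ) - y'| ^ γ :=
      Real.rpow_pos_of_pos (abs_pos.2 (sub_ne_zero.2 fun h => hy (Subtype.ext h))) _
    rw [inv_weight, inv_mul_le_iff₀ h1, div_le_iff₀ h2] at h
    linarith
  · by_cases hx : x = x'
    · subst hx
      rw [zero, sub_self, zero_sub, neg_add_cancel, norm_zero]; simp
    by_cases hy : y = y'
    · subst hy
      rw [zero, sub_right_comm, sub_self, zero_sub, neg_add_cancel, norm_zero]; simp
    have h := key (‖F.both x y - F.both x' y - F.both x y' + F.both x' y'‖ /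
        (|(x : ℝ) - x'| ^ γ * |(y : ℝ) - y'| ^ γ)) <| by
      rw [holderNorm]
      exact le_add_left (le_iSup₂_of_le x x' (le_iSup₂_of_le y y' le_rfl))
    have h1 : 0 < |(x : ℝ) - x'| ^ γ :=
      Real.rpow_pos_of_pos (abs_pos.2 (sub_ne_zero.2 fun h => hx (Subtype.ext h))) _
    have h2 : 0 < |(y : ℝ) - y'| ^ γ :=
      Real.rpow_pos_of_pos (abs_pos.2 (sub_ne_zero.2 fun h => hy (Subtype.ext h))) _
    rw [div_le_iff₀ (by positivity)] at h
    linarith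

namespace HolderBound

variable {F : Kernel C D}

theorem holderNorm_le (hF : F.HolderBound θ γ M) (hM : 0 ≤ M) :
    F.holderNorm θ γ ≤ ENNReal.ofReal (4 * M) := by
  have e : ENNReal.ofReal (4 * M) = ENNReal.ofReal M + ENNReal.ofReal M + ENNReal.ofReal M +
      ENNReal.ofReal M := by
    rw [← ENNReal.ofReal_add hM hM, ← ENNReal.ofReal_add (by positivity) hM,
      ← ENNReal.ofReal_add (by positivity) hM]
    congr 1
    ring
  rw [e]
  refine add_le_add (add_le_add (add_le_add ?_ ?_) ?_) ?_
  · refine iSup₂_le fun x y => ENNReal.ofReal_le_ofReal ?_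
    have h1 := weight_pos θ (C.pos x)
    have h2 := weight_pos θ (D.pos y)
    rw [inv_weight, inv_weight, ← mul_inv, inv_mul_le_iff₀ (by positivity)]
    linarith [hF.bound x y]
  · refine iSup_le fun x => iSup₂_le fun x' y => ENNReal.ofReal_le_ofReal ?_
    have h1 := weight_pos θ (D.pos y)
    rw [inv_weight, inv_mul_le_iff₀ h1]
    refine div_le_of_le_mul₀ (by positivity) (by positivity) ?_
    linarith [hF.left x x' y]
  · refine iSup_le fun x => iSup₂_le fun y y' => ENNReal.ofReal_le_ofReal ?_
    have h1 := weight_pos θ (C.pos x)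
    rw [inv_weight, inv_mul_le_iff₀ h1]
    refine div_le_of_le_mul₀ (by positivity) (by positivity) ?_
    linarith [hF.right x y y']
  · refine iSup₂_le fun x x' => iSup₂_le fun y y' => ENNReal.ofReal_le_ofReal ?_
    refine div_le_of_le_mul₀ (by positivity) (by positivity) ?_
    linarith [hF.both x x' y y']

theorem inClass (hF : F.HolderBound θ γ M) (hM : 0 ≤ M) : F.InClass θ γ :=
  (hF.holderNorm_le hM).trans_lt ENNReal.ofReal_lt_top

end HolderBound

/-- The kernel of the adjoint operator: the arguments are swapped and the values are replaced by
their adjoints. -/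
def adj (F : Kernel C D) : Kernel D C := fun y x => (F x y).adjoint

theorem adj_left (F : Kernel C D) (y : D.cont) (x : C.Pt) :
    F.adj.left y x = (F.right x y).adjoint := rfl

theorem adj_right (F : Kernel C D) (y : D.Pt) (x : C.cont) :
    F.adj.right y x = (F.left x y).adjoint := rfl

theorem adj_both (F : Kernel C D) (y : D.cont) (x : C.cont) :
    F.adj.both y x = (F.both x y).adjoint := rfl

theorem HolderBound.adj {F : Kernel C D} (hF : F.HolderBound θ γ M) : F.adj.HolderBound θ γ M := by
  refine ⟨fun y x => ?_, fun y y' x => ?_, fun y x x' => ?_, fun y y' x x' => ?_⟩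
  · refine (LinearIsometryEquiv.norm_map _ _).trans_le ((hF.bound x y).trans_eq ?_)
    ring
  · rw [adj_left, adj_left, ← map_sub, LinearIsometryEquiv.norm_map]
    refine (hF.right x y y').trans_eq ?_
    ring
  · rw [adj_right, adj_right, ← map_sub, LinearIsometryEquiv.norm_map]
    refine (hF.left x x' y).trans_eq ?_
    ring
  · rw [adj_both, adj_both, adj_both, adj_both, ← map_sub, ← map_sub, ← map_add,
      LinearIsometryEquiv.norm_map, sub_right_comm]
    refine (hF.both x x' y y').trans_eq ?_
    ring

end Kernel

theorem continuous_of_holder {s : Set ℝ} {E : Type*} [NormedAddCommGroup E] {f : s → E} {K γ : ℝ}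
    (hγ : 0 < γ) (h : ∀ x y : s, ‖f x - f y‖ ≤ K * |(x : ℝ) - y| ^ γ) : Continuous f := by
  refine continuous_iff_continuousAt.2 fun y => ?_
  refine tendsto_iff_norm_sub_tendsto_zero.2 (squeeze_zero (fun _ => norm_nonneg _)
    (fun x => h x y) ?_)
  have hc : Continuous fun x : s => K * |(x : ℝ) - y| ^ γ :=
    continuous_const.mul ((continuous_subtype_val.sub continuous_const).abs.rpow_const
      fun _ => Or.inr hγ.le)
  simpa [Real.zero_rpow hγ.ne'] using hc.tendsto y

/-! ### Rows of a kernel -/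

section RowBound

variable {C : Channel.{u}} {H : Type*} [NormedAddCommGroup H] [NormedSpace ℂ H]

/-- The restriction of a family of operators with values in the fibres to the continuous spectrum,
where the fibre is constant. -/
def contRow (U : (x : C.Pt) → H →L[ℂ] C.Fiber x) (x : C.cont) : H →L[ℂ] C.Gc := U (.inl x)

/-- A family of operators with values in the fibres that is dominated by the weight and Hölder
continuous on the continuous spectrum. -/
structure RowBound (θ γ M : ℝ) (U : (x : C.Pt) → H →L[ℂ] C.Fiber x) : Prop where
  bound : ∀ x, ‖U x‖ ≤ M * weight θ (C.pos x)
  holder : ∀ x x' : C.cont, ‖contRow U x - contRow U x'‖ ≤ M * |(x : ℝ) - x'| ^ γ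

variable {θ γ M : ℝ} {U : (x : C.Pt) → H →L[ℂ] C.Fiber x}

theorem RowBound.continuous (h : RowBound θ γ M U) (hγ : 0 < γ) : Continuous (contRow U) :=
  continuous_of_holder hγ h.holder

theorem RowBound.comp {H' : Type*} [NormedAddCommGroup H'] [NormedSpace ℂ H']
    (h : RowBound θ γ M U) (T : H' →L[ℂ] H) :
    RowBound θ γ (M * ‖T‖) fun x => U x ∘L T := by
  refine ⟨fun x => ?_, fun x x' => ?_⟩
  · refine (ContinuousLinearMap.opNorm_comp_le _ _).trans ?_
    have := mul_le_mul_of_nonneg_right (h.bound x) (norm_nonneg T)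
    linarith
  · have e : contRow (fun x => U x ∘L T) x - contRow (fun x => U x ∘L T) x' =
        (contRow U x - contRow U x') ∘L T := by
      ext v; rfl
    rw [e]
    refine (ContinuousLinearMap.opNorm_comp_le _ _).trans ?_
    have := mul_le_mul_of_nonneg_right (h.holder x x') (norm_nonneg T)
    linarith

end RowBound

namespace Kernel

variable {C : Channel.{u}} {D : Channel.{v}} {θ γ M : ℝ} {F : Kernel C D}

theorem HolderBound.isWeightedForm (hF : F.HolderBound θ γ M) (hγ : 0 < γ) (x : C.Pt) :
    IsWeightedForm θ (M * weight θ (C.pos x)) (F x) :=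
  ⟨continuous_of_holder hγ (hF.right x), hF.bound x⟩

/-- The operator `f ↦ ∫ F(x, y) f(y) dy` for fixed `x`. -/
def HolderBound.row (hF : F.HolderBound θ γ M) (hθ : 1 / 2 < θ) (hγ : 0 < γ) (hM : 0 ≤ M)
    (x : C.Pt) : D.Space →L[ℂ] C.Fiber x :=
  formOp (hF.isWeightedForm hγ x) hθ (mul_nonneg hM (weight_pos _ _).le)

theorem HolderBound.row_apply (hF : F.HolderBound θ γ M) (hθ : 1 / 2 < θ) (hγ : 0 < γ)
    (hM : 0 ≤ M) (x : C.Pt) (f : D.Space) :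
    hF.row hθ hγ hM x f = D.sumInt fun y => F x y (D.val f y) := rfl

/-- The rows of a kernel of the class inherit the weight and the Hölder continuity. -/
theorem HolderBound.rowBound (hF : F.HolderBound θ γ M) (hθ : 1 / 2 < θ) (hγ : 0 < γ)
    (hM : 0 ≤ M) : RowBound θ γ (M * D.mass θ) (hF.row hθ hγ hM) := by
  refine ⟨fun x => ?_, fun x x' => ?_⟩
  · refine (norm_formOp_le _ hθ _).trans_eq ?_
    ring
  · have hk : IsWeightedForm θ (M * |(x : ℝ) - x'| ^ γ)
        (fun y => F.left x y - F.left x' y) :=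
      ⟨((hF.isWeightedForm hγ (.inl x)).continuous.sub
        (hF.isWeightedForm hγ (.inl x')).continuous), hF.left x x'⟩
    have hA : 0 ≤ M * |(x : ℝ) - x'| ^ γ := by positivity
    have e : contRow (hF.row hθ hγ hM) x - contRow (hF.row hθ hγ hM) x' = formOp hk hθ hA := by
      ext f
      exact (sumInt_sub (F := fun y => F.left x y (D.val f y))
        (G := fun y => F.left x' y (D.val f y)) ((hF.isWeightedForm hγ (.inl x)).integrable hθ f)
        ((hF.isWeightedForm hγ (.inl x')).integrable hθ f)).symm
    rw [e]
    refine (norm_formOp_le hk hθ hA).trans_eq ?_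
    ring

theorem HolderBound.isIntegralOperator (hF : F.HolderBound θ γ M) (hθ : 1 / 2 < θ) (hγ : 0 < γ)
    {T : D.Space →L[ℂ] C.Space}
    (h : ∀ f, ∀ᶠ x in C.aeFilter, C.val (T f) x = D.sumInt fun y => F x y (D.val f y)) :
    IsIntegralOperator T F := fun f => by
  refine eventually_aeFilter.1 ?_
  filter_upwards [h f] with x hx
  exact ⟨(hF.isWeightedForm hγ x).integrable hθ f, hx⟩

theorem HolderBound.val_eq_row (hF : F.HolderBound θ γ M) (hθ : 1 / 2 < θ) (hγ : 0 < γ)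
    (hM : 0 ≤ M) {T : D.Space →L[ℂ] C.Space} (hT : IsIntegralOperator T F) (f : D.Space) :
    ∀ᶠ x in C.aeFilter, C.val (T f) x = hF.row hθ hγ hM x f := by
  filter_upwards [eventually_aeFilter.2 (hT f)] with x hx
  exact hx.2

end Kernel

section Represent

variable {C : Channel.{u}} {θ γ M : ℝ} {H : Type*} [NormedAddCommGroup H] [InnerProductSpace ℂ H]
  {U : (x : C.Pt) → H →L[ℂ] C.Fiber x}

/-- An operator that acts pointwise through a dominated family of operators is bounded by the
constant of the family. -/
theorem norm_le_of_val_eq (hθ : 1 / 2 < θ) (hM : 0 ≤ M)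
    (hU : ∀ x, ‖U x‖ ≤ M * weight θ (C.pos x)) {T : H →L[ℂ] C.Space}
    (hT : ∀ h, ∀ᶠ x in C.aeFilter, C.val (T h) x = U x h) : ‖T‖ ≤ M * C.mass θ := by
  refine T.opNorm_le_bound (mul_nonneg hM mass_pos.le) fun h => ?_
  have := norm_le_of_val_le hθ (mul_nonneg hM (norm_nonneg h)) (f := T h) <| by
    filter_upwards [hT h] with x hx
    rw [hx]
    refine ((U x).le_of_opNorm_le (hU x) h).trans_eq ?_
    ring
  linarith

/-- A dominated continuous family of operators, applied to a fixed vector, gives an element of the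
Hilbert space. -/
theorem RowBound.exists_val_eq (hU : RowBound θ γ M U) (hθ : 1 / 2 < θ) (hγ : 0 < γ) (h : H) :
    ∃ f : C.Space, ∀ᶠ x in C.aeFilter, C.val f x = U x h := by
  refine Channel.exists_val_eq (fun x => U x h) ?_
  refine (memLp_weight_cont hθ).of_le_mul (c := M * ‖h‖)
    ((hU.continuous hγ).clm_apply continuous_const).aestronglyMeasurable
    (Eventually.of_forall fun x => ?_)
  rw [Real.norm_of_nonneg (weight_pos θ _).le]
  refine ((U (.inl x)).le_of_opNorm_le (hU.bound _) h).trans_eq ?_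
  change M * weight θ x * ‖h‖ = _
  ring

variable [CompleteSpace H] {E : Type*} [NormedAddCommGroup E] [InnerProductSpace ℂ E]

theorem RowBound.isWeightedForm (hU : RowBound θ γ M U) (hγ : 0 < γ) (S : H →L[ℂ] E) :
    IsWeightedForm θ (‖S‖ * M) fun x => S ∘L (U x).adjoint := by
  refine ⟨?_, fun x => ?_⟩
  · have h1 : Continuous fun x => (contRow U x).adjoint :=
      (ContinuousLinearMap.adjoint (𝕜 := ℂ) (E := H) (F := C.Gc)).continuous.comp
        (hU.continuous hγ)
    exact continuous_const.clm_comp h1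
  · refine (ContinuousLinearMap.opNorm_comp_le _ _).trans ?_
    rw [LinearIsometryEquiv.norm_map, mul_assoc]
    exact mul_le_mul_of_nonneg_left (hU.bound x) (norm_nonneg _)

/-- If the adjoint of `T` acts pointwise through the operators `U x`, then `T` is integration
against the adjoints of the `U x`. -/
theorem RowBound.apply_eq_sumInt [CompleteSpace E] (hU : RowBound θ γ M U) (hθ : 1 / 2 < θ)
    (hγ : 0 < γ) {T : C.Space →L[ℂ] H} (hT : ∀ h, ∀ᶠ x in C.aeFilter, C.val (T.adjoint h) x = U x h)
    (S : H →L[ℂ] E) (f : C.Space) :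
    S (T f) = C.sumInt fun x => (S ∘L (U x).adjoint) (C.val f x) := by
  refine ext_inner_left ℂ fun e => ?_
  rw [← sumInt_inner e ((hU.isWeightedForm hγ S).integrable hθ f),
    ← ContinuousLinearMap.adjoint_inner_left, ← ContinuousLinearMap.adjoint_inner_left,
    inner_eq_sumInt]
  refine sumInt_congr ?_
  filter_upwards [hT (S.adjoint e)] with x hx
  rw [hx, ContinuousLinearMap.comp_apply, ← ContinuousLinearMap.adjoint_inner_left,
    ContinuousLinearMap.adjoint_inner_right]

end Represent

/-! ### The adjoint of an integral operator -/

section Adjoint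

variable {C : Channel.{u}} {D : Channel.{v}} {θ γ M : ℝ} {F : Kernel C D}

theorem Channel.sumInt_inner_left {E : Type*} [NormedAddCommGroup E] [InnerProductSpace ℂ E]
    [CompleteSpace E] (e : E) {G : C.Pt → E}
    (hG : Integrable (fun x => G (.inl x)) C.contMeasure) :
    C.sumInt (fun x => ⟪G x, e⟫_ℂ) = ⟪C.sumInt G, e⟫_ℂ := by
  rw [← inner_conj_symm, ← sumInt_inner e hG]
  simp only [sumInt, map_add, map_sum, ← integral_conj, inner_conj_symm]

theorem Channel.sumInt_swap {Φ : C.Pt → D.Pt → ℂ}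
    (h : Integrable (fun z : C.cont × D.cont => Φ (.inl z.1) (.inl z.2))
      (C.contMeasure.prod D.contMeasure))
    (hC : ∀ y, Integrable (fun x => Φ (.inl x) (.inr y)) C.contMeasure)
    (hD : ∀ x, Integrable (fun y => Φ (.inr x) (.inl y)) D.contMeasure) :
    (C.sumInt fun x => D.sumInt fun y => Φ x y) = D.sumInt fun y => C.sumInt fun x => Φ x y := by
  simp only [sumInt]
  rw [integral_add h.integral_prod_left (integrable_finsetSum _ fun y _ => hC y),
    integral_add h.integral_prod_right (integrable_finsetSum _ fun x _ => hD x),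
    integral_finsetSum _ fun y _ => hC y, integral_finsetSum _ fun x _ => hD x,
    Finset.sum_add_distrib, Finset.sum_add_distrib, Finset.sum_comm,
    integral_integral_swap h]
  abel

theorem Kernel.HolderBound.stronglyMeasurable_both (hF : F.HolderBound θ γ M) (hγ : 0 < γ) :
    StronglyMeasurable (Function.uncurry F.both) :=
  stronglyMeasurable_uncurry_of_continuous_of_stronglyMeasurable
    (fun y => continuous_of_holder hγ fun x x' =>
      (hF.left x x' (.inl y)).trans_eq (mul_right_comm _ _ _))
    (fun x => (continuous_of_holder hγ (hF.right (.inl x))).stronglyMeasurable)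

/-- Fubini's theorem for the sesquilinear form of an integral operator. -/
theorem Kernel.HolderBound.sumInt_swap (hF : F.HolderBound θ γ M) (hθ : 1 / 2 < θ) (hγ : 0 < γ)
    (g : C.Space) (f : D.Space) :
    (C.sumInt fun x => D.sumInt fun y => ⟪C.val g x, F x y (D.val f y)⟫_ℂ) =
      D.sumInt fun y => C.sumInt fun x => ⟪C.val g x, F x y (D.val f y)⟫_ℂ := by
  have hC : ∀ y, Integrable (fun x : C.cont =>
      ⟪C.val g (.inl x), F (.inl x) y (D.val f y)⟫_ℂ) C.contMeasure := fun y => by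
    refine ((hF.adj.isWeightedForm hγ y).integrable hθ g).inner_const (𝕜 := ℂ)
      (D.val f y) |>.congr (Eventually.of_forall fun x => ?_)
    exact ContinuousLinearMap.adjoint_inner_left _ _ _
  refine Channel.sumInt_swap ?_ (fun y => hC (.inr y)) (fun x => ?_)
  · have hg := (memLp_weight_cont (C := C) hθ).integrable_mul (memLp_val g).norm
    have hf := (memLp_weight_cont (C := D) hθ).integrable_mul (memLp_val f).norm
    have hm : AEStronglyMeasurable (fun z : C.cont × D.cont =>
        F.both z.1 z.2 (f.fst z.2)) (C.contMeasure.prod D.contMeasure) :=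
      (ContinuousLinearMap.id ℂ (D.Gc →L[ℂ] C.Gc)).aestronglyMeasurable_comp₂
        (hF.stronglyMeasurable_both hγ).aestronglyMeasurable
        (Lp.aestronglyMeasurable f.fst).comp_snd
    refine ((hg.mul_prod hf).const_mul M).mono'
      ((Lp.aestronglyMeasurable g.fst).comp_fst.inner hm) (Eventually.of_forall fun z => ?_)
    have h1 := hF.bound (.inl z.1) (.inl z.2)
    have h2 := (F (.inl z.1) (.inl z.2)).le_of_opNorm_le h1 (D.val f (.inl z.2))
    refine (norm_inner_le_norm _ _).trans ((mul_le_mul_of_nonneg_left h2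
      (norm_nonneg _)).trans_eq ?_)
    simp only [Pi.mul_apply, pos]
    change ‖g.fst z.1‖ * _ = M * ((_ * ‖g.fst z.1‖) * _)
    change ‖g.fst z.1‖ * (_ * ‖f.fst z.2‖) = M * ((_ * ‖g.fst z.1‖) * (_ * ‖f.fst z.2‖))
    ring
  · exact ((hF.isWeightedForm hγ (.inr x)).integrable hθ f).const_inner (C.val g (.inr x))

/-- The adjoint of an integral operator is the integral operator with the adjoint kernel. -/
theorem Kernel.HolderBound.val_adjoint (hF : F.HolderBound θ γ M) (hθ : 1 / 2 < θ) (hγ : 0 < γ)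
    (hM : 0 ≤ M) {T : D.Space →L[ℂ] C.Space} (hT : IsIntegralOperator T F) (g : C.Space) :
    ∀ᶠ y in D.aeFilter, D.val (T.adjoint g) y = hF.adj.row hθ hγ hM y g := by
  obtain ⟨z, hz⟩ := (hF.adj.rowBound hθ hγ hM).exists_val_eq hθ hγ g
  suffices h : T.adjoint g = z by rw [h]; exact hz
  refine ext_inner_right ℂ fun f => ?_
  rw [ContinuousLinearMap.adjoint_inner_left, inner_eq_sumInt, inner_eq_sumInt]
  have e1 : (C.sumInt fun x => ⟪C.val g x, C.val (T f) x⟫_ℂ) =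
      C.sumInt fun x => D.sumInt fun y => ⟪C.val g x, F x y (D.val f y)⟫_ℂ := by
    refine sumInt_congr ?_
    filter_upwards [hF.val_eq_row hθ hγ hM hT f] with x hx
    rw [hx, hF.row_apply, sumInt_inner _ ((hF.isWeightedForm hγ x).integrable hθ f)]
  have e2 : (D.sumInt fun y => ⟪D.val z y, D.val f y⟫_ℂ) =
      D.sumInt fun y => C.sumInt fun x => ⟪C.val g x, F x y (D.val f y)⟫_ℂ := by
    refine sumInt_congr ?_
    filter_upwards [hz] with y hy
    rw [hy, hF.adj.row_apply,
      ← sumInt_inner_left _ ((hF.adj.isWeightedForm hγ y).integrable hθ g)]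
    refine congrArg _ (funext fun x => ?_)
    exact ContinuousLinearMap.adjoint_inner_left _ _ _
  rw [e1, e2, hF.sumInt_swap hθ hγ]

end Adjoint

/-! ### Kernels built from rows, and division by the difference of the variables -/

section Build

variable {C : Channel.{u}} {D : Channel.{v}} {θ γ M : ℝ}

/-- The kernel `U(x) V(y)*` made of two families of operators on a common space. -/
def sandwich {H : Type*} [NormedAddCommGroup H] [InnerProductSpace ℂ H] [CompleteSpace H]
    (U : (x : C.Pt) → H →L[ℂ] C.Fiber x) (V : (y : D.Pt) → H →L[ℂ] D.Fiber y) : Kernel C D :=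
  fun x y => U x ∘L (V y).adjoint

/-- A sandwich has the product structure that the mixed difference in the norm asks for. -/
theorem RowBound.sandwich {H : Type*} [NormedAddCommGroup H] [InnerProductSpace ℂ H]
    [CompleteSpace H] {U : (x : C.Pt) → H →L[ℂ] C.Fiber x} {V : (y : D.Pt) → H →L[ℂ] D.Fiber y}
    {K L : ℝ} (hU : RowBound θ γ K U) (hV : RowBound θ γ L V) (hK : 0 ≤ K) :
    (sandwich U V).HolderBound θ γ (K * L) := by
  have key : ∀ {E E' : Type _} [NormedAddCommGroup E] [InnerProductSpace ℂ E] [CompleteSpace E]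
      [NormedAddCommGroup E'] [InnerProductSpace ℂ E'] [CompleteSpace E']
      (S : H →L[ℂ] E) (T : H →L[ℂ] E') (p q : ℝ), 0 ≤ p → ‖S‖ ≤ K * p → ‖T‖ ≤ L * q →
      ‖S ∘L T.adjoint‖ ≤ K * L * p * q := by
    intro E E' _ _ _ _ _ _ S T p q hp hS hT
    refine (ContinuousLinearMap.opNorm_comp_le _ _).trans ?_
    rw [LinearIsometryEquiv.norm_map]
    refine (mul_le_mul hS hT (norm_nonneg _) (by positivity)).trans_eq ?_
    ring
  refine ⟨fun x y => ?_, fun x x' y => ?_, fun x y y' => ?_, fun x x' y y' => ?_⟩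
  · exact key _ _ _ _ (weight_pos _ _).le (hU.bound x) (hV.bound y)
  · have e : (Friedrichs.sandwich U V).left x y - (Friedrichs.sandwich U V).left x' y =
        (contRow U x - contRow U x') ∘L (V y).adjoint := by
      ext v; rfl
    rw [e]
    exact key _ _ _ _ (by positivity) (hU.holder x x') (hV.bound y)
  · have e : (Friedrichs.sandwich U V).right x y - (Friedrichs.sandwich U V).right x y' =
        U x ∘L (contRow V y - contRow V y').adjoint := by
      rw [map_sub, ContinuousLinearMap.comp_sub]
      rfl
    rw [e]
    exact key _ _ _ _ (weight_pos _ _).le (hU.bound x) (hV.holder y y')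
  · have e : (Friedrichs.sandwich U V).both x y - (Friedrichs.sandwich U V).both x' y -
        (Friedrichs.sandwich U V).both x y' + (Friedrichs.sandwich U V).both x' y' =
        (contRow U x - contRow U x') ∘L (contRow V y - contRow V y').adjoint := by
      rw [map_sub, ContinuousLinearMap.comp_sub, ContinuousLinearMap.sub_comp,
        ContinuousLinearMap.sub_comp, ← sub_add]
      rfl
    rw [e]
    exact key _ _ _ _ (by positivity) (hU.holder x x') (hV.holder y y')

theorem Kernel.HolderBound.add {F G : Kernel C D} {K L : ℝ} (hF : F.HolderBound θ γ K)
    (hG : G.HolderBound θ γ L) :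
    Kernel.HolderBound (fun x y => F x y + G x y : Kernel C D) θ γ (K + L) := by
  refine ⟨fun x y => ?_, fun x x' y => ?_, fun x y y' => ?_, fun x x' y y' => ?_⟩
  · have := norm_add_le_of_le (hF.bound x y) (hG.bound x y)
    rw [add_mul, add_mul]
    exact this
  · have := norm_add_le_of_le (hF.left x x' y) (hG.left x x' y)
    rw [add_mul, add_mul]
    refine le_trans (le_of_eq (congrArg norm ?_)) this
    exact add_sub_add_comm (F.left x y) (G.left x y) (F.left x' y) (G.left x' y)
  · have := norm_add_le_of_le (hF.right x y y') (hG.right x y y')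
    rw [add_mul, add_mul]
    refine le_trans (le_of_eq (congrArg norm ?_)) this
    exact add_sub_add_comm (F.right x y) (G.right x y) (F.right x y') (G.right x y')
  · have := norm_add_le_of_le (hF.both x x' y y') (hG.both x x' y y')
    rw [add_mul, add_mul]
    refine le_trans (le_of_eq (congrArg norm ?_)) this
    change (F.both x y + G.both x y) - (F.both x' y + G.both x' y) -
      (F.both x y' + G.both x y') + (F.both x' y' + G.both x' y') = _
    abel

theorem le_rpow_of_le_one {p γ : ℝ} (hp : 0 ≤ p) (hp1 : p ≤ 1) (hγ1 : γ ≤ 1) (hγ : 0 < γ) :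
    p ≤ p ^ γ := by
  rcases hp.eq_or_lt with rfl | h
  · rw [Real.zero_rpow hγ.ne']
  · simpa using Real.rpow_le_rpow_of_exponent_ge h hp1 hγ1

/-- Interpolation between a Lipschitz bound and a uniform bound. -/
theorem le_rpow_of_le {z p γ : ℝ} (hp : 0 ≤ p) (hγ : 0 < γ) (hγ1 : γ ≤ 1) (h1 : z ≤ p)
    (h2 : z ≤ 2) : z ≤ 2 * p ^ γ := by
  rcases le_total p 1 with h | h
  · have := le_rpow_of_le_one hp h hγ1 hγ
    linarith
  · have := Real.one_le_rpow h hγ.le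
    linarith

/-- Interpolation between Lipschitz bounds and uniform bounds in two variables. -/
theorem le_rpow_mul_rpow_of_le {z p q γ : ℝ} (hp : 0 ≤ p) (hq : 0 ≤ q) (hγ : 0 < γ) (hγ1 : γ ≤ 1)
    (h1 : z ≤ 2 * (p * q)) (h2 : z ≤ 2 * p) (h3 : z ≤ 2 * q) (h4 : z ≤ 4) :
    z ≤ 4 * (p ^ γ * q ^ γ) := by
  have hp0 := Real.rpow_nonneg hp γ
  have hq0 := Real.rpow_nonneg hq γ
  rcases le_total p 1 with h | h <;> rcases le_total q 1 with h' | h'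
  · have a := le_rpow_of_le_one hp h hγ1 hγ
    have b := le_rpow_of_le_one hq h' hγ1 hγ
    nlinarith [mul_le_mul a b hq hp0]
  · have a := le_rpow_of_le_one hp h hγ1 hγ
    have b := Real.one_le_rpow h' hγ.le
    nlinarith [mul_le_mul a b zero_le_one hp0]
  · have a := Real.one_le_rpow h hγ.le
    have b := le_rpow_of_le_one hq h' hγ1 hγ
    nlinarith [mul_le_mul a b hq hp0]
  · have a := Real.one_le_rpow h hγ.le
    have b := Real.one_le_rpow h' hγ.le
    nlinarith [mul_le_mul a b zero_le_one hp0]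

theorem abs_inv_le {d u : ℝ} (hd : 0 < d) (h : d ≤ |u|) : |u⁻¹| ≤ 1 / d := by
  rw [abs_inv, ← one_div]
  exact one_div_le_one_div_of_le hd h

theorem abs_inv_sub_inv_le {d u u' : ℝ} (hd : 0 < d) (h : d ≤ |u|) (h' : d ≤ |u'|) :
    |u⁻¹ - u'⁻¹| ≤ 1 / d * (|u - u'| / d) := by
  have hu : u ≠ 0 := abs_pos.1 (hd.trans_le h)
  have hu' : u' ≠ 0 := abs_pos.1 (hd.trans_le h')
  have e : u⁻¹ - u'⁻¹ = u⁻¹ * u'⁻¹ * (u' - u) := by field_simp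
  rw [e, abs_mul, abs_mul, abs_sub_comm u']
  have := mul_le_mul (abs_inv_le hd h) (abs_inv_le hd h') (abs_nonneg _) (by positivity)
  have := mul_le_mul_of_nonneg_right this (abs_nonneg (u - u'))
  refine this.trans_eq ?_
  field_simp

theorem abs_inv_sub_inv_le_two {d u u' : ℝ} (hd : 0 < d) (h : d ≤ |u|) (h' : d ≤ |u'|) :
    |u⁻¹ - u'⁻¹| ≤ 1 / d * 2 := by
  have := abs_sub u⁻¹ u'⁻¹
  linarith [abs_inv_le hd h, abs_inv_le hd h']

theorem abs_inv_sub_inv_le_rpow {d u u' γ : ℝ} (hd : 0 < d) (hγ : 0 < γ) (hγ1 : γ ≤ 1)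
    (h : d ≤ |u|) (h' : d ≤ |u'|) :
    |u⁻¹ - u'⁻¹| ≤ 1 / d * (2 * (d ^ (-γ) * |u - u'| ^ γ)) := by
  have h1 := abs_inv_sub_inv_le hd h h'
  have h2 := abs_inv_sub_inv_le_two hd h h'
  rw [one_div, ← div_eq_inv_mul, le_div_iff₀ hd] at h1 h2 ⊢
  refine (le_rpow_of_le (by positivity) hγ hγ1 h1 h2).trans_eq ?_
  rw [Real.div_rpow (abs_nonneg _) hd.le, Real.rpow_neg hd.le]
  ring

/-- The mixed difference of `(λ, μ) ↦ 1 / (λ - μ)` at distance at least `d` from the diagonal. -/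
theorem abs_inv_mixed_le_rpow {d s s' t t' γ : ℝ} (hd : 0 < d) (hγ : 0 < γ) (hγ1 : γ ≤ 1)
    (h11 : d ≤ |t - s|) (h21 : d ≤ |t - s'|) (h12 : d ≤ |t' - s|) (h22 : d ≤ |t' - s'|) :
    |(t - s)⁻¹ - (t - s')⁻¹ - (t' - s)⁻¹ + (t' - s')⁻¹| ≤
      1 / d * (4 * (d ^ (-γ) * |s - s'| ^ γ * (d ^ (-γ) * |t - t'| ^ γ))) := by
  set X := (t - s)⁻¹ - (t - s')⁻¹ - (t' - s)⁻¹ + (t' - s')⁻¹ with hX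
  set p := |s - s'| / d with hp
  set q := |t - t'| / d with hq
  have ne : ∀ {u : ℝ}, d ≤ |u| → u ≠ 0 := fun h => abs_pos.1 (hd.trans_le h)
  have es : ∀ r : ℝ, |r - s - (r - s')| / d = p := fun r => by
    rw [hp, abs_sub_comm s]; congr 2; ring
  have et : ∀ r : ℝ, |t - r - (t' - r)| / d = q := fun r => by rw [hq]; congr 2; ring
  have a1 : |(t - s)⁻¹ - (t - s')⁻¹| ≤ 1 / d * p := es t ▸ abs_inv_sub_inv_le hd h11 h21
  have a2 : |(t' - s)⁻¹ - (t' - s')⁻¹| ≤ 1 / d * p := es t' ▸ abs_inv_sub_inv_le hd h12 h22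
  have b1 : |(t - s)⁻¹ - (t' - s)⁻¹| ≤ 1 / d * q := et s ▸ abs_inv_sub_inv_le hd h11 h12
  have b2 : |(t - s')⁻¹ - (t' - s')⁻¹| ≤ 1 / d * q := et s' ▸ abs_inv_sub_inv_le hd h21 h22
  have i1 := abs_inv_sub_inv_le_two hd h11 h21
  have i2 := abs_inv_sub_inv_le_two hd h12 h22
  have k2 : |X| ≤ 1 / d * (2 * p) := by
    have e : X = ((t - s)⁻¹ - (t - s')⁻¹) - ((t' - s)⁻¹ - (t' - s')⁻¹) := by rw [hX]; ring
    rw [e]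
    linarith [abs_sub ((t - s)⁻¹ - (t - s')⁻¹) ((t' - s)⁻¹ - (t' - s')⁻¹)]
  have k3 : |X| ≤ 1 / d * (2 * q) := by
    have e : X = ((t - s)⁻¹ - (t' - s)⁻¹) - ((t - s')⁻¹ - (t' - s')⁻¹) := by rw [hX]; ring
    rw [e]
    linarith [abs_sub ((t - s)⁻¹ - (t' - s)⁻¹) ((t - s')⁻¹ - (t' - s')⁻¹)]
  have k4 : |X| ≤ 1 / d * 4 := by
    have e : X = ((t - s)⁻¹ - (t - s')⁻¹) - ((t' - s)⁻¹ - (t' - s')⁻¹) := by rw [hX]; ring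
    rw [e]
    linarith [abs_sub ((t - s)⁻¹ - (t - s')⁻¹) ((t' - s)⁻¹ - (t' - s')⁻¹)]
  have k1 : |X| ≤ 1 / d * (2 * (p * q)) := by
    have e : X = (s - s') * (((t - s)⁻¹ - (t' - s)⁻¹) * (t - s')⁻¹ +
        (t' - s)⁻¹ * ((t - s')⁻¹ - (t' - s')⁻¹)) := by
      have := ne h11
      have := ne h21
      have := ne h12
      have := ne h22
      rw [hX]
      field_simp
      ring
    rw [e, abs_mul]
    have c1 : |((t - s)⁻¹ - (t' - s)⁻¹) * (t - s')⁻¹| ≤ 1 / d * q * (1 / d) := by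
      rw [abs_mul]
      exact mul_le_mul b1 (abs_inv_le hd h21) (abs_nonneg _) (by positivity)
    have c2 : |(t' - s)⁻¹ * ((t - s')⁻¹ - (t' - s')⁻¹)| ≤ 1 / d * (1 / d * q) := by
      rw [abs_mul]
      exact mul_le_mul (abs_inv_le hd h12) b2 (abs_nonneg _) (by positivity)
    have c3 := (abs_add_le (((t - s)⁻¹ - (t' - s)⁻¹) * (t - s')⁻¹)
      ((t' - s)⁻¹ * ((t - s')⁻¹ - (t' - s')⁻¹))).trans (add_le_add c1 c2)
    refine (mul_le_mul_of_nonneg_left c3 (abs_nonneg _)).trans_eq ?_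
    rw [hp]
    field_simp
    ring
  rw [one_div, ← div_eq_inv_mul, le_div_iff₀ hd] at k1 k2 k3 k4 ⊢
  refine (le_rpow_mul_rpow_of_le (by positivity) (by positivity) hγ hγ1 k1 k2 k3 k4).trans_eq ?_
  rw [hp, hq, Real.div_rpow (abs_nonneg _) hd.le, Real.div_rpow (abs_nonneg _) hd.le,
    Real.rpow_neg hd.le]
  ring

/-- The kernel `F(x, y) / (y - x)`. -/
def Kernel.divDiff (F : Kernel C D) : Kernel C D :=
  fun x y => (((D.pos y - C.pos x)⁻¹ : ℝ) : ℂ) • F x y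

end Build

section Division

variable {C : Channel.{u}} {D : Channel.{v}} {θ γ M : ℝ}

/-- The discrete Leibniz rule in one variable. -/
theorem norm_smul_sub_smul_le {E : Type*} [NormedAddCommGroup E] [NormedSpace ℂ E] {h h' m : ℝ}
    {f f' : E} {a b c e : ℝ} (ha : |h| ≤ a) (hb : ‖f - f'‖ ≤ b) (hc : |h - h'| ≤ c)
    (he : ‖f'‖ ≤ e) (hm : a * b + c * e ≤ m) : ‖(h : ℂ) • f - (h' : ℂ) • f'‖ ≤ m := by
  have e1 : (h : ℂ) • f - (h' : ℂ) • f' = (h : ℂ) • (f - f') + ((h - h' : ℝ) : ℂ) • f' := by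
    push_cast
    module
  rw [e1]
  refine (norm_add_le _ _).trans (le_trans ?_ hm)
  rw [norm_smul, norm_smul, Complex.norm_real, Complex.norm_real, Real.norm_eq_abs,
    Real.norm_eq_abs]
  gcongr
  · exact (abs_nonneg _).trans ha
  · exact (abs_nonneg _).trans hc

/-- Division by the difference of the variables preserves the class when the spectra have a
positive distance `d`. -/
theorem Kernel.HolderBound.divDiff {F : Kernel C D} (hF : F.HolderBound θ γ M) (hM : 0 ≤ M)
    (hθ : 1 / 2 < θ) (hγ : 0 < γ) (hγ1 : γ ≤ 1) {d : ℝ} (hd : 0 < d)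
    (h : ∀ x y, d ≤ |D.pos y - C.pos x|) :
    F.divDiff.HolderBound θ γ (4 / d * (1 + d ^ (-γ)) ^ 2 * M) := by
  set e := d ^ (-γ) with he
  have he0 : 0 < e := Real.rpow_pos_of_pos hd _
  have hd0 : 0 < 1 / d := by positivity
  have h4 : 4 / d = 4 * (1 / d) := by ring
  have hM0 : 0 ≤ 1 / d * M := by positivity
  rw [h4]
  refine ⟨fun x y => ?_, fun x x' y => ?_, fun x y y' => ?_, fun x x' y y' => ?_⟩
  · change ‖(((D.pos y - C.pos x)⁻¹ : ℝ) : ℂ) • F x y‖ ≤ _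
    rw [norm_smul, Complex.norm_real, Real.norm_eq_abs]
    refine (mul_le_mul (abs_inv_le hd (h x y)) (hF.bound x y) (norm_nonneg _) hd0.le).trans ?_
    have h1 := weight_pos θ (C.pos x)
    have h2 := weight_pos θ (D.pos y)
    have h3 : 0 ≤ 1 / d * M * (weight θ (C.pos x) * weight θ (D.pos y)) := by positivity
    nlinarith [mul_nonneg h3 he0.le, mul_nonneg h3 (sq_nonneg e)]
  · have h1 := weight_pos θ (D.pos y)
    have h2 : 0 ≤ |(x : ℝ) - x'| ^ γ := by positivity
    have h3 := abs_inv_sub_inv_le_rpow hd hγ hγ1 (h (.inl x) y) (h (.inl x') y)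
    have h5 : |D.pos y - C.pos (.inl x) - (D.pos y - C.pos (.inl x'))| = |(x : ℝ) - x'| := by
      rw [abs_sub_comm (x : ℝ)]; congr 1; simp only [pos]; ring
    rw [h5] at h3
    have h6 : ‖F.left x' y‖ ≤ M * weight θ (D.pos y) := by
      refine (hF.bound (.inl x') y).trans ?_
      gcongr
      exact mul_le_of_le_one_right hM (weight_le_one hθ _)
    refine norm_smul_sub_smul_le (abs_inv_le hd (h (.inl x) y)) (hF.left x x' y) h3 h6 ?_
    have h7 : 0 ≤ 1 / d * M * (|(x : ℝ) - x'| ^ γ * weight θ (D.pos y)) := by positivity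
    nlinarith [mul_nonneg h7 he0.le, mul_nonneg h7 (sq_nonneg e)]
  · have h1 := weight_pos θ (C.pos x)
    have h2 : 0 ≤ |(y : ℝ) - y'| ^ γ := by positivity
    have h3 := abs_inv_sub_inv_le_rpow hd hγ hγ1 (h x (.inl y)) (h x (.inl y'))
    have h5 : |D.pos (.inl y) - C.pos x - (D.pos (.inl y') - C.pos x)| = |(y : ℝ) - y'| := by
      congr 1; simp only [pos]; ring
    rw [h5] at h3
    have h6 : ‖F.right x y'‖ ≤ M * weight θ (C.pos x) :=
      (hF.bound x (.inl y')).trans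
        (mul_le_of_le_one_right (mul_nonneg hM h1.le) (weight_le_one hθ _))
    refine norm_smul_sub_smul_le (abs_inv_le hd (h x (.inl y))) (hF.right x y y') h3 h6 ?_
    have h7 : 0 ≤ 1 / d * M * (|(y : ℝ) - y'| ^ γ * weight θ (C.pos x)) := by positivity
    nlinarith [mul_nonneg h7 he0.le, mul_nonneg h7 (sq_nonneg e)]
  · set a := |(x : ℝ) - x'| ^ γ with ha
    set b := |(y : ℝ) - y'| ^ γ with hb
    have ha0 : 0 ≤ a := by positivity
    have hb0 : 0 ≤ b := by positivity
    -- the discrete Leibniz rule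
    have e1 : F.divDiff.both x y - F.divDiff.both x' y - F.divDiff.both x y' +
        F.divDiff.both x' y' =
        (((y - x : ℝ)⁻¹ : ℝ) : ℂ) •
          (F.both x y - F.both x' y - F.both x y' + F.both x' y') +
        (((y - x : ℝ)⁻¹ - (y - x' : ℝ)⁻¹ : ℝ) : ℂ) • (F.both x' y - F.both x' y') +
        (((y - x : ℝ)⁻¹ - (y' - x : ℝ)⁻¹ : ℝ) : ℂ) • (F.both x y' - F.both x' y') +
        (((y - x : ℝ)⁻¹ - (y - x' : ℝ)⁻¹ - (y' - x : ℝ)⁻¹ + (y' - x' : ℝ)⁻¹ : ℝ) : ℂ) •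
          F.both x' y' := by
      change (((y - x : ℝ)⁻¹ : ℝ) : ℂ) • F.both x y - (((y - x' : ℝ)⁻¹ : ℝ) : ℂ) • F.both x' y -
        (((y' - x : ℝ)⁻¹ : ℝ) : ℂ) • F.both x y' + (((y' - x' : ℝ)⁻¹ : ℝ) : ℂ) • F.both x' y' = _
      push_cast
      module
    have d11 : d ≤ |(y - x : ℝ)| := h (.inl x) (.inl y)
    have d21 : d ≤ |(y - x' : ℝ)| := h (.inl x') (.inl y)
    have d12 : d ≤ |(y' - x : ℝ)| := h (.inl x) (.inl y')
    have d22 : d ≤ |(y' - x' : ℝ)| := h (.inl x') (.inl y')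
    have s1 := abs_inv_sub_inv_le_rpow hd hγ hγ1 d11 d21
    have s2 := abs_inv_sub_inv_le_rpow hd hγ hγ1 d11 d12
    have s3 := abs_inv_mixed_le_rpow hd hγ hγ1 d11 d21 d12 d22
    have r1 : |(y - x - (y - x') : ℝ)| = |(x : ℝ) - x'| := by
      rw [abs_sub_comm (x : ℝ)]; congr 1; ring
    have r2 : |(y - x - (y' - x) : ℝ)| = |(y : ℝ) - y'| := by congr 1; ring
    rw [r1, ← he, ← ha] at s1
    rw [r2, ← he, ← hb] at s2
    rw [← he, ← ha, ← hb] at s3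
    have f1 : ‖F.both x' y - F.both x' y'‖ ≤ M * b := by
      refine (hF.right (.inl x') y y').trans ?_
      rw [← hb]
      gcongr
      exact mul_le_of_le_one_right hM (weight_le_one hθ _)
    have f2 : ‖F.both x y' - F.both x' y'‖ ≤ M * a :=
      (hF.left x x' (.inl y')).trans
        (mul_le_of_le_one_right (mul_nonneg hM ha0) (weight_le_one hθ _))
    have f3 : ‖F.both x' y'‖ ≤ M :=
      (hF.bound (.inl x') (.inl y')).trans
        ((mul_le_of_le_one_right (mul_nonneg hM (weight_pos _ _).le) (weight_le_one hθ _)).trans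
          (mul_le_of_le_one_right hM (weight_le_one hθ _)))
    have sm : ∀ {E : Type _} [NormedAddCommGroup E] [NormedSpace ℂ E] {r : ℝ} {f : E} {p q : ℝ},
        |r| ≤ p → ‖f‖ ≤ q → ‖(r : ℂ) • f‖ ≤ p * q := by
      intro E _ _ r f p q hp hq
      rw [norm_smul, Complex.norm_real, Real.norm_eq_abs]
      exact mul_le_mul hp hq (norm_nonneg _) ((abs_nonneg _).trans hp)
    rw [e1]
    refine (norm_add_le_of_le (norm_add_le_of_le (norm_add_le_of_le
      (sm (abs_inv_le hd d11) (hF.both x x' y y')) (sm s1 f1)) (sm s2 f2)) (sm s3 f3)).trans ?_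
    rw [← ha, ← hb]
    have h7 : 0 ≤ 1 / d * M * (a * b) := by positivity
    nlinarith [mul_nonneg h7 he0.le, mul_nonneg h7 (sq_nonneg e)]

end Division

/-! ### Multiplication operators and resolvents -/

section Resolvent

variable {C : Channel.{u}}

variable (C) in
/-- The pointwise form of `A f = g` for the multiplication operator `A` of the channel. -/
def IsMul (f g : C.Space) : Prop :=
  ∀ᶠ x in C.aeFilter, C.val g x = ((C.pos x : ℝ) : ℂ) • C.val f x

theorem isMul_mulOp (f : C.mulOp.domain) : IsMul C f (C.mulOp f) :=
  eventually_aeFilter.2 ⟨MemLp.coeFn_toLp (f.2 : (f : C.Space).fst ∈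
    lpMulDomain C.Gc C.contMeasure (fun x : C.cont => ((x : ℝ) : ℂ))), fun _ => rfl⟩

theorem IsMul.mem_domain {f g : C.Space} (h : IsMul C f g) : f ∈ C.mulOp.domain := by
  obtain ⟨h1, -⟩ := eventually_aeFilter.1 h
  exact (memLp_congr_ae h1).1 (Lp.memLp g.fst)

theorem IsMul.mulOp_eq {f g : C.Space} (h : IsMul C f g) :
    C.mulOp ⟨f, h.mem_domain⟩ = g := by
  refine ext_val ?_
  filter_upwards [h, isMul_mulOp ⟨f, h.mem_domain⟩] with x h1 h2
  rw [h1, h2]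

/-- The resolvent of `A + W` in pointwise terms, without reference to the domain of `A`. -/
theorem isResolvent_iff {W R : C.Space →L[ℂ] C.Space} {z : ℂ} :
    IsResolvent (perturbed C W) z R ↔
      (∀ f, IsMul C (R f) (f + z • R f - W (R f))) ∧
        ∀ f g, IsMul C f g → R (g + W f - z • f) = f := by
  constructor
  · rintro ⟨h1, h2⟩
    refine ⟨fun f => ?_, fun f g hfg => ?_⟩
    · obtain ⟨h, e⟩ := h1 f
      have e' : W (R f) + C.mulOp ⟨R f, h⟩ - z • R f = f := e
      rw [sub_eq_iff_eq_add] at e'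
      rw [← e', add_sub_cancel_left]
      exact isMul_mulOp ⟨R f, h⟩
    · have e' : R (W f + C.mulOp ⟨f, hfg.mem_domain⟩ - z • f) = f := h2 ⟨f, hfg.mem_domain⟩
      rw [hfg.mulOp_eq, add_comm] at e'
      exact e'
  · rintro ⟨h1, h2⟩
    refine ⟨fun f => ⟨(h1 f).mem_domain, ?_⟩, fun f => ?_⟩
    · change W (R f) + C.mulOp ⟨R f, (h1 f).mem_domain⟩ - z • R f = f
      rw [(h1 f).mulOp_eq]
      abel
    · change R (W f + C.mulOp f - z • (f : C.Space)) = f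
      rw [add_comm (W f)]
      exact h2 _ _ (isMul_mulOp f)

/-- The symmetry of the multiplication operator. -/
theorem IsMul.inner_eq {f g h k : C.Space} (h1 : IsMul C f g) (h2 : IsMul C h k) :
    ⟪g, h⟫_ℂ = ⟪f, k⟫_ℂ := by
  rw [inner_eq_sumInt, inner_eq_sumInt]
  refine sumInt_congr ?_
  filter_upwards [h1, h2] with x e1 e2
  rw [e1, e2, inner_smul_left, inner_smul_right, Complex.conj_ofReal]

/-- First resolvent identity. -/
theorem resolvent_sub {W R R' : C.Space →L[ℂ] C.Space} {z z' : ℂ}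
    (h : IsResolvent (perturbed C W) z R) (h' : IsResolvent (perturbed C W) z' R') :
    R - R' = (z - z') • R ∘L R' := by
  ext1 f
  have := (isResolvent_iff.1 h).2 _ _ ((isResolvent_iff.1 h').1 f)
  have e : f + z' • R' f - W (R' f) + W (R' f) - z • R' f = f - (z - z') • R' f := by
    module
  rw [e, map_sub, map_smul] at this
  change R f - R' f = (z - z') • R (R' f)
  rw [sub_eq_iff_eq_add] at this ⊢
  exact this.trans (add_comm _ _)

/-- Second resolvent identity. -/
theorem resolvent_sub' {W W' R R' : C.Space →L[ℂ] C.Space} {z : ℂ}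
    (h : IsResolvent (perturbed C W) z R) (h' : IsResolvent (perturbed C W') z R') :
    R - R' = R ∘L (W' - W) ∘L R' := by
  ext1 f
  have := (isResolvent_iff.1 h).2 _ _ ((isResolvent_iff.1 h').1 f)
  have e : f + z • R' f - W' (R' f) + W (R' f) - z • R' f = f - (W' - W) (R' f) := by
    rw [sub_apply]
    abel
  rw [e, map_sub] at this
  change R f - R' f = R ((W' - W) (R' f))
  rw [sub_eq_iff_eq_add] at this ⊢
  exact this.trans (add_comm _ _)

/-- The bounded operator of multiplication by a function that is bounded on the spectrum. -/
theorem exists_mul (φ : ℝ → ℝ) (hφ : Measurable φ) {K : ℝ} (hK : 0 ≤ K)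
    (h : ∀ x : C.Pt, |φ (C.pos x)| ≤ K) :
    ∃ T : C.Space →L[ℂ] C.Space, ‖T‖ ≤ K ∧
      ∀ f, ∀ᶠ x in C.aeFilter, C.val (T f) x = (φ (C.pos x) : ℂ) • C.val f x := by
  have hb : ∀ (x : C.Pt) (v : C.Fiber x), ‖(φ (C.pos x) : ℂ) • v‖ ≤ K * ‖v‖ := fun x v => by
    rw [norm_smul, Complex.norm_real, Real.norm_eq_abs]
    exact mul_le_mul_of_nonneg_right (h x) (norm_nonneg v)
  have hex : ∀ f : C.Space, ∃ g : C.Space,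
      ∀ᶠ x in C.aeFilter, C.val g x = (φ (C.pos x) : ℂ) • C.val f x := fun f => by
    refine exists_val_eq (fun x => (φ (C.pos x) : ℂ) • C.val f x) ?_
    refine (memLp_val f).of_le_mul (c := K) ?_ (Eventually.of_forall fun x => hb (.inl x) _)
    have hm : Measurable fun x : C.cont => (φ x : ℂ) :=
      Complex.measurable_ofReal.comp (hφ.comp measurable_subtype_coe)
    exact hm.aestronglyMeasurable.smul (Lp.aestronglyMeasurable f.fst)
  choose T hT using hex
  have hadd : ∀ f g, T (f + g) = T f + T g := fun f g => ext_val <| by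
    filter_upwards [hT (f + g), hT f, hT g, val_add f g, val_add (T f) (T g)]
      with x h1 h2 h3 h4 h5
    rw [h1, h5, h2, h3, h4, smul_add]
  have hsmul : ∀ (c : ℂ) f, T (c • f) = c • T f := fun c f => ext_val <| by
    filter_upwards [hT (c • f), hT f, val_smul c f, val_smul c (T f)] with x h1 h2 h3 h4
    rw [h1, h4, h2, h3, smul_comm]
  have hn : ∀ f, ‖T f‖ ≤ K * ‖f‖ := fun f => by
    obtain ⟨h1, h2⟩ := eventually_aeFilter.1 (hT f)
    have e1 : ‖(T f).fst‖ ≤ K * ‖f.fst‖ := by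
      refine Lp.norm_le_mul_norm_of_ae_le_mul ?_
      filter_upwards [h1] with x hx
      exact (congrArg norm hx).trans_le (hb (.inl x) (f.fst x))
    have e2 : ‖(T f).snd‖ ^ 2 ≤ K ^ 2 * ‖f.snd‖ ^ 2 := by
      rw [PiLp.norm_sq_eq_of_L2, PiLp.norm_sq_eq_of_L2, Finset.mul_sum]
      refine Finset.sum_le_sum fun x _ => ?_
      rw [← mul_pow]
      exact pow_le_pow_left₀ (norm_nonneg _)
        ((congrArg norm (h2 x)).trans_le (hb (.inr x) (f.snd x))) 2
    rw [← sq_le_sq₀ (norm_nonneg _) (by positivity), mul_pow, WithLp.prod_norm_sq_eq_of_L2,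
      WithLp.prod_norm_sq_eq_of_L2, mul_add, ← mul_pow]
    exact add_le_add (pow_le_pow_left₀ (norm_nonneg _) e1 2) e2
  exact ⟨LinearMap.mkContinuous
    { toFun := T, map_add' := hadd, map_smul' := hsmul } K hn,
    LinearMap.mkContinuous_norm_le _ hK _, hT⟩

/-- The resolvent of the multiplication operator off the spectrum. -/
theorem exists_inv_sub {d μ : ℝ} (hd : 0 < d) (h : ∀ x : C.Pt, d ≤ |C.pos x - μ|) :
    ∃ T : C.Space →L[ℂ] C.Space, ‖T‖ ≤ 1 / d ∧
      ∀ f, ∀ᶠ x in C.aeFilter, C.val (T f) x = (((C.pos x - μ)⁻¹ : ℝ) : ℂ) • C.val f x :=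
  exists_mul (fun t => (t - μ)⁻¹) (measurable_id.sub_const μ).inv (by positivity)
    fun x => abs_inv_le hd (h x)

variable {d μ : ℝ} {T : C.Space →L[ℂ] C.Space}

theorem isMul_inv_sub (hd : 0 < d) (h : ∀ x : C.Pt, d ≤ |C.pos x - μ|)
    (hT : ∀ f, ∀ᶠ x in C.aeFilter, C.val (T f) x = (((C.pos x - μ)⁻¹ : ℝ) : ℂ) • C.val f x)
    (f : C.Space) : IsMul C (T f) (f + (μ : ℂ) • T f) := by
  filter_upwards [hT f, val_add f ((μ : ℂ) • T f), val_smul (μ : ℂ) (T f)] with x h1 h2 h3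
  have hne : C.pos x - μ ≠ 0 := abs_pos.1 (hd.trans_le (h x))
  rw [h2, h3, h1, smul_smul, smul_smul]
  nth_rw 1 [← one_smul ℂ (C.val f x)]
  rw [← add_smul]
  congr 1
  have : ((C.pos x - μ : ℝ) : ℂ) ≠ 0 := Complex.ofReal_ne_zero.2 hne
  push_cast at this ⊢
  field_simp
  ring

theorem inv_sub_eq (hd : 0 < d) (h : ∀ x : C.Pt, d ≤ |C.pos x - μ|)
    (hT : ∀ f, ∀ᶠ x in C.aeFilter, C.val (T f) x = (((C.pos x - μ)⁻¹ : ℝ) : ℂ) • C.val f x)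
    {f g : C.Space} (hfg : IsMul C f g) : T (g - (μ : ℂ) • f) = f := by
  refine ext_val ?_
  filter_upwards [hT (g - (μ : ℂ) • f), hfg, val_sub g ((μ : ℂ) • f), val_smul (μ : ℂ) f]
    with x h1 h2 h3 h4
  have hne : C.pos x - μ ≠ 0 := abs_pos.1 (hd.trans_le (h x))
  have : ((C.pos x - μ : ℝ) : ℂ) ≠ 0 := Complex.ofReal_ne_zero.2 hne
  rw [h1, h3, h4, h2, ← sub_smul, smul_smul, Complex.ofReal_inv, ← Complex.ofReal_sub,
    inv_mul_cancel₀ this, one_smul]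

theorem inner_inv_sub
    (hT : ∀ f, ∀ᶠ x in C.aeFilter, C.val (T f) x = (((C.pos x - μ)⁻¹ : ℝ) : ℂ) • C.val f x)
    (f g : C.Space) : ⟪T f, g⟫_ℂ = ⟪f, T g⟫_ℂ := by
  rw [inner_eq_sumInt, inner_eq_sumInt]
  refine sumInt_congr ?_
  filter_upwards [hT f, hT g] with x e1 e2
  rw [e1, e2, inner_smul_left, inner_smul_right, Complex.conj_ofReal]

end Resolvent

/-! ### Spectral integrals -/

section Spectral

variable {C : Channel.{u}} {D : Channel.{v}}

theorem val_proj (S : Set ℝ) (hS : MeasurableSet S) (f : C.Space) :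
    ∀ᶠ x in C.aeFilter, C.val (C.proj S hS f) x = char S (C.pos x) • C.val f x :=
  eventually_aeFilter.2 ⟨MemLp.coeFn_toLp (C.memLp_char hS f.fst), fun _ => rfl⟩

variable {B : C.Space →L[ℂ] D.Space} {r : (x : D.Pt) → C.Space →L[ℂ] D.Fiber x}

/-- Where `B` acts through its rows `r x`, an integral sum is the row composed with the value of the
simple function at the same point. -/
theorem val_spectralSum (hB : ∀ f, ∀ᶠ x in D.aeFilter, D.val (B f) x = r x f)
    (S : SimpleFunc ℝ (C.Space →L[ℂ] C.Space)) (f : C.Space) :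
    ∀ᶠ x in D.aeFilter, D.val (spectralSum B S f) x = r x (S (D.pos x) f) := by
  have h1 : ∀ᶠ x in D.aeFilter, ∀ T ∈ S.range, D.val (B (T f)) x = r x (T f) :=
    (Filter.eventually_all_finset _).2 fun T _ => hB (T f)
  have h2 : ∀ᶠ x in D.aeFilter, ∀ T ∈ S.range,
      D.val (D.proj (S ⁻¹' {T}) (S.measurableSet_fiber T) (B (T f))) x =
        char (S ⁻¹' {T}) (D.pos x) • D.val (B (T f)) x :=
    (Filter.eventually_all_finset _).2 fun T _ => val_proj _ _ _
  have e : spectralSum B S f =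
      ∑ T ∈ S.range, D.proj (S ⁻¹' {T}) (S.measurableSet_fiber T) (B (T f)) := by
    rw [spectralSum, sum_apply]
    rfl
  rw [e]
  filter_upwards [h1, h2, val_sum S.range
    fun T => D.proj (S ⁻¹' {T}) (S.measurableSet_fiber T) (B (T f))] with x h1 h2 h3
  rw [h3, Finset.sum_eq_single (S (D.pos x))]
  · rw [h2 _ (S.mem_range_self _), h1 _ (S.mem_range_self _)]
    simp [char]
  · intro T hT hne
    rw [h2 T hT]
    have : D.pos x ∉ S ⁻¹' {T} := fun h => hne h.symm
    simp [char, this]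
  · exact fun h => (h (S.mem_range_self _)).elim

theorem spectralSum_sub (hB : ∀ f, ∀ᶠ x in D.aeFilter, D.val (B f) x = r x f)
    (S S' : SimpleFunc ℝ (C.Space →L[ℂ] C.Space)) :
    spectralSum B S - spectralSum B S' = spectralSum B (S - S') := by
  ext1 f
  refine ext_val ?_
  rw [sub_apply]
  filter_upwards [val_spectralSum hB S f, val_spectralSum hB S' f, val_spectralSum hB (S - S') f,
    val_sub (spectralSum B S f) (spectralSum B S' f)] with x h1 h2 h3 h4
  rw [h4, h1, h2, h3, SimpleFunc.coe_sub, Pi.sub_apply, sub_apply, map_sub]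

/-- The spectral integral of `T` acts pointwise through `r x ∘ T(x)`. On the continuous spectrum the
limit in `L²` is identified along a subsequence that converges almost everywhere. -/
theorem IsSpectralIntegral.val_eq (hB : ∀ f, ∀ᶠ x in D.aeFilter, D.val (B f) x = r x f)
    {T : ℝ → C.Space →L[ℂ] C.Space} {X : C.Space →L[ℂ] D.Space} (hX : IsSpectralIntegral B T X)
    (f : C.Space) : ∀ᶠ x in D.aeFilter, D.val (X f) x = r x (T (D.pos x) f) := by
  obtain ⟨S, hS, hlim⟩ := hX
  have hconv : ∀ᶠ x in D.aeFilter, Tendsto (fun n => S n (D.pos x)) atTop (𝓝 (T (D.pos x))) := by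
    have h : ∀ k : ℕ, ∃ N, ∀ n ≥ N, ∀ᵐ μ ∂D.specMeasure, ‖S n μ - T μ‖ ≤ 1 / ((k : ℝ) + 1) :=
      fun k => eventually_atTop.1 (hS _ (by positivity))
    choose N hN using h
    have h' : ∀ᵐ μ ∂D.specMeasure, ∀ k n, n ≥ N k → ‖S n μ - T μ‖ ≤ 1 / ((k : ℝ) + 1) :=
      ae_all_iff.2 fun k => ae_all_iff.2 fun n => by
        by_cases hn : n ≥ N k
        · filter_upwards [hN k n hn] with μ hμ _ using hμ
        · exact Eventually.of_forall fun μ h => (hn h).elim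
    filter_upwards [eventually_specMeasure.1 h'] with x hx
    refine tendsto_iff_norm_sub_tendsto_zero.2 (Metric.tendsto_atTop.2 fun ε hε => ?_)
    obtain ⟨k, hk⟩ := exists_nat_one_div_lt hε
    refine ⟨N k, fun n hn => ?_⟩
    rw [Real.dist_0_eq_abs, abs_norm]
    exact (hx k n hn).trans_lt hk
  have hr : ∀ᶠ x in D.aeFilter,
      Tendsto (fun n => r x (S n (D.pos x) f)) atTop (𝓝 (r x (T (D.pos x) f))) := by
    filter_upwards [hconv] with x hx
    exact ((r x).continuous.tendsto _).comp
      (((ContinuousLinearMap.apply ℂ C.Space f).continuous.tendsto _).comp hx)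
  have hsum : ∀ᶠ x in D.aeFilter, ∀ n,
      D.val (spectralSum B (S n) f) x = r x (S n (D.pos x) f) :=
    eventually_aeFilter.2 ⟨ae_all_iff.2 fun n =>
      (eventually_aeFilter.1 (val_spectralSum hB (S n) f)).1, fun x n =>
      (eventually_aeFilter.1 (val_spectralSum hB (S n) f)).2 x⟩
  have hf : Tendsto (fun n => spectralSum B (S n) f) atTop (𝓝 (X f)) :=
    ((ContinuousLinearMap.apply ℂ D.Space f).continuous.tendsto _).comp hlim
  obtain ⟨hr1, hr2⟩ := eventually_aeFilter.1 hr
  obtain ⟨hs1, hs2⟩ := eventually_aeFilter.1 hsum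
  refine eventually_aeFilter.2 ⟨?_, fun x => ?_⟩
  · have hf1 : Tendsto (fun n => (spectralSum B (S n) f).fst) atTop (𝓝 (X f).fst) :=
      ((WithLp.fstL 2 ℂ (Lp D.Gc 2 D.contMeasure) (PiLp 2 D.Gd)).continuous.tendsto _).comp hf
    obtain ⟨ns, hns, hae⟩ := (tendstoInMeasure_of_tendsto_Lp hf1).exists_seq_tendsto_ae
    filter_upwards [hae, hr1, hs1] with x h1 h2 h3
    refine tendsto_nhds_unique (X := D.Gc) h1 ((h2.comp hns.tendsto_atTop).congr fun n => ?_)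
    exact (h3 (ns n)).symm
  · have hf2 : Tendsto (fun n => D.val (spectralSum B (S n) f) (.inr x)) atTop
        (𝓝 (D.val (X f) (.inr x))) :=
      (((PiLp.proj 2 D.Gd x : PiLp 2 D.Gd →L[ℂ] D.Gd x).continuous.comp
        (WithLp.sndL 2 ℂ (Lp D.Gc 2 D.contMeasure) (PiLp 2 D.Gd)).continuous).tendsto _).comp hf
    exact tendsto_nhds_unique hf2 ((hr2 x).congr fun n => (hs2 x n).symm)

end Spectral

/-! ### Integral sums and the Hilbert-Schmidt norm -/

section HilbertSchmidt

theorem sum_sq_le_of_hilbertSchmidtNorm_le {E F : Type*} [NormedAddCommGroup E]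
    [InnerProductSpace ℂ E] [NormedAddCommGroup F] [NormedSpace ℂ F] {T : E →L[ℂ] F} {h : ℝ}
    (hh : 0 ≤ h) (hT : hilbertSchmidtNorm T ≤ ENNReal.ofReal h) {s : Finset E}
    (hs : Orthonormal ℂ ((↑) : {e // e ∈ s} → E)) : ∑ e ∈ s, ‖T e‖ ^ 2 ≤ h ^ 2 := by
  have h1 : ∑ e ∈ s, ‖T e‖ₑ ^ 2 ≤ (hilbertSchmidtNorm T) ^ 2 := by
    rw [hilbertSchmidtNorm, ← ENNReal.rpow_natCast, ← ENNReal.rpow_mul]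
    norm_num
    exact le_iSup₂ (f := fun (s : Finset E) (_ : Orthonormal ℂ ((↑) : {e // e ∈ s} → E)) =>
      ∑ e ∈ s, ‖T e‖ₑ ^ 2) s hs
  have h2 := h1.trans (pow_le_pow_left₀ zero_le hT 2)
  rw [← ENNReal.ofReal_pow hh] at h2
  have h3 : ∑ e ∈ s, ‖T e‖ₑ ^ 2 = ENNReal.ofReal (∑ e ∈ s, ‖T e‖ ^ 2) := by
    rw [ENNReal.ofReal_sum_of_nonneg fun _ _ => by positivity]
    refine Finset.sum_congr rfl fun e _ => ?_
    rw [ENNReal.ofReal_pow (norm_nonneg _), ofReal_norm]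
  rw [h3] at h2
  exact (ENNReal.ofReal_le_ofReal_iff (by positivity)).1 h2

theorem norm_le_of_hilbertSchmidtNorm_le {E F : Type*} [NormedAddCommGroup E]
    [InnerProductSpace ℂ E] [NormedAddCommGroup F] [NormedSpace ℂ F] {T : E →L[ℂ] F} {h : ℝ}
    (hh : 0 ≤ h) (hT : hilbertSchmidtNorm T ≤ ENNReal.ofReal h) : ‖T‖ ≤ h := by
  refine T.opNorm_le_of_unit_norm hh fun x hx => ?_
  -- a unit vector is an orthonormal system
  have h1 := sum_sq_le_of_hilbertSchmidtNorm_le hh hT (s := {x})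
    ⟨fun i => by rw [Finset.mem_singleton.1 i.2, hx], fun i j hij =>
      (hij (Subtype.ext ((Finset.mem_singleton.1 i.2).trans
        (Finset.mem_singleton.1 j.2).symm))).elim⟩
  rw [Finset.sum_singleton] at h1
  exact (sq_le_sq₀ (norm_nonneg _) hh).1 h1

variable {C : Channel.{u}} {D : Channel.{v}}

theorem inner_proj_left (S : Set ℝ) (hS : MeasurableSet S) (f g : C.Space) :
    ⟪C.proj S hS f, g⟫_ℂ = ⟪f, C.proj S hS g⟫_ℂ := by
  rw [inner_eq_sumInt, inner_eq_sumInt]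
  refine sumInt_congr ?_
  filter_upwards [val_proj S hS f, val_proj S hS g] with x h1 h2
  rw [h1, h2, inner_smul_left, inner_smul_right]
  by_cases h : C.pos x ∈ S <;> simp [char, h]

theorem proj_proj (S : Set ℝ) (hS : MeasurableSet S) (f : C.Space) :
    C.proj S hS (C.proj S hS f) = C.proj S hS f := by
  refine ext_val ?_
  filter_upwards [val_proj S hS (C.proj S hS f), val_proj S hS f] with x h1 h2
  rw [h1, h2]
  by_cases h : C.pos x ∈ S <;> simp [char, h]

theorem inner_proj_of_disjoint {S S' : Set ℝ} (hS : MeasurableSet S) (hS' : MeasurableSet S')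
    (h : Disjoint S S') (f g : C.Space) : ⟪C.proj S hS f, C.proj S' hS' g⟫_ℂ = 0 := by
  have h0 : (0 : ℂ) = ⟪(0 : C.Space), g⟫_ℂ := (inner_zero_left _).symm
  rw [h0, inner_eq_sumInt, inner_eq_sumInt]
  refine sumInt_congr ?_
  filter_upwards [val_proj S hS f, val_proj S' hS' g, val_zero (C := C)] with x h1 h2 h3
  rw [h1, h2, h3, inner_zero_left, inner_smul_left, inner_smul_right]
  by_cases hx : C.pos x ∈ S
  · simp [char, Set.disjoint_left.1 h hx]
  · simp [char, hx]

/-- The integral sums are bounded by the Hilbert-Schmidt norm of `B` times the essential supremum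
of the integrand: the pieces `E(Δₖ) B Tₖ f` are orthogonal, and after normalisation they form an
orthonormal system that can be inserted into the Hilbert-Schmidt norm of `B*`. -/
theorem norm_spectralSum_le {B : C.Space →L[ℂ] D.Space} {h K : ℝ} (hh : 0 ≤ h) (hK : 0 ≤ K)
    (hB : hilbertSchmidtNorm B.adjoint ≤ ENNReal.ofReal h)
    (S : SimpleFunc ℝ (C.Space →L[ℂ] C.Space))
    (hS : ∀ᶠ x in D.aeFilter, ‖S (D.pos x)‖ ≤ K) : ‖spectralSum B S‖ ≤ h * K := by
  classical
  refine ContinuousLinearMap.opNorm_le_bound _ (by positivity) fun f => ?_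
  set y : (C.Space →L[ℂ] C.Space) → D.Space :=
    fun T => D.proj (S ⁻¹' {T}) (S.measurableSet_fiber T) (B (T f)) with hy
  have horth : ∀ T T', T ≠ T' → ⟪y T, y T'⟫_ℂ = 0 := fun T T' hne =>
    inner_proj_of_disjoint _ _ (Disjoint.preimage _ (Set.disjoint_singleton.2 hne)) _ _
  set s := S.range.filter fun T => y T ≠ 0 with hs
  -- a value taken on a null set only has `y T = 0` and need not be bounded by `K`
  have hTK : ∀ T ∈ s, ‖T‖ ≤ K := by
    intro T hT
    by_contra hlt
    refine (Finset.mem_filter.1 hT).2 (ext_val ?_)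
    filter_upwards [val_proj (S ⁻¹' {T}) (S.measurableSet_fiber T) (B (T f)), hS,
      val_zero (C := D)] with x h1 h2 h3
    have : D.pos x ∉ S ⁻¹' {T} := fun hx => hlt (by
      have hx' : S (D.pos x) = T := hx
      rw [← hx']; exact h2)
    rw [h3, hy, h1]
    simp [char, this]
  set e : (C.Space →L[ℂ] C.Space) → D.Space := fun T => ((‖y T‖⁻¹ : ℝ) : ℂ) • y T with he
  have hen : ∀ T ∈ s, ‖e T‖ = 1 := fun T hT => by
    have : ‖y T‖ ≠ 0 := norm_ne_zero_iff.2 (Finset.mem_filter.1 hT).2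
    rw [he, norm_smul, Complex.norm_real, norm_inv, norm_norm, inv_mul_cancel₀ this]
  have heo : ∀ T T', T ≠ T' → ⟪e T, e T'⟫_ℂ = 0 := fun T T' hne => by
    rw [he, inner_smul_left, inner_smul_right, horth T T' hne, mul_zero, mul_zero]
  have hinj : Set.InjOn e s := fun T hT T' hT' hee => by
    by_contra hne
    have h0 := heo T T' hne
    rw [← hee, inner_self_eq_norm_sq_to_K, hen T hT] at h0
    norm_num at h0
  have hons : Orthonormal ℂ ((↑) : {v // v ∈ s.image e} → D.Space) := by
    refine ⟨fun v => ?_, fun v w hvw => ?_⟩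
    · obtain ⟨T, hT, hTv⟩ := Finset.mem_image.1 v.2
      rw [← hTv, hen T hT]
    · obtain ⟨T, hT, hTv⟩ := Finset.mem_image.1 v.2
      obtain ⟨T', hT', hTw⟩ := Finset.mem_image.1 w.2
      rw [← hTv, ← hTw]
      refine heo T T' fun hTT => hvw (Subtype.ext ?_)
      rw [← hTv, ← hTw, hTT]
  have hHS := sum_sq_le_of_hilbertSchmidtNorm_le hh hB hons
  rw [Finset.sum_image hinj] at hHS
  have hyn : ∀ T ∈ s, ‖y T‖ ≤ ‖B.adjoint (e T)‖ * (K * ‖f‖) := fun T hT => by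
    have h0 : ‖y T‖ ≠ 0 := norm_ne_zero_iff.2 (Finset.mem_filter.1 hT).2
    have h1 : ⟪e T, y T⟫_ℂ = (‖y T‖ : ℂ) := by
      rw [he, inner_smul_left, inner_self_eq_norm_sq_to_K, Complex.conj_ofReal]
      have : (‖y T‖ : ℂ) ≠ 0 := Complex.ofReal_ne_zero.2 h0
      push_cast
      field_simp
      rfl
    have h2 : D.proj (S ⁻¹' {T}) (S.measurableSet_fiber T) (e T) = e T := by
      rw [he, map_smul, hy, proj_proj]
    have h3 : ⟪e T, y T⟫_ℂ = ⟪B.adjoint (e T), T f⟫_ℂ := by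
      rw [ContinuousLinearMap.adjoint_inner_left, hy, ← inner_proj_left, h2]
    have h4 : ‖y T‖ = ‖⟪B.adjoint (e T), T f⟫_ℂ‖ := by
      rw [← h3, h1, Complex.norm_real, norm_norm]
    rw [h4]
    refine (norm_inner_le_norm _ _).trans ?_
    gcongr
    exact T.le_of_opNorm_le (hTK T hT) f
  have hsum : spectralSum B S f = ∑ T ∈ s, y T := by
    rw [hs, Finset.sum_filter_ne_zero, spectralSum, sum_apply]
    rfl
  have hpyth : ‖∑ T ∈ s, y T‖ ^ 2 = ∑ T ∈ s, ‖y T‖ ^ 2 := by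
    have h2 : ⟪∑ T ∈ s, y T, ∑ T ∈ s, y T⟫_ℂ = ∑ T ∈ s, (‖y T‖ : ℂ) ^ 2 := by
      rw [sum_inner]
      refine Finset.sum_congr rfl fun T hT => ?_
      rw [inner_sum, Finset.sum_eq_single T, inner_self_eq_norm_sq_to_K]
      · rfl
      · exact fun T' _ hne => horth T T' hne.symm
      · exact fun h => (h hT).elim
    have h1 : ((‖∑ T ∈ s, y T‖ ^ 2 : ℝ) : ℂ) = ((∑ T ∈ s, ‖y T‖ ^ 2 : ℝ) : ℂ) := by
      push_cast
      rw [← h2]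
      exact (inner_self_eq_norm_sq_to_K (𝕜 := ℂ) (∑ T ∈ s, y T)).symm
    exact_mod_cast h1
  rw [hsum, ← sq_le_sq₀ (norm_nonneg _) (by positivity), hpyth]
  calc ∑ T ∈ s, ‖y T‖ ^ 2 ≤ ∑ T ∈ s, ‖B.adjoint (e T)‖ ^ 2 * (K * ‖f‖) ^ 2 :=
        Finset.sum_le_sum fun T hT => by
          rw [← mul_pow]
          exact pow_le_pow_left₀ (norm_nonneg _) (hyn T hT) 2
    _ ≤ h ^ 2 * (K * ‖f‖) ^ 2 := by
        rw [← Finset.sum_mul]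
        gcongr
    _ = (h * K * ‖f‖) ^ 2 := by ring

end HilbertSchmidt

/-! ### The operator Riccati equation -/

section Distance

variable {C : Channel.{u}} {D : Channel.{v}}

theorem specDist_le {x y : ℝ} (hx : x ∈ C.spec) (hy : y ∈ D.spec) : specDist C D ≤ |x - y| := by
  refine csInf_le ⟨0, ?_⟩ ⟨x, hx, y, hy, rfl⟩
  rintro _ ⟨x, -, y, -, rfl⟩
  exact abs_nonneg _

theorem nonempty_of_specDist_pos (h : 0 < specDist C D) : C.spec.Nonempty ∧ D.spec.Nonempty := by
  have hne : (Set.image2 (fun x y => |x - y|) C.spec D.spec).Nonempty := by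
    by_contra hne
    rw [Set.not_nonempty_iff_eq_empty] at hne
    rw [specDist, hne, Real.sInf_empty] at h
    exact lt_irrefl _ h
  exact ⟨hne.of_image2_left, hne.of_image2_right⟩

theorem specDist_comm : specDist C D = specDist D C := by
  rw [specDist, specDist, Set.image2_swap]
  simp only [abs_sub_comm]

end Distance

section Riccati

variable {α : Channel.{u}} {β : Channel.{v}} {B Q : α.Space →L[ℂ] β.Space}
  {r : (x : β.Pt) → α.Space →L[ℂ] β.Fiber x} {R : ℝ → α.Space →L[ℂ] α.Space}

/-- A solution of the basic equation solves the Riccati equation `Q A - A Q + Q B* Q = B`. -/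
theorem isMul_solution (hB : ∀ f, ∀ᶠ x in β.aeFilter, β.val (B f) x = r x f)
    (hQ : ∀ f, ∀ᶠ x in β.aeFilter, β.val (Q f) x = r x (R (β.pos x) f))
    (hR : ∀ μ ∈ β.spec, IsResolvent (perturbed α (B.adjoint ∘L Q)) (μ : ℂ) (R μ))
    {f g : α.Space} (h : IsMul α f g) : IsMul β (Q f) (Q (g + B.adjoint (Q f)) - B f) := by
  filter_upwards [hB f, hQ f, hQ (g + B.adjoint (Q f)), val_sub (Q (g + B.adjoint (Q f))) (B f)]
    with x h1 h2 h3 h4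
  have h5 := (isResolvent_iff.1 (hR _ (pos_mem_spec x))).2 f g h
  rw [map_sub, map_smul, sub_eq_iff_eq_add] at h5
  have h6 : R (β.pos x) (g + B.adjoint (Q f)) = f + (β.pos x : ℂ) • R (β.pos x) f := h5
  rw [h4, h3, h1, h2, h6, map_add, map_smul, add_sub_cancel_left]

/-- The adjoint of a solution of the Riccati equation solves the dual Riccati equation. In
particular it maps the domain of one multiplication operator into that of the other, which follows
by writing it as `(A - μ)⁻¹ z` for a point `μ` of the other spectrum. -/
theorem isMul_adjoint_solution (hd : 0 < specDist α β)
    (hQ : ∀ f g, IsMul α f g → IsMul β (Q f) (Q (g + B.adjoint (Q f)) - B f))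
    {h k : β.Space} (hhk : IsMul β h k) :
    IsMul α (Q.adjoint h) (Q.adjoint k + B.adjoint h - Q.adjoint (B (Q.adjoint h))) := by
  obtain ⟨μ, hμ⟩ := (nonempty_of_specDist_pos hd).2
  have hμd : ∀ x : α.Pt, specDist α β ≤ |α.pos x - μ| := fun x => specDist_le (pos_mem_spec x) hμ
  obtain ⟨M, -, hM⟩ := exists_inv_sub hd hμd
  set z := Q.adjoint k + B.adjoint h - (μ : ℂ) • Q.adjoint h - Q.adjoint (B (Q.adjoint h))
    with hz
  have key : Q.adjoint h = M z := by
    refine ext_inner_left ℂ fun φ => ?_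
    have h1 := (hQ _ _ (isMul_inv_sub hd hμd hM φ)).inner_eq hhk
    have hQa : ∀ u v, ⟪Q u, v⟫_ℂ = ⟪u, Q.adjoint v⟫_ℂ := fun u v =>
      (ContinuousLinearMap.adjoint_inner_right Q u v).symm
    rw [inner_sub_left, hQa, hQa, ← ContinuousLinearMap.adjoint_inner_right B,
      inner_add_left, inner_add_left, inner_smul_left, Complex.conj_ofReal,
      ContinuousLinearMap.adjoint_inner_left, hQa] at h1
    rw [← inner_inv_sub hM, hz, inner_sub_right, inner_sub_right, inner_add_right,
      inner_smul_right]
    linear_combination h1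
  have h2 := isMul_inv_sub hd hμd hM z
  rw [← key] at h2
  convert h2 using 1
  rw [hz]
  abel

end Riccati

/-! ### The adjoint of a solution acts pointwise -/

/-- A measure that is small of second order on short intervals vanishes. -/
theorem measure_eq_zero_of_le_sq {ν : Measure ℝ} {K : ℝ}
    (h : ∀ (a : ℝ) (n : ℕ), 0 < n → ν (Set.Ico a (a + 1 / n)) ≤ ENNReal.ofReal (K / n ^ 2)) :
    ν = 0 := by
  have h1 : ∀ a : ℝ, ν (Set.Ico a (a + 1)) = 0 := fun a => by
    have h2 : ∀ n : ℕ, ν (Set.Ico a (a + 1)) ≤ ENNReal.ofReal (K / ((n : ℝ) + 1)) := fun n => by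
      have hn : (0 : ℝ) < (n : ℝ) + 1 := by positivity
      have hsub : Set.Ico a (a + 1) ⊆ ⋃ j ∈ Finset.range (n + 1),
          Set.Ico (a + j / ((n : ℝ) + 1)) (a + j / ((n : ℝ) + 1) + 1 / ((n + 1 : ℕ) : ℝ)) := by
        intro x hx
        have h0 : 0 ≤ (x - a) * ((n : ℝ) + 1) := mul_nonneg (by linarith [hx.1]) hn.le
        have hfl := Nat.floor_le h0
        have hlt := Nat.lt_floor_add_one ((x - a) * ((n : ℝ) + 1))
        have hjn : ⌊(x - a) * ((n : ℝ) + 1)⌋₊ < n + 1 := by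
          rw [Nat.floor_lt h0]
          push_cast
          nlinarith [hx.2]
        refine Set.mem_iUnion₂.2 ⟨_, Finset.mem_range.2 hjn, ?_, ?_⟩
        · have := (div_le_iff₀ hn).2 hfl
          linarith
        · push_cast
          rw [add_assoc, ← add_div]
          have := (lt_div_iff₀ hn).2 hlt
          linarith
      refine (measure_mono hsub).trans ((measure_biUnion_finset_le _ _).trans
        ((Finset.sum_le_card_nsmul _ _ _ fun j _ => h _ (n + 1) n.succ_pos).trans_eq ?_))
      rw [Finset.card_range, nsmul_eq_mul, ← ENNReal.ofReal_natCast (n + 1),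
        ← ENNReal.ofReal_mul (by positivity)]
      congr 1
      push_cast
      field_simp
    refine le_antisymm (ge_of_tendsto' (x := atTop) (f := fun n : ℕ =>
      ENNReal.ofReal (K / ((n : ℝ) + 1))) ?_ h2) zero_le
    have h3 : Tendsto (fun n : ℕ => K / ((n : ℝ) + 1)) atTop (𝓝 0) :=
      tendsto_const_nhds.div_atTop (tendsto_natCast_atTop_atTop.atTop_add tendsto_const_nhds)
    simpa using ENNReal.tendsto_ofReal h3
  refine Measure.measure_univ_eq_zero.1 (measure_mono_null (t := ⋃ k : ℤ, Set.Ico (k : ℝ) (k + 1))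
    (fun x _ => Set.mem_iUnion.2 ⟨⌊x⌋, Int.floor_le x, Int.lt_floor_add_one x⟩)
    (measure_iUnion_null fun k => h1 k))

theorem lintegral_enorm_val_sq_le {C : Channel.{u}} (z : C.Space) :
    ∫⁻ x, ‖z.fst x‖ₑ ^ 2 ∂C.contMeasure ≤ ENNReal.ofReal (‖z‖ ^ 2) := by
  have h := eLpNorm_nnreal_pow_eq_lintegral (f := (z.fst : C.cont → C.Gc)) (μ := C.contMeasure)
    (p := 2) (by norm_num)
  have h' : ∫⁻ x, ‖z.fst x‖ₑ ^ 2 ∂C.contMeasure =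
      eLpNorm (z.fst : C.cont → C.Gc) 2 C.contMeasure ^ 2 := by
    norm_num at h
    exact h.symm
  rw [h', ← Lp.enorm_def, ← ofReal_norm, ← ENNReal.ofReal_pow (norm_nonneg _)]
  exact ENNReal.ofReal_le_ofReal (pow_le_pow_left₀ (norm_nonneg _) (WithLp.norm_fst_le _ z) 2)

/-- A square integrable function on the continuous spectrum vanishes if near every point `t` it is
bounded by the distance to `t` times a square integrable function with norms bounded uniformly
in `t`. -/
theorem ae_eq_zero_of_local_bound {C : Channel.{u}} {φ : C.cont → C.Gc} {K A : ℝ} (hA : 0 ≤ A)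
    (hφ : AEStronglyMeasurable φ C.contMeasure)
    (h : ∀ t : C.cont, ∃ z : C.Space, ‖z‖ ≤ K ∧
      ∀ᵐ x ∂C.contMeasure, ‖φ x‖ ≤ |(x : ℝ) - t| * (‖z.fst x‖ + A)) :
    ∀ᵐ x ∂C.contMeasure, φ x = 0 := by
  set ν := (C.contMeasure.withDensity fun x => ‖φ x‖ₑ ^ 2).map ((↑) : C.cont → ℝ) with hν
  have hν0 : ν = 0 := by
    refine measure_eq_zero_of_le_sq (K := 2 * (K ^ 2 + A ^ 2)) fun a n hn => ?_
    have hn0 : (0 : ℝ) < n := by exact_mod_cast hn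
    have hIm : MeasurableSet (((↑) : C.cont → ℝ) ⁻¹' Set.Ico a (a + 1 / n)) :=
      measurable_subtype_coe measurableSet_Ico
    rw [hν, Measure.map_apply measurable_subtype_coe measurableSet_Ico, withDensity_apply _ hIm]
    set I := ((↑) : C.cont → ℝ) ⁻¹' Set.Ico a (a + 1 / n) with hI
    rcases I.eq_empty_or_nonempty with hemp | ⟨t, ht⟩
    · rw [hemp]; simp
    obtain ⟨z, hzK, hz⟩ := h t
    have hmI : C.contMeasure I ≤ 1 := by
      have : C.contMeasure I = (volume.restrict C.cont) (Set.Ico a (a + 1 / n)) := by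
        rw [← map_contMeasure, Measure.map_apply measurable_subtype_coe measurableSet_Ico]
      rw [this]
      refine (Measure.restrict_apply_le _ _).trans ?_
      rw [Real.volume_Ico, add_sub_cancel_left]
      refine ENNReal.ofReal_le_one.2 ?_
      rw [div_le_one hn0]
      exact_mod_cast hn
    calc ∫⁻ x in I, ‖φ x‖ₑ ^ 2 ∂C.contMeasure
        ≤ ∫⁻ x in I, ENNReal.ofReal (2 / n ^ 2) * (‖z.fst x‖ₑ ^ 2 + ENNReal.ofReal (A ^ 2))
            ∂C.contMeasure := by
          refine lintegral_mono_ae ?_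
          filter_upwards [ae_restrict_of_ae hz, ae_restrict_mem hIm] with x hx hxI
          have h1 : |(x : ℝ) - t| ≤ 1 / n := by
            rw [abs_le]
            constructor <;> linarith [hxI.1, hxI.2, ht.1, ht.2]
          have h2 : ‖φ x‖ ≤ 1 / n * (‖z.fst x‖ + A) :=
            hx.trans (mul_le_mul_of_nonneg_right h1 (by positivity))
          rw [← ofReal_norm, ← ofReal_norm, ← ENNReal.ofReal_pow (norm_nonneg _),
            ← ENNReal.ofReal_pow (norm_nonneg _), ← ENNReal.ofReal_add (by positivity)
            (by positivity), ← ENNReal.ofReal_mul (by positivity)]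
          refine ENNReal.ofReal_le_ofReal ((pow_le_pow_left₀ (norm_nonneg _) h2 2).trans ?_)
          rw [mul_pow, div_pow, one_pow, show (2 : ℝ) / n ^ 2 = 1 / n ^ 2 * 2 by ring, mul_assoc]
          refine mul_le_mul_of_nonneg_left ?_ (by positivity)
          nlinarith [sq_nonneg (‖z.fst x‖ - A)]
      _ = ENNReal.ofReal (2 / n ^ 2) * (∫⁻ x in I, ‖z.fst x‖ₑ ^ 2 ∂C.contMeasure +
            ENNReal.ofReal (A ^ 2) * C.contMeasure I) := by
          rw [lintegral_const_mul' _ _ ENNReal.ofReal_ne_top, lintegral_add_right _ measurable_const,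
            setLIntegral_const]
      _ ≤ ENNReal.ofReal (2 / n ^ 2) * (ENNReal.ofReal (K ^ 2) + ENNReal.ofReal (A ^ 2) * 1) := by
          gcongr
          refine (setLIntegral_le_lintegral _ _).trans ((lintegral_enorm_val_sq_le z).trans ?_)
          exact ENNReal.ofReal_le_ofReal (pow_le_pow_left₀ (norm_nonneg _) hzK 2)
      _ = ENNReal.ofReal (2 * (K ^ 2 + A ^ 2) / n ^ 2) := by
          rw [mul_one, ← ENNReal.ofReal_add (by positivity) (by positivity),
            ← ENNReal.ofReal_mul (by positivity)]
          congr 1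
          ring
  have h0 : ∫⁻ x, ‖φ x‖ₑ ^ 2 ∂C.contMeasure = 0 := by
    have h1 : ν Set.univ = 0 := by rw [hν0]; simp
    rw [hν, Measure.map_apply measurable_subtype_coe MeasurableSet.univ, Set.preimage_univ,
      withDensity_apply _ MeasurableSet.univ, Measure.restrict_univ] at h1
    exact h1
  rw [lintegral_eq_zero_iff' (hφ.enorm.pow_const 2)] at h0
  filter_upwards [h0] with x hx
  simpa using hx

section Dual

variable {α : Channel.{u}} {β : Channel.{v}} {B Q : α.Space →L[ℂ] β.Space} {θ γ L K : ℝ}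
  {s : (x : α.Pt) → β.Space →L[ℂ] α.Fiber x} {S : ℝ → β.Space →L[ℂ] β.Space}

/-- A common bound `K` makes the resolvents Lipschitz continuous with constant `K²`. -/
theorem norm_resolvent_sub_le {C : Channel.{u}} {W R R' : C.Space →L[ℂ] C.Space} {z z' : ℝ}
    (h : IsResolvent (perturbed C W) z R) (h' : IsResolvent (perturbed C W) z' R') (hK : ‖R‖ ≤ K)
    (hK' : ‖R'‖ ≤ K) : ‖R - R'‖ ≤ |z - z'| * K ^ 2 := by
  rw [resolvent_sub h h', norm_smul, ← Complex.ofReal_sub, Complex.norm_real, Real.norm_eq_abs,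
    sq]
  have := mul_le_mul hK hK' (norm_nonneg _) ((norm_nonneg _).trans hK)
  exact mul_le_mul_of_nonneg_left ((ContinuousLinearMap.opNorm_comp_le _ _).trans this)
    (abs_nonneg _)

theorem add_eq_sub_smul {V : Type*} [AddCommGroup V] [Module ℂ V] {z p b w q v v' : V} {x t : ℝ}
    (h1 : z = (x : ℂ) • q) (h2 : z = v + v') (h3 : v = p + b) (h4 : b = w)
    (h5 : v' = (t : ℂ) • q) : p + w = ((x - t : ℝ) : ℂ) • q := by
  rw [Complex.ofReal_sub, sub_smul, ← h1, h2, h3, h4, h5, add_sub_cancel_right]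

/-- The dual Riccati equation, applied to `S(t) k`: at the point `x`, the defect of the dual basic
equation with the resolvent frozen at `t` is `x - t` times the value of `Q* S(t) k`. -/
theorem sylvester_apply
    (hQ : ∀ h k, IsMul β h k →
      IsMul α (Q.adjoint h) (Q.adjoint k + B.adjoint h - Q.adjoint (B (Q.adjoint h))))
    (hB : ∀ g, ∀ᶠ x in α.aeFilter, α.val (B.adjoint g) x = s x g) {t : ℝ}
    (hS : IsResolvent (perturbed β (B ∘L (-Q.adjoint))) (t : ℂ) (S t)) (k : β.Space) :
    ∀ᶠ x in α.aeFilter, α.val (Q.adjoint k) x + s x (S t k) =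
      ((α.pos x - t : ℝ) : ℂ) • α.val (Q.adjoint (S t k)) x := by
  have h1 := hQ _ _ ((isResolvent_iff.1 hS).1 k)
  have e : Q.adjoint (k + (t : ℂ) • S t k - (B ∘L (-Q.adjoint)) (S t k)) + B.adjoint (S t k) -
      Q.adjoint (B (Q.adjoint (S t k))) =
      Q.adjoint k + B.adjoint (S t k) + (t : ℂ) • Q.adjoint (S t k) := by
    have e1 : (B ∘L (-Q.adjoint)) (S t k) = -B (Q.adjoint (S t k)) := map_neg B _
    rw [e1, sub_neg_eq_add, map_add, map_add, map_smul]
    abel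
  rw [e] at h1
  filter_upwards [h1, hB (S t k), val_add (Q.adjoint k + B.adjoint (S t k))
    ((t : ℂ) • Q.adjoint (S t k)), val_add (Q.adjoint k) (B.adjoint (S t k)),
    val_smul (t : ℂ) (Q.adjoint (S t k))] with x e1 e2 e3 e4 e5
  exact add_eq_sub_smul e1 e3 e4 e2 e5

/-- The adjoint of a solution acts pointwise through the resolvents of the dual problem. This is
the dual basic equation. At a discrete point the defect vanishes by `sylvester_apply` with `t = x`.
On the continuous spectrum, where one point has measure zero, freezing the resolvent at a point `t`
of a short interval costs another error of first order in `x - t`, and `ae_eq_zero_of_local_bound`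
applies. -/
theorem val_adjoint_solution (hd : 0 < specDist α β)
    (hQ : ∀ h k, IsMul β h k →
      IsMul α (Q.adjoint h) (Q.adjoint k + B.adjoint h - Q.adjoint (B (Q.adjoint h))))
    (hθ : 1 / 2 < θ) (hγ : 0 < γ) (hs : RowBound θ γ L s) (hL : 0 ≤ L)
    (hB : ∀ g, ∀ᶠ x in α.aeFilter, α.val (B.adjoint g) x = s x g)
    (hS : ∀ t ∈ α.spec, IsResolvent (perturbed β (B ∘L (-Q.adjoint))) (t : ℂ) (S t))
    (hK : ∀ t ∈ α.spec, ‖S t‖ ≤ K) (k : β.Space) :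
    ∀ᶠ x in α.aeFilter, α.val (Q.adjoint k) x = -s x (S (α.pos x) k) := by
  have hsyl := fun t (ht : t ∈ α.spec) => sylvester_apply hQ hB (hS t ht) k
  obtain ⟨t₀, ht₀⟩ := (nonempty_of_specDist_pos hd).1
  have hK0 : 0 ≤ K := (norm_nonneg _).trans (hK t₀ ht₀)
  -- the resolvents are Lipschitz continuous, hence the defect is measurable
  have hSc : Continuous fun x : α.cont => S x := by
    refine continuous_of_holder (K := K ^ 2) (γ := 1) one_pos fun x y => ?_
    rw [Real.rpow_one, mul_comm]
    exact norm_resolvent_sub_le (hS _ (Or.inl x.2)) (hS _ (Or.inl y.2)) (hK _ (Or.inl x.2))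
      (hK _ (Or.inl y.2))
  have hφ : AEStronglyMeasurable
      (fun x : α.cont => (Q.adjoint k).fst x + contRow s x (S x k)) α.contMeasure :=
    (Lp.aestronglyMeasurable _).add ((hs.continuous hγ).clm_apply
      (hSc.clm_apply continuous_const)).aestronglyMeasurable
  have h0 : ∀ᵐ x ∂α.contMeasure, (Q.adjoint k).fst x + contRow s x (S x k) = 0 := by
    refine ae_eq_zero_of_local_bound (K := ‖Q.adjoint‖ * (K * ‖k‖)) (A := L * (K ^ 2 * ‖k‖))
      (by positivity) hφ fun t => ⟨Q.adjoint (S t k), ?_, ?_⟩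
    · exact (Q.adjoint.le_opNorm _).trans (mul_le_mul_of_nonneg_left
        ((S t).le_of_opNorm_le (hK _ (Or.inl t.2)) k) (norm_nonneg _))
    · have ht := (eventually_aeFilter.1 (hsyl t (Or.inl t.2))).1
      filter_upwards [ht] with x hx
      have hx' : (Q.adjoint k).fst x + contRow s x (S t k) =
        (((x : ℝ) - t : ℝ) : ℂ) • (Q.adjoint (S t k)).fst x := hx
      have e : (Q.adjoint k).fst x + contRow s x (S x k) =
          (((x : ℝ) - t : ℝ) : ℂ) • (Q.adjoint (S t k)).fst x + contRow s x ((S x - S t) k) := by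
        rw [← hx', sub_apply, map_sub]
        abel
      rw [e, mul_add]
      refine norm_add_le_of_le ?_ ?_
      · rw [norm_smul, Complex.norm_real, Real.norm_eq_abs]
      · have h1 : ‖contRow s x‖ ≤ L :=
          (hs.bound (.inl x)).trans (mul_le_of_le_one_right hL (weight_le_one hθ _))
        have h2 := (S x - S t).le_of_opNorm_le (norm_resolvent_sub_le (hS _ (Or.inl x.2))
          (hS _ (Or.inl t.2)) (hK _ (Or.inl x.2)) (hK _ (Or.inl t.2))) k
        refine ((contRow s x).le_of_opNorm_le h1 _).trans
          ((mul_le_mul_of_nonneg_left h2 hL).trans_eq ?_)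
        ring
  refine eventually_aeFilter.2 ⟨?_, fun x => ?_⟩
  · filter_upwards [h0] with x hx
    exact eq_neg_of_add_eq_zero_left hx
  · have hx := (eventually_aeFilter.1 (hsyl x (Or.inr x.2))).2 x
    refine eq_neg_of_add_eq_zero_left (hx.trans ?_)
    change (((x : ℝ) - x : ℝ) : ℂ) • _ = _
    rw [sub_self, Complex.ofReal_zero, zero_smul]

end Dual

/-! ### The kernels of a solution -/

section Family

variable {C : Channel.{u}} {H : Type*} [NormedAddCommGroup H] [NormedSpace ℂ H]
  {θ γ L K : ℝ} {U : (x : C.Pt) → H →L[ℂ] C.Fiber x} {S : ℝ → H →L[ℂ] H}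

/-- Interpolation between the Lipschitz and the uniform bound of the resolvents; this is where the
power `K ^ (1 + γ)` comes from. -/
theorem norm_sub_le_rpow {S S' : H →L[ℂ] H} {t t' : ℝ} (hγ : 0 < γ) (hγ1 : γ ≤ 1) (hK : 0 < K)
    (h : ‖S‖ ≤ K) (h' : ‖S'‖ ≤ K) (hsub : ‖S - S'‖ ≤ |t - t'| * K ^ 2) :
    ‖S - S'‖ ≤ 2 * K ^ (1 + γ) * |t - t'| ^ γ := by
  have h1 : ‖S - S'‖ / K ≤ |t - t'| * K := by
    rw [div_le_iff₀ hK]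
    refine hsub.trans_eq ?_
    ring
  have h2 : ‖S - S'‖ / K ≤ 2 := by
    rw [div_le_iff₀ hK]
    linarith [norm_sub_le S S']
  have h3 := le_rpow_of_le (by positivity) hγ hγ1 h1 h2
  rw [div_le_iff₀ hK, Real.mul_rpow (abs_nonneg _) hK.le] at h3
  refine h3.trans_eq ?_
  rw [Real.rpow_add hK, Real.rpow_one]
  ring

/-- Composition of the rows with resolvents at the same point. -/
theorem RowBound.comp_resolvent (hU : RowBound θ γ L U) (hL : 0 ≤ L) (hθ : 1 / 2 < θ) (hγ : 0 < γ)
    (hγ1 : γ ≤ 1) (hK : 0 < K) (hS : ∀ t ∈ C.spec, ‖S t‖ ≤ K)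
    (hsub : ∀ t ∈ C.spec, ∀ t' ∈ C.spec, ‖S t - S t'‖ ≤ |t - t'| * K ^ 2) :
    RowBound θ γ (L * (2 * (K + K ^ (1 + γ)))) fun x => U x ∘L S (C.pos x) := by
  have hKγ : 0 < K ^ (1 + γ) := Real.rpow_pos_of_pos hK _
  refine ⟨fun x => ?_, fun x x' => ?_⟩
  · refine (ContinuousLinearMap.opNorm_comp_le _ _).trans ?_
    have h1 := weight_pos θ (C.pos x)
    refine (mul_le_mul (hU.bound x) (hS _ (pos_mem_spec x)) (norm_nonneg _)
      (by positivity)).trans ?_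
    have h2 : 0 ≤ L * weight θ (C.pos x) := by positivity
    nlinarith [mul_nonneg h2 hK.le, mul_nonneg h2 hKγ.le]
  · have e : contRow (fun x => U x ∘L S (C.pos x)) x - contRow (fun x => U x ∘L S (C.pos x)) x' =
        (contRow U x - contRow U x') ∘L S x + contRow U x' ∘L (S x - S x') := by
      ext v
      simp only [sub_apply, add_apply, ContinuousLinearMap.comp_apply, map_sub]
      change contRow U x (S x v) - contRow U x' (S x' v) = _
      abel
    have hx := hS x (Or.inl x.2)
    have hx' := hS x' (Or.inl x'.2)
    have h1 := norm_sub_le_rpow hγ hγ1 hK hx hx' (hsub x (Or.inl x.2) x' (Or.inl x'.2))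
    have h2 : ‖contRow U x'‖ ≤ L :=
      (hU.bound (.inl x')).trans (mul_le_of_le_one_right hL (weight_le_one hθ _))
    have h3 : 0 ≤ L * |(x : ℝ) - x'| ^ γ := by positivity
    rw [e]
    refine (norm_add_le_of_le
      ((ContinuousLinearMap.opNorm_comp_le _ _).trans
        (mul_le_mul (hU.holder x x') hx (norm_nonneg _) h3))
      ((ContinuousLinearMap.opNorm_comp_le _ _).trans
        (mul_le_mul h2 h1 (norm_nonneg _) hL))).trans ?_
    nlinarith [mul_nonneg h3 hK.le]

end Family

theorem div_one_add_abs_le {K : ℝ} (hK : 0 < K) (t : ℝ) : K / (1 + |t|) ≤ K :=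
  div_le_self hK.le (by linarith [abs_nonneg t])

theorem IsResolvent.unique {C : Channel.{u}} {W R R' : C.Space →L[ℂ] C.Space} {z : ℂ}
    (h : IsResolvent (perturbed C W) z R) (h' : IsResolvent (perturbed C W) z R') : R = R' := by
  ext1 f
  have h1 := (isResolvent_iff.1 h).2 _ _ ((isResolvent_iff.1 h').1 f)
  rwa [sub_add_cancel, add_sub_cancel_right] at h1

section Kernels

variable {α : Channel.{u}} {β : Channel.{v}} {B Q : α.Space →L[ℂ] β.Space} {b : Kernel β α}
  {θ γ M K K' : ℝ}

/-- The factor by which a resolvent estimate enters the kernel bounds. -/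
def resolventFactor (γ K : ℝ) : ℝ := 2 * (K + K ^ (1 + γ))

theorem resolventFactor_nonneg (hK : 0 < K) : 0 ≤ resolventFactor γ K := by
  unfold resolventFactor
  positivity

/-- If `Q` acts pointwise through `U(μ) = r(μ) R(μ)`, where `r(μ)` are the rows of `b` and `R(μ)`
the resolvents of `A + W`, and the adjoint of `W` acts pointwise through `-V(λ)`, then `Q` is the
integral operator with the kernel `(b(μ, λ) + U(μ) V(λ)*) / (λ - μ)`: apply
`U(μ) (A + W - μ) = r(μ)` to `(A - μ)⁻¹ φ`. -/
theorem isIntegralOperator_divDiff (hd : 0 < specDist α β) (hθ : 1 / 2 < θ) (hγ : 0 < γ)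
    (hγ1 : γ ≤ 1) (hM : 0 ≤ M) (hb : b.HolderBound θ γ M) {W : α.Space →L[ℂ] α.Space}
    {R : ℝ → α.Space →L[ℂ] α.Space}
    (hR : ∀ μ ∈ β.spec, IsResolvent (perturbed α W) (μ : ℂ) (R μ))
    {V : (x : α.Pt) → α.Space →L[ℂ] α.Fiber x} {U : (x : β.Pt) → α.Space →L[ℂ] β.Fiber x}
    {K L : ℝ} (hU : RowBound θ γ K U) (hV : RowBound θ γ L V) (hK : 0 ≤ K) (hL : 0 ≤ L)
    (hUr : ∀ x φ, U x φ = hb.row hθ hγ hM x (R (β.pos x) φ))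
    (hW : ∀ h, ∀ᶠ x in α.aeFilter, α.val ((-W).adjoint h) x = V x h)
    (hQ : ∀ f, ∀ᶠ x in β.aeFilter, β.val (Q f) x = U x f) :
    ∃ q : Kernel β α, IsIntegralOperator Q q ∧ q.HolderBound θ γ
      (4 / specDist α β * (1 + specDist α β ^ (-γ)) ^ 2 * (M + K * L)) := by
  have hUV := hU.sandwich hV hK
  have hg := hb.add hUV
  have hdist : ∀ (x : β.Pt) (y : α.Pt), specDist α β ≤ |α.pos y - β.pos x| := fun x y =>
    specDist_le (pos_mem_spec y) (pos_mem_spec x)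
  have hq := hg.divDiff (by positivity) hθ hγ hγ1 hd hdist
  refine ⟨_, hq.isIntegralOperator hθ hγ fun φ => ?_, hq⟩
  filter_upwards [hQ φ] with x hx
  obtain ⟨T, -, hT⟩ := exists_inv_sub hd (hdist x)
  have hres := (isResolvent_iff.1 (hR _ (pos_mem_spec x))).2 _ _
    (isMul_inv_sub hd (hdist x) hT φ)
  have hWT := hV.apply_eq_sumInt hθ hγ hW (U x) (T φ)
  have hUφ : U x φ = hb.row hθ hγ hM x (T φ) + U x ((-W) (T φ)) := by
    have e1 : φ + (β.pos x : ℂ) • T φ + W (T φ) - (β.pos x : ℂ) • T φ = φ - (-W) (T φ) := by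
      rw [neg_apply, sub_neg_eq_add]
      abel
    rw [e1, map_sub, sub_eq_iff_eq_add] at hres
    rw [hUr, hUr, hres, map_add]
  have hsw : Integrable (fun y : α.cont => sandwich U V x (.inl y) (α.val (T φ) (.inl y)))
      α.contMeasure := (hUV.isWeightedForm hγ x).integrable hθ (T φ)
  have hsum := sumInt_add (F := fun y => b x y (α.val (T φ) y))
    (G := fun y => sandwich U V x y (α.val (T φ) y))
    ((hb.isWeightedForm hγ x).integrable hθ (T φ)) hsw
  rw [hx, hUφ, hWT, hb.row_apply]
  refine hsum.symm.trans (sumInt_congr ?_)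
  filter_upwards [hT φ] with y hy
  have e2 : ∀ v, b x y v + sandwich U V x y v = (b x y + sandwich U V x y) v := fun v => rfl
  rw [hy, e2, map_smul]
  rfl

/-- The perturbation `B* Q` and the solution `Q` are integral operators. With the rows `r(μ)` of
`B`, the rows `s(λ)` of `B*` and the resolvents `R(μ)`, `S(λ)` of the two problems, the kernels are
`-s(λ) (s(λ') S(λ'))*` and `(b(μ, λ) + r(μ) R(μ) (s(λ) S(λ) B)*) / (λ - μ)`. -/
theorem exists_kernels (hd : 0 < specDist α β) (hθ : 1 / 2 < θ) (hγ : 0 < γ) (hγ1 : γ ≤ 1)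
    (hM : 0 ≤ M) (hBb : IsIntegralOperator B b) (hb : b.HolderBound θ γ M)
    (hsol : IsBasicSolution B Q) (hK : 0 < K) (hK' : 0 < K')
    (hα : ResolventBound α β (B.adjoint ∘L Q) K)
    (hβ : ResolventBound β α (B ∘L (-Q.adjoint)) K') :
    (∃ q : Kernel β α, IsIntegralOperator Q q ∧ q.HolderBound θ γ
      (4 / specDist α β * (1 + specDist α β ^ (-γ)) ^ 2 *
        (M + M * α.mass θ * resolventFactor γ K * (M * β.mass θ * resolventFactor γ K' * ‖B‖)))) ∧
    ∃ w : Kernel α α, IsIntegralOperator (B.adjoint ∘L Q) w ∧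
      w.HolderBound θ γ (M * β.mass θ * (M * β.mass θ * resolventFactor γ K')) := by
  obtain ⟨R, hR, hQint⟩ := hsol
  have hRK : ∀ μ ∈ β.spec, ‖R μ‖ ≤ K := fun μ hμ => by
    obtain ⟨R', hR', hn⟩ := hα μ hμ
    rw [(hR μ hμ).unique hR']
    exact hn.trans (div_one_add_abs_le hK μ)
  have hRsub : ∀ t ∈ β.spec, ∀ t' ∈ β.spec, ‖R t - R t'‖ ≤ |t - t'| * K ^ 2 :=
    fun t ht t' ht' => norm_resolvent_sub_le (hR t ht) (hR t' ht') (hRK t ht) (hRK t' ht')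
  choose! S hS hSn using hβ
  have hSK : ∀ t ∈ α.spec, ‖S t‖ ≤ K' := fun t ht => (hSn t ht).trans (div_one_add_abs_le hK' t)
  have hSsub : ∀ t ∈ α.spec, ∀ t' ∈ α.spec, ‖S t - S t'‖ ≤ |t - t'| * K' ^ 2 :=
    fun t ht t' ht' => norm_resolvent_sub_le (hS t ht) (hS t' ht') (hSK t ht) (hSK t' ht')
  -- the rows of `B` and of `B*`
  set r := hb.row hθ hγ hM with hr
  set s := hb.adj.row hθ hγ hM with hs
  have hrB : ∀ f, ∀ᶠ x in β.aeFilter, β.val (B f) x = r x f := hb.val_eq_row hθ hγ hM hBb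
  have hsB : ∀ g, ∀ᶠ x in α.aeFilter, α.val (B.adjoint g) x = s x g :=
    hb.val_adjoint hθ hγ hM hBb
  have hrR := hb.rowBound hθ hγ hM
  have hsR := hb.adj.rowBound hθ hγ hM
  have hLr : 0 ≤ M * α.mass θ := mul_nonneg hM mass_pos.le
  have hLs : 0 ≤ M * β.mass θ := mul_nonneg hM mass_pos.le
  -- the solution and its adjoint act pointwise
  have hQ := fun f => hQint.val_eq hrB f
  have hQadj := val_adjoint_solution hd (fun h k hhk => isMul_adjoint_solution hd
    (fun f g hfg => isMul_solution hrB hQ hR hfg) hhk) hθ hγ hsR hLs hsB hS hSK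
  have hU := hrR.comp_resolvent hLr hθ hγ hγ1 hK hRK hRsub
  have hV := hsR.comp_resolvent hLs hθ hγ hγ1 hK' hSK hSsub
  have hVneg := hsR.comp_resolvent (S := fun t => -S t) hLs hθ hγ hγ1 hK'
    (fun t ht => (norm_neg (S t)).trans_le (hSK t ht))
    (fun t ht t' ht' => by rw [neg_sub_neg, norm_sub_rev]; exact hSsub t ht t' ht')
  refine ⟨?_, ?_⟩
  · refine isIntegralOperator_divDiff hd hθ hγ hγ1 hM hb hR hU (hV.comp B)
      (mul_nonneg hLr (resolventFactor_nonneg hK))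
      (mul_nonneg (mul_nonneg hLs (resolventFactor_nonneg hK')) (norm_nonneg B))
      (fun x φ => rfl) (fun h => ?_) hQ
    have e : (-(B.adjoint ∘L Q)).adjoint h = -Q.adjoint (B h) := by
      rw [map_neg, ContinuousLinearMap.adjoint_comp, ContinuousLinearMap.adjoint_adjoint]
      rfl
    rw [e]
    filter_upwards [hQadj (B h), val_neg (Q.adjoint (B h))] with x h1 h2
    rw [h2, h1, neg_neg]
    rfl
  · have hw := hsR.sandwich hVneg hLs
    refine ⟨_, hw.isIntegralOperator hθ hγ fun f => ?_, hw⟩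
    filter_upwards [hsB (Q f)] with x hx
    refine hx.trans (hVneg.apply_eq_sumInt hθ hγ (fun h => ?_) (s x) f)
    filter_upwards [hQadj h] with y hy
    rw [hy]
    exact (map_neg (s y) _).symm

end Kernels

/-! ### Resolvents of small perturbations -/

section DistBound

theorem Channel.exists_Ici_subset {C : Channel.{u}} (h : ¬BddAbove C.spec) :
    ∃ a, Set.Ici a ⊆ C.spec := by
  have h1 : ∃ j, ¬BddAbove (C.I j) := by
    by_contra hc
    push Not at hc
    refine h (BddAbove.union ?_ C.disc.bddAbove)
    have := (Set.finite_univ (α := Fin C.n)).bddAbove_biUnion (S := C.I)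
    rw [Set.biUnion_univ] at this
    exact this.2 fun j _ => hc j
  obtain ⟨j, hj⟩ := h1
  obtain ⟨a, ha⟩ := (C.nonempty_interior_I j).mono interior_subset
  refine ⟨a, fun t ht => Or.inl (Set.mem_iUnion.2 ⟨j, ?_⟩)⟩
  obtain ⟨y, hy, hty⟩ := not_bddAbove_iff.1 hj t
  exact (C.ordConnected_I j).out ha hy ⟨ht, hty.le⟩

theorem Channel.exists_Iic_subset {C : Channel.{u}} (h : ¬BddBelow C.spec) :
    ∃ a, Set.Iic a ⊆ C.spec := by
  have h1 : ∃ j, ¬BddBelow (C.I j) := by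
    by_contra hc
    push Not at hc
    refine h (BddBelow.union ?_ C.disc.bddBelow)
    have := (Set.finite_univ (α := Fin C.n)).bddBelow_biUnion (S := C.I)
    rw [Set.biUnion_univ] at this
    exact this.2 fun j _ => hc j
  obtain ⟨j, hj⟩ := h1
  obtain ⟨a, ha⟩ := (C.nonempty_interior_I j).mono interior_subset
  refine ⟨a, fun t ht => Or.inl (Set.mem_iUnion.2 ⟨j, ?_⟩)⟩
  obtain ⟨y, hy, hty⟩ := not_bddBelow_iff.1 hj t
  exact (C.ordConnected_I j).out hy ha ⟨hty.le, ht⟩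

variable {α : Channel.{u}} {β : Channel.{v}}

/-- The distance of a point of one spectrum to the other spectrum grows linearly: as both are
finite unions of intervals, at most one of them is unbounded in each direction. -/
theorem exists_dist_bound (hd : 0 < specDist α β) :
    ∃ c > 0, ∀ x ∈ α.spec, ∀ μ ∈ β.spec, c * (1 + |μ|) ≤ |x - μ| := by
  have hdist : ∀ x ∈ α.spec, ∀ μ ∈ β.spec, specDist α β ≤ |x - μ| :=
    fun x hx μ hμ => specDist_le hx hμ
  have hdisj : ∀ t, t ∈ α.spec → t ∈ β.spec → False := fun t h1 h2 => by
    have := hdist t h1 t h2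
    rw [sub_self, abs_zero] at this
    linarith
  have habove : BddAbove α.spec ∨ BddAbove β.spec := by
    by_contra! hc
    obtain ⟨a, ha⟩ := exists_Ici_subset hc.1
    obtain ⟨a', ha'⟩ := exists_Ici_subset hc.2
    exact hdisj (max a a') (ha (Set.mem_Ici.2 (le_max_left _ _)))
      (ha' (Set.mem_Ici.2 (le_max_right _ _)))
  have hbelow : BddBelow α.spec ∨ BddBelow β.spec := by
    by_contra! hc
    obtain ⟨a, ha⟩ := exists_Iic_subset hc.1
    obtain ⟨a', ha'⟩ := exists_Iic_subset hc.2
    exact hdisj (min a a') (ha (Set.mem_Iic.2 (min_le_left _ _)))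
      (ha' (Set.mem_Iic.2 (min_le_right _ _)))
  obtain ⟨U, hU⟩ : ∃ U, (∀ x ∈ α.spec, x ≤ U) ∨ ∀ x ∈ β.spec, x ≤ U := by
    rcases habove with ⟨U, hU⟩ | ⟨U, hU⟩
    · exact ⟨U, Or.inl fun x hx => hU hx⟩
    · exact ⟨U, Or.inr fun x hx => hU hx⟩
  obtain ⟨V, hV⟩ : ∃ V, (∀ x ∈ α.spec, V ≤ x) ∨ ∀ x ∈ β.spec, V ≤ x := by
    rcases hbelow with ⟨V, hV⟩ | ⟨V, hV⟩
    · exact ⟨V, Or.inl fun x hx => hV hx⟩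
    · exact ⟨V, Or.inr fun x hx => hV hx⟩
  set L := max 1 (max |U| |V|) with hL
  have hL1 : 1 ≤ L := le_max_left _ _
  have hUL : U ≤ L := (le_abs_self U).trans ((le_max_left _ _).trans (le_max_right _ _))
  have hVL : -L ≤ V := by
    have : |V| ≤ L := (le_max_right _ _).trans (le_max_right _ _)
    linarith [neg_abs_le V]
  refine ⟨min (specDist α β / (1 + 2 * L)) (1 / 4), by positivity, fun x hx μ hμ => ?_⟩
  have h1 : (0 : ℝ) ≤ 1 + |μ| := by positivity
  rcases le_or_gt |μ| (2 * L) with h | h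
  · have h2 : min (specDist α β / (1 + 2 * L)) (1 / 4) * (1 + |μ|) ≤
        specDist α β / (1 + 2 * L) * (1 + 2 * L) :=
      mul_le_mul (min_le_left _ _) (by linarith) h1 (by positivity)
    rw [div_mul_cancel₀ _ (by positivity)] at h2
    exact h2.trans (hdist x hx μ hμ)
  · refine (mul_le_mul_of_nonneg_right (min_le_right _ _) h1).trans ?_
    rcases le_total 0 μ with h0 | h0
    · rw [abs_of_nonneg h0] at h ⊢
      rcases hU with hU | hU
      · rw [abs_sub_comm]
        linarith [le_abs_self (μ - x), hU x hx]
      · linarith [hU μ hμ]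
    · rw [abs_of_nonpos h0] at h ⊢
      rcases hV with hV | hV
      · linarith [le_abs_self (x - μ), hV x hx]
      · linarith [hV μ hμ]

end DistBound

section Neumann

variable {C : Channel.{u}} {W : C.Space →L[ℂ] C.Space}

/-- The resolvent of a perturbation smaller than the distance to the spectrum. -/
theorem exists_resolvent {d μ : ℝ} (hd : 0 < d) (h : ∀ x : C.Pt, d ≤ |C.pos x - μ|)
    (hW : ‖W‖ < d) :
    ∃ R, IsResolvent (perturbed C W) (μ : ℂ) R ∧ ‖R‖ ≤ 1 / (d - ‖W‖) := by
  obtain ⟨T, hTn, hT⟩ := exists_inv_sub hd h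
  have hlt : ‖-(T ∘L W)‖ < 1 := by
    rw [norm_neg]
    refine (ContinuousLinearMap.opNorm_comp_le _ _).trans_lt ?_
    refine (mul_le_mul_of_nonneg_right hTn (norm_nonneg W)).trans_lt ?_
    rw [one_div, inv_mul_lt_iff₀ hd]
    linarith
  obtain ⟨G, hG1, hG2⟩ : ∃ G : C.Space →L[ℂ] C.Space,
      (∀ f, G f + T (W (G f)) = f) ∧ ∀ f, G (f + T (W f)) = f := by
    set U := Units.oneSub (-(T ∘L W)) hlt with hU
    have hUv : ∀ f, (U : C.Space →L[ℂ] C.Space) f = f + T (W f) := fun f => by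
      rw [hU, Units.val_oneSub, sub_neg_eq_add]
      rfl
    refine ⟨(U⁻¹ : (C.Space →L[ℂ] C.Space)ˣ), fun f => ?_, fun f => ?_⟩
    · rw [← hUv]
      exact congrArg (fun S : C.Space →L[ℂ] C.Space => S f) U.mul_inv
    · rw [← hUv]
      exact congrArg (fun S : C.Space →L[ℂ] C.Space => S f) U.inv_mul
  have hfix : ∀ f, T (f - W (G (T f))) = G (T f) := fun f => by
    rw [map_sub, sub_eq_iff_eq_add]
    exact (hG1 (T f)).symm
  refine ⟨G ∘L T, isResolvent_iff.2 ⟨fun f => ?_, fun f g hfg => ?_⟩, ?_⟩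
  · have h1 := isMul_inv_sub hd h hT (f - W (G (T f)))
    rw [hfix] at h1
    rw [sub_add_eq_add_sub] at h1
    exact h1
  · have e : g + W f - (μ : ℂ) • f = (g - (μ : ℂ) • f) + W f := by abel
    rw [e]
    change G (T _) = f
    rw [map_add, inv_sub_eq hd h hT hfg, hG2]
  · have hdW : 0 < d - ‖W‖ := by linarith
    refine ContinuousLinearMap.opNorm_le_bound _ (by positivity) fun f => ?_
    change ‖G (T f)‖ ≤ _
    have h1 : ‖G (T f)‖ ≤ 1 / d * (‖f‖ + ‖W‖ * ‖G (T f)‖) := by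
      nth_rw 1 [← hfix f]
      refine (T.le_of_opNorm_le hTn _).trans (mul_le_mul_of_nonneg_left ?_ (by positivity))
      exact (norm_sub_le _ _).trans (add_le_add le_rfl (W.le_opNorm _))
    rw [one_div, ← div_eq_inv_mul, le_div_iff₀ hd] at h1
    rw [one_div, ← div_eq_inv_mul, le_div_iff₀ hdW]
    linarith

variable {D : Channel.{v}}

/-- Both resolvent bounds that are needed: one in terms of the distance of the spectra alone, and
one that decays at infinity. -/
theorem exists_resolvents (hd : 0 < specDist C D) (hW : ‖W‖ < specDist C D) :
    ∃ K > 0, ∀ μ ∈ D.spec, ∃ R, IsResolvent (perturbed C W) ((μ : ℝ) : ℂ) R ∧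
      ‖R‖ ≤ 1 / (specDist C D - ‖W‖) ∧ ‖R‖ ≤ K / (1 + |μ|) := by
  obtain ⟨c, hc, hcd⟩ := exists_dist_bound hd
  set d := specDist C D with hdd
  have hκ : 0 < 1 - ‖W‖ / d := by
    rw [sub_pos, div_lt_one hd]
    exact hW
  refine ⟨1 / (c * (1 - ‖W‖ / d)), by positivity, fun μ hμ => ?_⟩
  have hdμ : ∀ x : C.Pt, max d (c * (1 + |μ|)) ≤ |C.pos x - μ| := fun x =>
    max_le (specDist_le (pos_mem_spec x) hμ) (hcd _ (pos_mem_spec x) _ hμ)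
  have hle := le_max_left d (c * (1 + |μ|))
  obtain ⟨R, hR, hRn⟩ := exists_resolvent (hd.trans_le hle) hdμ (hW.trans_le hle)
  refine ⟨R, hR, hRn.trans ?_, hRn.trans ?_⟩
  · exact one_div_le_one_div_of_le (by linarith) (by linarith)
  · rw [div_div]
    have h0 : (0 : ℝ) < 1 + |μ| := by positivity
    refine one_div_le_one_div_of_le (by positivity) ?_
    set m := max d (c * (1 + |μ|)) with hm
    have h1 : ‖W‖ ≤ m * (‖W‖ / d) := by
      rw [← mul_div_assoc, le_div_iff₀ hd, mul_comm m]
      exact mul_le_mul_of_nonneg_left hle (norm_nonneg _)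
    have h2 : c * (1 + |μ|) * (1 - ‖W‖ / d) ≤ m * (1 - ‖W‖ / d) :=
      mul_le_mul_of_nonneg_right (le_max_right _ _) hκ.le
    linarith

end Neumann

/-! ### Existence of spectral integrals -/

/-- A Lipschitz function that decays at infinity is a uniform limit of simple functions: sample it
on the cells of a grid of mesh `1 / m`, and put `0` on the cells that are far out or do not meet
`s`. -/
theorem exists_simpleFunc_norm_sub_le {E : Type*} [NormedAddCommGroup E] {T : ℝ → E} {s : Set ℝ}
    {L K ε : ℝ} (hε : 0 < ε)
    (hT : ∀ x ∈ s, ∀ y ∈ s, ‖T x - T y‖ ≤ |x - y| * L) (hTK : ∀ x ∈ s, ‖T x‖ ≤ K / (1 + |x|)) :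
    ∃ S : SimpleFunc ℝ E, ∀ x ∈ s, ‖S x - T x‖ ≤ ε := by
  classical
  obtain ⟨m, hm⟩ := exists_nat_gt (max 0 (L / ε))
  have hm0 : (0 : ℝ) < m := (le_max_left _ _).trans_lt hm
  have hmL : L ≤ m * ε := ((div_le_iff₀ hε).1 ((le_max_right _ _).trans hm.le))
  obtain ⟨N, hN⟩ := exists_nat_gt (m * K / ε)
  have hNK : m * K ≤ N * ε := (div_le_iff₀ hε).1 hN.le
  set p : ℤ → Prop := fun k => |k| ≤ N ∧ ∃ x ∈ s, ⌊m * x⌋ = k with hp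
  set v : ℤ → E := fun k => if h : p k then T h.2.choose else 0 with hv
  refine ⟨⟨fun x => v ⌊m * x⌋, fun y => ?_, ?_⟩, fun x hx => ?_⟩
  · have h1 : Measurable fun x : ℝ => ⌊m * x⌋ := Int.measurable_floor.comp (measurable_const_mul _)
    exact h1 (MeasurableSet.of_discrete (s := v ⁻¹' {y}))
  · refine (((Set.finite_Icc (-(N : ℤ)) N).image v).insert 0).subset ?_
    rintro _ ⟨x, rfl⟩
    by_cases h : |⌊m * x⌋| ≤ (N : ℤ)
    · exact Or.inr ⟨_, abs_le.1 h, rfl⟩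
    · refine Or.inl ?_
      simp only [hv, hp]
      rw [dif_neg fun h' => h h'.1]
  · change ‖v ⌊m * x⌋ - T x‖ ≤ ε
    by_cases h : |⌊m * x⌋| ≤ (N : ℤ)
    · have hpk : p ⌊m * x⌋ := ⟨h, x, hx, rfl⟩
      obtain ⟨hys, hy⟩ := hpk.2.choose_spec
      simp only [hv]
      rw [dif_pos hpk]
      set y := hpk.2.choose with hyd
      have h1 : |y - x| ≤ 1 / m := by
        have h2 := Int.floor_le (m * x)
        have h3 := Int.lt_floor_add_one (m * x)
        have h4 := Int.floor_le (m * y)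
        have h5 := Int.lt_floor_add_one (m * y)
        rw [hy] at h4 h5
        rw [le_div_iff₀ hm0, ← abs_of_pos hm0, ← abs_mul, abs_le]
        constructor <;> nlinarith
      have h6 := hT y hys x hx
      rcases le_total 0 L with hL | hL
      · calc _ ≤ _ := h6
          _ ≤ 1 / m * L := mul_le_mul_of_nonneg_right h1 hL
          _ ≤ ε := by
            rw [one_div, ← div_eq_inv_mul, div_le_iff₀ hm0]
            linarith
      · exact h6.trans ((mul_nonpos_of_nonneg_of_nonpos (abs_nonneg _) hL).trans hε.le)
    · have e : v ⌊m * x⌋ = 0 := by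
        simp only [hv, hp]
        rw [dif_neg fun h' => h h'.1]
      rw [e, zero_sub, norm_neg]
      refine (hTK x hx).trans ?_
      have h0 : (0 : ℝ) < 1 + |x| := by positivity
      rw [div_le_iff₀ h0]
      have h1 : (N : ℝ) + 1 ≤ |(⌊m * x⌋ : ℝ)| := by
        have : (N : ℤ) + 1 ≤ |⌊m * x⌋| := by lia
        exact_mod_cast this
      have h2 : |(⌊m * x⌋ : ℝ)| ≤ |m * x| + 1 := by
        have h3 := Int.floor_le (m * x)
        have h4 := Int.lt_floor_add_one (m * x)
        rw [abs_le]
        constructor <;> linarith [neg_abs_le (m * x), le_abs_self (m * x)]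
      rw [abs_mul, abs_of_pos hm0] at h2
      have h5 : (N : ℝ) ≤ m * |x| := by linarith
      have h6 : m * K ≤ m * (ε * |x|) := by nlinarith
      have h7 := le_of_mul_le_mul_left h6 hm0
      linarith

theorem norm_sub_le_of_tendsto {E : Type*} [NormedAddCommGroup E] {v v' : ℕ → E} {x x' : E} {c : ℝ}
    (h : Tendsto v atTop (𝓝 x)) (h' : Tendsto v' atTop (𝓝 x'))
    (hc : ∀ᶠ n in atTop, ‖v n - v' n‖ ≤ c) : ‖x - x'‖ ≤ c :=
  le_of_tendsto (h.sub h').norm hc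

section SpectralExistence

variable {C : Channel.{u}} {D : Channel.{v}} {B : C.Space →L[ℂ] D.Space}
  {r : (x : D.Pt) → C.Space →L[ℂ] D.Fiber x} {h : ℝ}

/-- When `B` is Hilbert-Schmidt, the integral sums depend continuously on the simple functions in
the uniform norm, so that decaying Lipschitz functions are integrable. -/
theorem exists_isSpectralIntegral (hB : ∀ f, ∀ᶠ x in D.aeFilter, D.val (B f) x = r x f)
    (hh : 0 ≤ h) (hHS : hilbertSchmidtNorm B.adjoint ≤ ENNReal.ofReal h)
    {T : ℝ → C.Space →L[ℂ] C.Space} {L K : ℝ}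
    (hT : ∀ x ∈ D.spec, ∀ y ∈ D.spec, ‖T x - T y‖ ≤ |x - y| * L)
    (hTK : ∀ x ∈ D.spec, ‖T x‖ ≤ K / (1 + |x|)) : ∃ X, IsSpectralIntegral B T X := by
  have hex := fun n : ℕ => exists_simpleFunc_norm_sub_le (ε := 1 / ((n : ℝ) + 1))
    (by positivity) hT hTK
  choose S hS using hex
  have hlim : Tendsto (fun n : ℕ => h * (2 * (1 / ((n : ℝ) + 1)))) atTop (𝓝 0) := by
    simpa using (tendsto_one_div_add_atTop_nhds_zero_nat.const_mul (2 : ℝ)).const_mul h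
  have hcauchy : CauchySeq fun n => spectralSum B (S n) := by
    refine cauchySeq_of_le_tendsto_0 (s := fun n => spectralSum B (S n))
      (fun n : ℕ => h * (2 * (1 / ((n : ℝ) + 1))))
      (fun n m N hn hm => ?_) hlim
    refine (dist_eq_norm (spectralSum B (S n)) (spectralSum B (S m))).trans_le ?_
    rw [spectralSum_sub hB]
    refine norm_spectralSum_le hh (by positivity) hHS _ (Eventually.of_forall fun x => ?_)
    have h1 := hS n _ (pos_mem_spec x)
    have h2 := hS m _ (pos_mem_spec x)
    have h3 : 1 / ((n : ℝ) + 1) ≤ 1 / ((N : ℝ) + 1) :=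
      one_div_le_one_div_of_le (by positivity) (by exact_mod_cast Nat.succ_le_succ hn)
    have h4 : 1 / ((m : ℝ) + 1) ≤ 1 / ((N : ℝ) + 1) :=
      one_div_le_one_div_of_le (by positivity) (by exact_mod_cast Nat.succ_le_succ hm)
    rw [SimpleFunc.coe_sub, Pi.sub_apply, ← sub_sub_sub_cancel_right _ _ (T (D.pos x))]
    refine (norm_sub_le _ _).trans ?_
    linarith
  obtain ⟨X, hX⟩ := cauchySeq_tendsto_of_complete hcauchy
  refine ⟨X, S, fun ε hε => ?_, hX⟩
  obtain ⟨N, hN⟩ := exists_nat_one_div_lt hε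
  filter_upwards [eventually_ge_atTop N] with n hn
  refine eventually_specMeasure.2 (Eventually.of_forall fun x => ?_)
  refine (hS n _ (pos_mem_spec x)).trans (le_trans ?_ hN.le)
  exact one_div_le_one_div_of_le (by positivity) (by exact_mod_cast Nat.succ_le_succ hn)

theorem IsSpectralIntegral.norm_sub_le (hB : ∀ f, ∀ᶠ x in D.aeFilter, D.val (B f) x = r x f)
    (hh : 0 ≤ h) (hHS : hilbertSchmidtNorm B.adjoint ≤ ENNReal.ofReal h)
    {T T' : ℝ → C.Space →L[ℂ] C.Space} {X X' : C.Space →L[ℂ] D.Space}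
    (hX : IsSpectralIntegral B T X) (hX' : IsSpectralIntegral B T' X') {K : ℝ} (hK : 0 ≤ K)
    (hT : ∀ x ∈ D.spec, ‖T x - T' x‖ ≤ K) : ‖X - X'‖ ≤ h * K := by
  obtain ⟨S, hS, hlim⟩ := hX
  obtain ⟨S', hS', hlim'⟩ := hX'
  have key : ∀ ε > 0, ‖X - X'‖ ≤ h * (K + 2 * ε) := fun ε hε => by
    refine norm_sub_le_of_tendsto (E := C.Space →L[ℂ] D.Space) hlim hlim' ?_
    filter_upwards [hS ε hε, hS' ε hε] with n hn hn'
    rw [spectralSum_sub hB]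
    refine norm_spectralSum_le hh (by positivity) hHS _ ?_
    filter_upwards [eventually_specMeasure.1 hn, eventually_specMeasure.1 hn'] with x h1 h2
    have h3 := hT _ (pos_mem_spec x)
    rw [SimpleFunc.coe_sub, Pi.sub_apply]
    have e : S n (D.pos x) - S' n (D.pos x) = (S n (D.pos x) - T (D.pos x)) +
        (T (D.pos x) - T' (D.pos x)) - (S' n (D.pos x) - T' (D.pos x)) := by abel
    rw [e]
    refine (_root_.norm_sub_le _ _).trans ?_
    have h4 := norm_add_le (S n (D.pos x) - T (D.pos x)) (T (D.pos x) - T' (D.pos x))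
    linarith
  have hl : Tendsto (fun n : ℕ => h * (K + 2 * (1 / ((n : ℝ) + 1)))) atTop (𝓝 (h * K)) := by
    simpa using ((tendsto_one_div_add_atTop_nhds_zero_nat.const_mul (2 : ℝ)).const_add K).const_mul
      h
  exact ge_of_tendsto' hl fun n => key _ (by positivity)

theorem isSpectralIntegral_zero (hB : ∀ f, ∀ᶠ x in D.aeFilter, D.val (B f) x = r x f) :
    IsSpectralIntegral B (fun _ => 0) 0 := by
  have h0 : spectralSum B (0 : SimpleFunc ℝ (C.Space →L[ℂ] C.Space)) = 0 := by
    have := spectralSum_sub hB 0 0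
    rwa [sub_self, sub_self, eq_comm] at this
  refine ⟨fun _ => 0, fun ε hε => Eventually.of_forall fun n =>
    Eventually.of_forall fun μ => ?_, ?_⟩
  · simpa using hε.le
  · simp only [h0]
    exact tendsto_const_nhds

end SpectralExistence

/-! ### The fixed point problem -/

section FixedPoint

/-- The contraction principle on a ball centred at the origin. -/
theorem exists_fixedPoint_of_norm_le {E : Type*} [NormedAddCommGroup E] [CompleteSpace E]
    {F : E → E} {κ δ : ℝ} (hδ : 0 ≤ δ) (hκ : 0 ≤ κ) (hκ1 : κ < 1)
    (hF : ∀ x, ‖x‖ ≤ δ → ‖F x‖ ≤ δ)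
    (hF' : ∀ x y, ‖x‖ ≤ δ → ‖y‖ ≤ δ → ‖F x - F y‖ ≤ κ * ‖x - y‖) :
    ∃ x, ‖x‖ ≤ δ ∧ F x = x := by
  have hmaps : Set.MapsTo F (Metric.closedBall 0 δ) (Metric.closedBall 0 δ) := fun x hx =>
    mem_closedBall_zero_iff.2 (hF x (mem_closedBall_zero_iff.1 hx))
  have hcontr : ContractingWith ⟨κ, hκ⟩ (hmaps.restrict F _ _) := by
    refine ⟨hκ1, LipschitzWith.of_dist_le_mul fun x y => ?_⟩
    rw [Subtype.dist_eq, Subtype.dist_eq, dist_eq_norm, dist_eq_norm]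
    exact hF' x y (mem_closedBall_zero_iff.1 x.2) (mem_closedBall_zero_iff.1 y.2)
  obtain ⟨x, hx, hfix, -⟩ := hcontr.exists_fixedPoint' Metric.isClosed_closedBall.isComplete
    hmaps (Metric.mem_closedBall_self hδ) (edist_ne_top _ _)
  exact ⟨x, mem_closedBall_zero_iff.1 hx, hfix⟩

variable {α : Channel.{u}} {β : Channel.{v}} {B Q Q' X X' : α.Space →L[ℂ] β.Space}
  {r : (x : β.Pt) → α.Space →L[ℂ] β.Fiber x} {h δ : ℝ}

/-- `X` is the value at `Q` of the right-hand side of the basic equation, so that the solutions are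
the fixed points. -/
def IsBasicImage (B Q X : α.Space →L[ℂ] β.Space) : Prop :=
  ∃ R : ℝ → α.Space →L[ℂ] α.Space,
    (∀ μ ∈ β.spec, IsResolvent (perturbed α (B.adjoint ∘L Q)) (μ : ℂ) (R μ)) ∧
      IsSpectralIntegral B R X

/-- The smallness condition in a form free of minima: `h` bounds the Hilbert-Schmidt norm of `B*`
and `δ` is the radius of the ball in which solutions are sought. The bound `lt` gives the
contraction property, and `lt'` says that the ball is mapped into itself. -/
structure IsSmall (B : α.Space →L[ℂ] β.Space) (h δ : ℝ) : Prop where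
  nonneg : 0 ≤ h
  le : hilbertSchmidtNorm B.adjoint ≤ ENNReal.ofReal h
  pos : 0 < δ
  lt : h * (1 + δ) < specDist α β
  lt' : h * (1 + δ ^ 2) < specDist α β * δ

theorem exists_isSmall (hd : 0 < specDist α β) (hδ : 0 < δ)
    (hB : hilbertSchmidtNorm B.adjoint <
      ENNReal.ofReal (specDist α β * min (1 / (1 + δ)) (δ / (1 + δ ^ 2)))) :
    ∃ h, IsSmall B h δ := by
  have hfin : hilbertSchmidtNorm B.adjoint ≠ ∞ := (hB.trans ENNReal.ofReal_lt_top).ne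
  refine ⟨(hilbertSchmidtNorm B.adjoint).toReal, ENNReal.toReal_nonneg,
    (ENNReal.ofReal_toReal hfin).ge, hδ, ?_, ?_⟩
  · have h1 := (ENNReal.lt_ofReal_iff_toReal_lt hfin).1 hB
    have h2 := h1.trans_le (mul_le_mul_of_nonneg_left (min_le_left _ _) hd.le)
    rwa [mul_one_div, lt_div_iff₀ (by positivity)] at h2
  · have h1 := (ENNReal.lt_ofReal_iff_toReal_lt hfin).1 hB
    have h2 := h1.trans_le (mul_le_mul_of_nonneg_left (min_le_right _ _) hd.le)
    rwa [← mul_div_assoc, lt_div_iff₀ (by positivity)] at h2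

namespace IsSmall

variable (hs : IsSmall B h δ)

include hs

theorem norm_le : ‖B‖ ≤ h := by
  rw [← LinearIsometryEquiv.norm_map (ContinuousLinearMap.adjoint (𝕜 := ℂ)) B]
  exact norm_le_of_hilbertSchmidtNorm_le hs.nonneg hs.le

theorem gap_pos : 0 < specDist α β - h * δ := by
  have := hs.lt
  have := hs.nonneg
  nlinarith

theorem norm_comp_le (hQ : ‖Q‖ ≤ δ) : ‖B.adjoint ∘L Q‖ ≤ h * δ := by
  refine (ContinuousLinearMap.opNorm_comp_le _ _).trans ?_
  rw [LinearIsometryEquiv.norm_map]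
  exact mul_le_mul hs.norm_le hQ (norm_nonneg _) hs.nonneg

theorem norm_comp_le' (hQ : ‖Q‖ ≤ δ) : ‖B ∘L (-Q.adjoint)‖ ≤ h * δ := by
  refine (ContinuousLinearMap.opNorm_comp_le _ _).trans ?_
  rw [norm_neg, LinearIsometryEquiv.norm_map]
  exact mul_le_mul hs.norm_le hQ (norm_nonneg _) hs.nonneg

/-- The unique resolvents of `A + B* Q` obey the Neumann bound. -/
theorem norm_resolvent_le (hd : 0 < specDist α β) (hQ : ‖Q‖ ≤ δ) {R : α.Space →L[ℂ] α.Space}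
    {μ : ℝ} (hμ : μ ∈ β.spec) (hR : IsResolvent (perturbed α (B.adjoint ∘L Q)) (μ : ℂ) R) :
    ‖R‖ ≤ 1 / (specDist α β - h * δ) := by
  have hW := hs.norm_comp_le hQ
  have hgap := hs.gap_pos
  obtain ⟨K, -, hK⟩ := exists_resolvents (D := β) hd (hW.trans_lt (by linarith))
  obtain ⟨R', hR', hn, -⟩ := hK μ hμ
  rw [hR.unique hR']
  exact hn.trans (one_div_le_one_div_of_le hgap (by linarith))

theorem exists_image (hd : 0 < specDist α β) (hB : ∀ f, ∀ᶠ x in β.aeFilter, β.val (B f) x = r x f)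
    (hQ : ‖Q‖ ≤ δ) : ∃ X, IsBasicImage B Q X := by
  have hW := hs.norm_comp_le hQ
  have hgap := hs.gap_pos
  obtain ⟨K, -, hK⟩ := exists_resolvents (D := β) hd (hW.trans_lt (by linarith))
  choose! R hR hn hn' using hK
  obtain ⟨X, hX⟩ := exists_isSpectralIntegral hB hs.nonneg hs.le
    (fun x hx y hy => norm_resolvent_sub_le (hR x hx) (hR y hy) (hn x hx) (hn y hy)) hn'
  exact ⟨X, R, hR, hX⟩

/-- The ball of radius `δ` is mapped into itself. -/
theorem norm_image_le (hd : 0 < specDist α β)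
    (hB : ∀ f, ∀ᶠ x in β.aeFilter, β.val (B f) x = r x f) (hQ : ‖Q‖ ≤ δ)
    (hX : IsBasicImage B Q X) : ‖X‖ ≤ δ := by
  obtain ⟨R, hR, hX⟩ := hX
  have hgap := hs.gap_pos
  have h1 := hX.norm_sub_le hB hs.nonneg hs.le (isSpectralIntegral_zero hB)
    (K := 1 / (specDist α β - h * δ)) (by positivity) fun x hx => by
      rw [sub_zero]
      exact hs.norm_resolvent_le hd hQ hx (hR x hx)
  rw [sub_zero, mul_one_div] at h1
  refine h1.trans ?_
  rw [div_le_iff₀ hgap]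
  linarith [hs.lt']

/-- The contraction estimate. -/
theorem norm_image_sub_le (hd : 0 < specDist α β)
    (hB : ∀ f, ∀ᶠ x in β.aeFilter, β.val (B f) x = r x f) (hQ : ‖Q‖ ≤ δ) (hQ' : ‖Q'‖ ≤ δ)
    (hX : IsBasicImage B Q X) (hX' : IsBasicImage B Q' X') :
    ‖X - X'‖ ≤ (h / (specDist α β - h * δ)) ^ 2 * ‖Q - Q'‖ := by
  obtain ⟨R, hR, hX⟩ := hX
  obtain ⟨R', hR', hX'⟩ := hX'
  have hgap := hs.gap_pos
  set e := specDist α β - h * δ with he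
  have hh := hs.nonneg
  have h1 := hX.norm_sub_le hB hs.nonneg hs.le hX' (K := 1 / e * (h * ‖Q - Q'‖ * (1 / e)))
    (by positivity) fun x hx => by
      rw [resolvent_sub' (hR x hx) (hR' x hx)]
      have hW : ‖B.adjoint ∘L Q' - B.adjoint ∘L Q‖ ≤ h * ‖Q - Q'‖ := by
        rw [← ContinuousLinearMap.comp_sub, norm_sub_rev Q]
        refine (ContinuousLinearMap.opNorm_comp_le _ _).trans ?_
        rw [LinearIsometryEquiv.norm_map]
        exact mul_le_mul_of_nonneg_right hs.norm_le (norm_nonneg _)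
      have e1 := hs.norm_resolvent_le hd hQ hx (hR x hx)
      have e2 := hs.norm_resolvent_le hd hQ' hx (hR' x hx)
      refine (ContinuousLinearMap.opNorm_comp_le _ _).trans ?_
      refine mul_le_mul e1 ?_ (norm_nonneg _) (by positivity)
      refine (ContinuousLinearMap.opNorm_comp_le _ _).trans ?_
      exact mul_le_mul hW e2 (norm_nonneg _) (by positivity)
  refine h1.trans_eq ?_
  ring

theorem factor_lt_one : (h / (specDist α β - h * δ)) ^ 2 < 1 := by
  have hgap := hs.gap_pos
  have hh := hs.nonneg
  have h1 : h / (specDist α β - h * δ) < 1 := by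
    rw [div_lt_one hgap]
    linarith [hs.lt]
  exact pow_lt_one₀ (by positivity) h1 two_ne_zero

theorem eq_of_solution (hd : 0 < specDist α β)
    (hB : ∀ f, ∀ᶠ x in β.aeFilter, β.val (B f) x = r x f) (hQ : ‖Q‖ ≤ δ) (hQ' : ‖Q'‖ ≤ δ)
    (hX : IsBasicSolution B Q) (hX' : IsBasicSolution B Q') : Q' = Q := by
  have h1 := hs.norm_image_sub_le hd hB hQ hQ' hX hX'
  have h2 := hs.factor_lt_one
  have h3 : ‖Q - Q'‖ = 0 := by nlinarith [norm_nonneg (Q - Q')]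
  exact (sub_eq_zero.1 (norm_eq_zero.1 h3)).symm

theorem exists_solution (hd : 0 < specDist α β)
    (hB : ∀ f, ∀ᶠ x in β.aeFilter, β.val (B f) x = r x f) :
    ∃ Q, ‖Q‖ ≤ δ ∧ IsBasicSolution B Q := by
  have hex : ∀ Q : α.Space →L[ℂ] β.Space, ‖Q‖ ≤ δ → ∃ X, IsBasicImage B Q X :=
    fun Q hQ => hs.exists_image hd hB hQ
  choose! F hF using hex
  obtain ⟨Q, hQ, hQF⟩ := exists_fixedPoint_of_norm_le (F := F) hs.pos.le (sq_nonneg _)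
    hs.factor_lt_one (fun Q hQ => hs.norm_image_le hd hB hQ (hF Q hQ))
    fun Q Q' hQ hQ' => hs.norm_image_sub_le hd hB hQ hQ' (hF Q hQ) (hF Q' hQ')
  have h1 := hF Q hQ
  rw [hQF] at h1
  exact ⟨Q, hQ, h1⟩

/-- The resolvent estimates of the first part hold for small perturbations, with some constants. -/
theorem exists_resolventBound (hd : 0 < specDist α β) (hQ : ‖Q‖ ≤ δ) :
    ∃ K K' : ℝ, 0 < K ∧ 0 < K' ∧ ResolventBound α β (B.adjoint ∘L Q) K ∧
      ResolventBound β α (B ∘L (-Q.adjoint)) K' := by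
  have hgap := hs.gap_pos
  obtain ⟨K, hK0, hK⟩ := exists_resolvents (D := β) hd
    ((hs.norm_comp_le hQ).trans_lt (by linarith))
  have hd' : 0 < specDist β α := by rwa [specDist_comm]
  obtain ⟨K', hK'0, hK'⟩ := exists_resolvents (D := α) hd'
    ((hs.norm_comp_le' hQ).trans_lt (by rw [specDist_comm]; linarith))
  refine ⟨K, K', hK0, hK'0, fun μ hμ => ?_, fun μ hμ => ?_⟩
  · obtain ⟨R, hR, -, hn⟩ := hK μ hμ
    exact ⟨R, hR, hn⟩
  · obtain ⟨R, hR, -, hn⟩ := hK' μ hμ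
    exact ⟨R, hR, hn⟩

end IsSmall

end FixedPoint

/-! ### The constants -/

section Constants

variable {C : Channel.{u}} {θ : ℝ}

theorem mass_sq : C.mass θ ^ 2 = (weightNorm θ + 1) ^ 2 * (1 + C.disc.card) := by
  rw [mass, mul_pow, Real.sq_sqrt (by positivity)]

variable {α : Channel.{u}} {β : Channel.{v}} {B : α.Space →L[ℂ] β.Space} {b : Kernel β α}
  {γ M : ℝ}

theorem norm_le_of_holderBound (hθ : 1 / 2 < θ) (hγ : 0 < γ) (hM : 0 ≤ M)
    (hB : IsIntegralOperator B b) (hb : b.HolderBound θ γ M) :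
    ‖B‖ ≤ M * α.mass θ * β.mass θ :=
  norm_le_of_val_eq hθ (mul_nonneg hM mass_pos.le) (hb.rowBound hθ hγ hM).bound
    (hb.val_eq_row hθ hγ hM hB)

theorem ofReal_le_ofReal_mul_add {N X Y : ℝ} {η : ℝ≥0∞} (hη : η ≠ ∞) (hN : 0 ≤ N) (hY : 0 ≤ Y)
    (h : X ≤ N * (η.toReal + Y * η.toReal ^ 3)) :
    ENNReal.ofReal X ≤ ENNReal.ofReal N * (η + ENNReal.ofReal Y * η ^ 3) := by
  have e : η + ENNReal.ofReal Y * η ^ 3 = ENNReal.ofReal (η.toReal + Y * η.toReal ^ 3) := by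
    rw [ENNReal.ofReal_add ENNReal.toReal_nonneg (by positivity), ENNReal.ofReal_mul hY,
      ENNReal.ofReal_pow ENNReal.toReal_nonneg, ENNReal.ofReal_toReal hη]
  rw [e, ← ENNReal.ofReal_mul hN]
  exact ENNReal.ofReal_le_ofReal h

end Constants

end Friedrichs

end

open Friedrichs in
theorem mainTheorem10 (θ : ℝ) (hθ : 1 / 2 < θ) :
    ∃ c : ℝ, 0 < c ∧
      ∀ (α : Friedrichs.Channel.{u}) (β : Friedrichs.Channel.{v}) (γ : ℝ),
        1 / 2 < γ → γ < 1 → 0 < Friedrichs.specDist α β →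
        ∀ (B : α.Space →L[ℂ] β.Space) (b : Friedrichs.Kernel β α),
          Friedrichs.IsIntegralOperator B b → b.InClass θ γ →
          (∀ (Q : α.Space →L[ℂ] β.Space) (Kαβ Kβα : ℝ),
            0 < Kαβ → 0 < Kβα →
            Friedrichs.IsBasicSolution B Q →
            Friedrichs.ResolventBound α β (B.adjoint ∘L Q) Kαβ →
            Friedrichs.ResolventBound β α (B ∘L (-Q.adjoint)) Kβα →
            (∃ q : Friedrichs.Kernel β α,
              Friedrichs.IsIntegralOperator Q q ∧ q.InClass θ γ ∧
              q.holderNorm θ γ ≤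
                ENNReal.ofReal (c / Friedrichs.specDist α β *
                    (1 + (Friedrichs.specDist α β) ^ (-γ)) ^ 2) *
                  (b.holderNorm θ γ +
                    ENNReal.ofReal ((1 + (α.disc.card : ℝ)) * (1 + (β.disc.card : ℝ)) *
                      (Kαβ + Kαβ ^ (1 + γ)) * (Kβα + Kβα ^ (1 + γ))) *
                    b.holderNorm θ γ ^ 3)) ∧
            (∃ w : Friedrichs.Kernel α α,
              Friedrichs.IsIntegralOperator (B.adjoint ∘L Q) w ∧ w.InClass θ γ ∧
              w.holderNorm θ γ ≤
                ENNReal.ofReal (c * (1 + (β.disc.card : ℝ)) * (Kβα + Kβα ^ (1 + γ))) *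
                  b.holderNorm θ γ ^ 2)) ∧
          (∀ δ : ℝ, 0 < δ →
            Friedrichs.hilbertSchmidtNorm B.adjoint <
              ENNReal.ofReal (Friedrichs.specDist α β * min (1 / (1 + δ)) (δ / (1 + δ ^ 2))) →
            ∃ Q : α.Space →L[ℂ] β.Space,
              ‖Q‖ ≤ δ ∧ Friedrichs.IsBasicSolution B Q ∧
              (∀ Q' : α.Space →L[ℂ] β.Space,
                ‖Q'‖ ≤ δ → Friedrichs.IsBasicSolution B Q' → Q' = Q) ∧
              (∃ q : Friedrichs.Kernel β α,
                Friedrichs.IsIntegralOperator Q q ∧ q.InClass θ γ) ∧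
              ∃ w : Friedrichs.Kernel α α,
                Friedrichs.IsIntegralOperator (B.adjoint ∘L Q) w ∧ w.InClass θ γ) := by
  have hm1 : 1 ≤ weightNorm θ + 1 := by linarith [weightNorm_nonneg θ]
  set m := weightNorm θ + 1 with hm
  have hm2 : m ^ 2 ≤ m ^ 4 := pow_le_pow_right₀ hm1 (by norm_num)
  have hm4 : 1 ≤ m ^ 4 := one_le_pow₀ hm1
  -- `64 = 4 ^ 3`: one `4` for the four parts of the norm, one for the division by the difference of
  -- the variables, one for the two resolvent factors; `m ^ 4` comes from the masses of the channels
  refine ⟨64 * m ^ 4, by positivity, fun α β γ hγ0 hγ1 hd B b hB hbc => ?_⟩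
  have hγ : 0 < γ := by linarith
  have hb := Kernel.inClass_holderBound hbc hγ
  have hη : b.holderNorm θ γ ≠ ∞ := hbc.ne
  set M := (b.holderNorm θ γ).toReal with hMdef
  have hM : 0 ≤ M := ENNReal.toReal_nonneg
  have hBn := norm_le_of_holderBound hθ hγ hM hB hb
  have hα0 := Channel.mass_pos (C := α) (θ := θ)
  have hβ0 := Channel.mass_pos (C := β) (θ := θ)
  have hαm := mass_sq (C := α) (θ := θ)
  have hβm := mass_sq (C := β) (θ := θ)
  rw [← hm] at hαm hβm
  refine ⟨fun Q K K' hK hK' hQ hRα hRβ => ?_, fun δ hδ hHS => ?_⟩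
  · obtain ⟨⟨q, hqi, hqb⟩, w, hwi, hwb⟩ :=
      exists_kernels hd hθ hγ hγ1.le hM hB hb hQ hK hK' hRα hRβ
    have hρ := resolventFactor_nonneg (γ := γ) hK
    have hρ' := resolventFactor_nonneg (γ := γ) hK'
    refine ⟨⟨q, hqi, hqb.inClass (by positivity), ?_⟩, w, hwi, hwb.inClass (by positivity), ?_⟩
    · refine (hqb.holderNorm_le (by positivity)).trans ?_
      set d := specDist α β with hdd
      set e := d ^ (-γ) with he
      set k := K + K ^ (1 + γ) with hk
      set k' := K' + K' ^ (1 + γ) with hk'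
      have hk0 : 0 ≤ k := by positivity
      have hk'0 : 0 ≤ k' := by positivity
      refine ofReal_le_ofReal_mul_add hη (by positivity) (by positivity) ?_
      rw [← hMdef]
      have h1 : M + M * α.mass θ * resolventFactor γ K *
          (M * β.mass θ * resolventFactor γ K' * ‖B‖) ≤
          4 * m ^ 4 * (M + (1 + (α.disc.card : ℝ)) * (1 + (β.disc.card : ℝ)) * k * k' * M ^ 3) := by
        have h2 : M * α.mass θ * resolventFactor γ K *
            (M * β.mass θ * resolventFactor γ K' * ‖B‖) ≤
            M * α.mass θ * resolventFactor γ K *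
            (M * β.mass θ * resolventFactor γ K' * (M * α.mass θ * β.mass θ)) := by
          gcongr
        have h3 : M * α.mass θ * resolventFactor γ K *
            (M * β.mass θ * resolventFactor γ K' * (M * α.mass θ * β.mass θ)) =
            4 * m ^ 4 * ((1 + (α.disc.card : ℝ)) * (1 + (β.disc.card : ℝ)) * k * k' * M ^ 3) := by
          have e1 : M * α.mass θ * resolventFactor γ K *
            (M * β.mass θ * resolventFactor γ K' * (M * α.mass θ * β.mass θ)) =
            α.mass θ ^ 2 * β.mass θ ^ 2 * resolventFactor γ K * resolventFactor γ K' * M ^ 3 := by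
            ring
          rw [e1, hαm, hβm, resolventFactor, resolventFactor, ← hk, ← hk']
          ring
        have h4 : M ≤ 4 * m ^ 4 * M := le_mul_of_one_le_left hM (by linarith)
        rw [mul_add]
        linarith
      have h5 : 0 ≤ 16 * (1 / d * (1 + e) ^ 2) := by positivity
      have h6 := mul_le_mul_of_nonneg_left h1 h5
      refine le_trans (le_of_eq ?_) (h6.trans_eq ?_)
      · ring
      · ring
    · refine (hwb.holderNorm_le (by positivity)).trans ?_
      set k' := K' + K' ^ (1 + γ) with hk'
      have hk'0 : 0 ≤ k' := by positivity
      rw [← ENNReal.ofReal_toReal hη, ← hMdef, ← ENNReal.ofReal_pow hM,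
        ← ENNReal.ofReal_mul (by positivity)]
      refine ENNReal.ofReal_le_ofReal ?_
      have e1 : 4 * (M * β.mass θ * (M * β.mass θ * resolventFactor γ K')) =
          8 * m ^ 2 * ((1 + (β.disc.card : ℝ)) * k' * M ^ 2) := by
        have e2 : 4 * (M * β.mass θ * (M * β.mass θ * resolventFactor γ K')) =
          4 * (β.mass θ ^ 2 * resolventFactor γ K' * M ^ 2) := by ring
        rw [e2, hβm, resolventFactor, ← hk']
        ring
      have h1 : 0 ≤ (1 + (β.disc.card : ℝ)) * k' * M ^ 2 := by positivity
      rw [e1]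
      have h2 := mul_le_mul_of_nonneg_right
        (show 8 * m ^ 2 ≤ 64 * m ^ 4 by linarith [sq_nonneg m]) h1
      refine h2.trans_eq ?_
      ring
  · obtain ⟨h, hs⟩ := exists_isSmall hd hδ hHS
    have hrB := hb.val_eq_row hθ hγ hM hB
    obtain ⟨Q, hQδ, hQ⟩ := hs.exists_solution hd hrB
    obtain ⟨K, K', hK, hK', hRα, hRβ⟩ := hs.exists_resolventBound hd hQδ
    obtain ⟨⟨q, hqi, hqb⟩, w, hwi, hwb⟩ :=
      exists_kernels hd hθ hγ hγ1.le hM hB hb hQ hK hK' hRα hRβ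
    have hρ := resolventFactor_nonneg (γ := γ) hK
    have hρ' := resolventFactor_nonneg (γ := γ) hK'
    exact ⟨Q, hQδ, hQ, fun Q' hQ'δ hQ' => hs.eq_of_solution hd hrB hQδ hQ'δ hQ hQ',
      ⟨q, hqi, hqb.inClass (by positivity)⟩, w, hwi, hwb.inClass (by positivity)⟩
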